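/- **Setting.** Let $d,N\ge 1$, $\beta,\lambda,\mu>0$, let $\gamma(\mathbf v)=(\beta/2\pi)^{dN/2}e^{-\beta|\mathbf v|^2/2}$ on $\mathbb R^{dN}$ and let $\gamma_1$ be the same Maxwellian on $\mathbb R^d$. Let $\rho$ be a Borel probability measure on the unit sphere $\mathbb S^{d-1}$ with $\int\sigma\otimes\sigma\,d\rho(\sigma)=\frac1d\mathbb 1$. For $v,w\in\mathbb R^d$ put $v^*_\sigma=v-(\sigma\cdot(v-w))\sigma$ and $w^*_\sigma=w+(\sigma\cdot(v-w))\sigma$. Define $$Qf(\mathbf v)=\tbinom N2^{-1}\sum_{i<j}\int f(\dots,(v_i)^*_\sigma,\dots,(v_j)^*_\sigma,\dots)\,d\rho(\sigma)$$ (where particles $i$ and $j$ collide; $Q=\mathbb 1$ if $N=1$), $R=\frac1N\sum_j R_j$ and $T=\frac1N\sum_jT_j$ with $$R_jf(\mathbf v)=\int_{\mathbb R^d}\!dw\int\! d\rho(\sigma)\,\gamma_1(w^*_\sigma)\,f(\dots,(v_j)^*_\sigma,\dots),\qquad T_jh(\mathbf v)=\int_{\mathbb R^d}\!\gamma_1(w)\,dw\int\!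 d\rho(\sigma)\,h(\dots,(v_j)^*_\sigma,\dots),$$ where particle $j$ collides with the thermostat velocity $w$. Let $\mathcal L=\lambda N(Q-\mathbb 1)+\mu N(R-\mathbb 1)$ and $\mathcal L'=\lambda N(Q-\mathbb 1)+\mu N(T-\mathbb 1)$. Solutions of the Kac master equation $\frac{d}{dt}f_t=\mathcal Lf_t$ are understood in $L^1(d\mathbf v)$, and solutions of the transformed equation $\frac{d}{dt}h_t=\mathcal L'h_t$ in $L^1(\gamma\,d\mathbf v)$, for $t\ge0$. Let $$S(f|\gamma)=\int f\ln\frac f\gamma\,d\mathbf v,\qquad I(h)=\int\frac{|\nabla h|^2}{h}\,\gamma\,d\mathbf v,\qquad P_sh(\mathbf v)=\int h\big(e^{-s}\mathbf v+\sqrt{1-e^{-2s}}\,\mathbf x\big)\gamma(\mathbf x)\,d\mathbf x,$$ where $\nabla$ is the weak gradient. **Theorem.** Let $(f_t)_{t\ge0}$ be a solution of the Kac master equation such that $f_0$ is a probability density with $\int|\mathbf v|^2f_0\,d\mathbf v<\infty$, put $h_t=f_t/\gamma$, and assume $\sqrt{h_0}\in H^1(\gamma\,d\mathbf v)$. Let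 $c:[0,\infty)\to\mathbb R$ and $t\ge0$. Then $f_0\ln(f_0/\gamma)$ and $f_t\ln(f_t/\gamma)$ are integrable, and: 1. If for every $s\ge0$ every solution $(g_\tau)_{\tau\ge0}$ of the transformed equation with $g_0=P_sh_0$ satisfies $I(g_t)\le c(t)\,I(g_0)$ (that is, $I(e^{t\mathcal L'}P_sh_0)\le c(t)\,I(P_sh_0)$ for all $s\ge0$, which for $s=0$ reads $I(h_t)\le c(t)I(h_0)$), then $$S(f_t|\gamma)\le c(t)\,S(f_0|\gamma).$$ 2. In particular, the same conclusion holds if $I(g_t)\le c(t)\,I(g_0)$ for every solution $(g_\tau)_{\tau\ge0}$ of the transformed equation for which $g_0$ is a probability density with respect to $\gamma\,d\mathbf v$ with $\sqrt{g_0}\in H^1(\gamma\,d\mathbf v)$ and $\int|\mathbf v|^2g_0\,\gamma\,d\mathbf v<\infty$. -/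

import Mathlib

open MeasureTheory Filter Topology
open scoped ContDiff InnerProductSpace

noncomputable section

namespace KacThermostat

/-- Velocity space of one particle, `ℝ^d` with the Euclidean norm. -/
abbrev Vel (d : ℕ) : Type := EuclideanSpace ℝ (Fin d)

/-- Master vectors `(v_1, …, v_N)`, i.e. `ℝ^{dN}` with the Euclidean norm and Lebesgue measure. -/
abbrev State (d N : ℕ) : Type := PiLp 2 (fun _ : Fin N => Vel d)

section Space

variable {E : Type*} [NormedAddCommGroup E] [InnerProductSpace ℝ E] [FiniteDimensional ℝ E]
  [MeasurableSpace E] [BorelSpace E]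

/-- The Maxwellian `(β / 2π)^{n/2} exp (-β |v|² / 2)` on a Euclidean space of dimension `n`. -/
def maxwell (β : ℝ) (v : E) : ℝ :=
  (β / (2 * Real.pi)) ^ ((Module.finrank ℝ E : ℝ) / 2) * Real.exp (-(β / 2) * ‖v‖ ^ 2)

variable (E) in
/-- The Gaussian measure `γ(v) dv`. -/
def gauss (β : ℝ) : Measure E :=
  (volume : Measure E).withDensity fun v => ENNReal.ofReal (maxwell β v)

/-- `G` is the weak (distributional) gradient of `u`. -/
def IsWeakGradient (u : E → ℝ) (G : E → E) : Prop :=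
  LocallyIntegrable u volume ∧ LocallyIntegrable G volume ∧
    ∀ φ : E → ℝ, ContDiff ℝ ∞ φ → HasCompactSupport φ → ∀ e : E,
      ∫ v, u v * fderiv ℝ φ v e = - ∫ v, ⟪G v, e⟫_ℝ * φ v

open Classical in
/-- The weak gradient (unique up to null sets); `0` if there is none. -/
def weakGradient (u : E → ℝ) : E → E :=
  if h : ∃ G, IsWeakGradient u G then h.choose else 0

/-- `u` belongs to the Sobolev space `H¹` with respect to the Gaussian measure. -/
def MemH1Gauss (β : ℝ) (u : E → ℝ) : Prop :=
  MemLp u 2 (gauss E β) ∧ ∃ G : E → E, IsWeakGradient u G ∧ MemLp G 2 (gauss E β)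

/-- Fisher information `∫ |∇h|² / h γ dv` with respect to the Gaussian measure. The integrand
is integrable as soon as `√h` is in `H¹(γ dv)`. -/
def fisherInfo (β : ℝ) (h : E → ℝ) : ℝ :=
  ∫ v, ‖weakGradient h v‖ ^ 2 / h v ∂(gauss E β)

/-- The integrand `f ln (f / γ)` of the relative entropy. -/
def entropyIntegrand (β : ℝ) (f : E → ℝ) (v : E) : ℝ :=
  f v * Real.log (f v / maxwell β v)

/-- Relative entropy `S(f|γ) = ∫ f ln (f / γ) dv`. -/
def relEntropy (β : ℝ) (f : E → ℝ) : ℝ :=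
  ∫ v, entropyIntegrand β f v

/-- Ornstein-Uhlenbeck semigroup, `P_s h (v) = ∫ h (e^{-s} v + √(1 - e^{-2s}) x) γ(x) dx`. -/
def ornsteinUhlenbeck (β s : ℝ) (h : E → ℝ) (v : E) : ℝ :=
  ∫ x, h (Real.exp (-s) • v + √(1 - Real.exp (-2 * s)) • x) ∂(gauss E β)

/-- `f` is a probability density with respect to `m`. -/
def IsProbDensity (m : Measure E) (f : E → ℝ) : Prop :=
  0 ≤ᵐ[m] f ∧ Integrable f m ∧ ∫ v, f v ∂m = 1

/-- `(f_t)_{t ≥ 0}` solves `d/dt f_t = A f_t` in `L¹(m)`: every `f_t` is in `L¹(m)`, and the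
difference quotients at every `t ≥ 0` (one-sided at `t = 0`) converge to `A f_t` in `L¹(m)`. -/
def IsL1Solution (m : Measure E) (A : (E → ℝ) → E → ℝ) (f : ℝ → E → ℝ) : Prop :=
  (∀ t, 0 ≤ t → Integrable (f t) m) ∧
    ∀ t, 0 ≤ t →
      Tendsto (fun s => eLpNorm (fun v => (s - t)⁻¹ * (f s v - f t v) - A (f t) v) 1 m)
        (𝓝[Set.Ici 0 \ {t}] t) (𝓝 0)

end Space

variable {d N : ℕ}

/-- Scattering directions, the unit sphere of `ℝ^d`. -/
abbrev Direction (d : ℕ) : Type := Metric.sphere (0 : Vel d) 1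

/-- The condition `∫ σ ⊗ σ dρ(σ) = (1/d) 1`, entrywise. -/
def SymmetryCondition (ρ : Measure (Direction d)) : Prop :=
  ∀ k l : Fin d, ∫ σ : Direction d, (σ : Vel d) k * (σ : Vel d) l ∂ρ =
    if k = l then 1 / (d : ℝ) else 0

/-- First velocity after the collision of `v` and `w`: `v - (σ·(v - w)) σ`. -/
def collideFst (σ : Direction d) (v w : Vel d) : Vel d :=
  v - ⟪(σ : Vel d), v - w⟫_ℝ • (σ : Vel d)

/-- Second velocity after the collision of `v` and `w`: `w + (σ·(v - w)) σ`. -/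
def collideSnd (σ : Direction d) (v w : Vel d) : Vel d :=
  w + ⟪(σ : Vel d), v - w⟫_ℝ • (σ : Vel d)

/-- Replace the velocity of particle `j` by `a`. -/
def setVel (v : State d N) (j : Fin N) (a : Vel d) : State d N :=
  WithLp.toLp 2 (Function.update v.ofLp j a)

/-- Collision of the particles `i` and `j` of the system. -/
def collidePair (σ : Direction d) (i j : Fin N) (v : State d N) : State d N :=
  setVel (setVel v i (collideFst σ (v i) (v j))) j (collideSnd σ (v i) (v j))

/-- Average over the pair collisions inside the system; the identity if there is only one
particle (and hence no pair). -/
def opQ (ρ : Measure (Direction d)) (f : State d N → ℝ) (v : State d N) : ℝ :=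
  if N ≤ 1 then f v
  else ((N.choose 2 : ℕ) : ℝ)⁻¹ *
    ∑ i : Fin N, ∑ j ∈ Finset.Ioi i, ∫ σ, f (collidePair σ i j v) ∂ρ

/-- Interaction of particle `j` with a thermostat particle, acting on densities. -/
def opRj (β : ℝ) (ρ : Measure (Direction d)) (j : Fin N) (f : State d N → ℝ)
    (v : State d N) : ℝ :=
  ∫ w : Vel d, ∫ σ, maxwell β (collideSnd σ (v j) w) * f (setVel v j (collideFst σ (v j) w)) ∂ρ

/-- `R = (1/N) ∑ R_j`. -/
def opR (β : ℝ) (ρ : Measure (Direction d)) (f : State d N → ℝ) (v : State d N) : ℝ :=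
  (N : ℝ)⁻¹ * ∑ j : Fin N, opRj β ρ j f v

/-- Interaction of particle `j` with a thermostat particle, acting on `h = f / γ`. -/
def opTj (β : ℝ) (ρ : Measure (Direction d)) (j : Fin N) (h : State d N → ℝ)
    (v : State d N) : ℝ :=
  ∫ w : Vel d, maxwell β w * ∫ σ, h (setVel v j (collideFst σ (v j) w)) ∂ρ

/-- `T = (1/N) ∑ T_j`. -/
def opT (β : ℝ) (ρ : Measure (Direction d)) (h : State d N → ℝ) (v : State d N) : ℝ :=
  (N : ℝ)⁻¹ * ∑ j : Fin N, opTj β ρ j h v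

/-- The generator `λ N (Q - 1) + μ N (R - 1)` of the Kac master equation. -/
def kacGenerator (β lam mu : ℝ) (ρ : Measure (Direction d)) (f : State d N → ℝ)
    (v : State d N) : ℝ :=
  lam * N * (opQ ρ f v - f v) + mu * N * (opR β ρ f v - f v)

/-- The generator `λ N (Q - 1) + μ N (T - 1)` of the transformed master equation. -/
def transformedGenerator (β lam mu : ℝ) (ρ : Measure (Direction d)) (h : State d N → ℝ)
    (v : State d N) : ℝ :=
  lam * N * (opQ ρ h v - h v) + mu * N * (opT β ρ h v - h v)

/-- `(f_t)_{t ≥ 0}` solves the Kac master equation in `L¹(dv)`. -/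
def IsKacSolution (β lam mu : ℝ) (ρ : Measure (Direction d)) (f : ℝ → State d N → ℝ) : Prop :=
  IsL1Solution volume (kacGenerator β lam mu ρ) f

/-- `(h_t)_{t ≥ 0}` solves the transformed master equation in `L¹(γ dv)`. -/
def IsTransformedSolution (β lam mu : ℝ) (ρ : Measure (Direction d))
    (h : ℝ → State d N → ℝ) : Prop :=
  IsL1Solution (gauss (State d N) β) (transformedGenerator β lam mu ρ) h

/-- Ground state transformation `h_t = f_t / γ`. -/
def groundState (β : ℝ) (f : ℝ → State d N → ℝ) (t : ℝ) (v : State d N) : ℝ :=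
  f t v / maxwell β v

/-- Admissible initial data of the transformed equation: `h` is a probability density with
respect to `γ dv`, `√h` is in `H¹(γ dv)`, and the kinetic energy is finite. -/
def IsAdmissible (β : ℝ) (h : State d N → ℝ) : Prop :=
  IsProbDensity (gauss (State d N) β) h ∧ MemH1Gauss β (fun v => √(h v)) ∧
    Integrable (fun v => ‖v‖ ^ 2 * h v) (gauss (State d N) β)

end KacThermostat

end

open MeasureTheory KacThermostat

open MeasureTheory Filter Topology
open scoped ContDiff InnerProductSpace
open InformationTheory

set_option linter.unusedSectionVars false

noncomputable section

/-! The Ornstein-Uhlenbeck semigroup `P_s` turns entropy into an integral of Fisher informations,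
and it commutes with the dynamics. De Bruijn's identity says `d/ds Ent(P_s h) = -(1/β) I(P_s h)`,
and `P_s h` relaxes to its mean, so a density satisfies `S(f|γ) = (1/β) ∫_0^∞ I(P_s h) ds` with `h =
f/γ`. A collision is an orthogonal map of the velocities, the thermostat velocity included, and the
noise in `P_s` is a rotation invariant Gaussian; hence `P_s e^{tL'} = e^{tL'} P_s`. Thus `I(P_s h_t)
= I(e^{tL'} P_s h_0) ≤ c(t) I(P_s h_0)` for every `s > 0`, and integrating in `s` proves the claim.
The sign of `c(t)` plays no role.

Entropy is handled as `∫ klFun h dγ` with `klFun x = x log x + 1 - x`, which is convex and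
nonnegative on `[0,∞)`; for a density this is the relative entropy (`relEntropy_eq`).

Commutation: the pair collisions, the `T_j` and `P_s` all average over a random displacement that
preserves `γ` (`avg`). Such averages commute as soon as a measure preserving change of the noise
interchanges the displacements (`avg_comm`); this gives `commute_ouL1_pairL1` and
`commute_ouL1_thermostatL1`. By Jensen the same averages do not raise the entropy, so `h_t` inherits
finite entropy from `h_0` (`IsTransformedSolution.isProbDensity`).

De Bruijn: for `C¹` functions with bounded gradient and values in `[ε, M]`, the dissipation is
computed from increments of size `√s`, with first derivatives only (`IsNice.tendsto_entropy_slope`,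
`IsNice.entropy_eq_integral`). Truncation extends the identity to all densities of finite entropy,
along the flow started at a time `s > 0` (`FiniteEntropy.entropy_ou`). Lower semicontinuity and
Jensen then allow `s → 0` in the entropies (`tendsto_entropy_ou`).

Finite initial entropy: decay of the information along `P_s` makes de Bruijn's identity a
logarithmic Sobolev inequality (`IsNice.entropy_le`). Applied to squares of smoothed cut-offs of
`√h_0`, with Fatou's lemma, it bounds the entropy of `h_0` (`integrable_klFun_of_memH1`).

The second claim follows in the same way, because `P_s h_0` is admissible for every `s > 0`. -/

namespace KacThermostat

/-! ### The Gaussian measure: normalisation, rotation invariance, moments -/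

section GaussBasics

variable {E : Type*} [NormedAddCommGroup E] [InnerProductSpace ℝ E] [FiniteDimensional ℝ E]
  [MeasurableSpace E] [BorelSpace E]
variable {F : Type*} [NormedAddCommGroup F] [InnerProductSpace ℝ F] [FiniteDimensional ℝ F]
  [MeasurableSpace F] [BorelSpace F]

/-- The normalising constant of the Maxwellian. -/
def maxwellConst (E : Type*) [NormedAddCommGroup E] [InnerProductSpace ℝ E] (β : ℝ) : ℝ :=
  (β / (2 * Real.pi)) ^ ((Module.finrank ℝ E : ℝ) / 2)

lemma maxwellConst_pos {β : ℝ} (hβ : 0 < β) : 0 < maxwellConst E β := by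
  unfold maxwellConst; positivity

lemma maxwell_eq (β : ℝ) (v : E) :
    maxwell β v = maxwellConst E β * Real.exp (-(β / 2) * ‖v‖ ^ 2) := rfl

lemma maxwell_pos {β : ℝ} (hβ : 0 < β) (v : E) : 0 < maxwell β v :=
  mul_pos (maxwellConst_pos hβ) (Real.exp_pos _)

lemma continuous_maxwell (β : ℝ) : Continuous (maxwell β : E → ℝ) := by
  unfold maxwell; fun_prop

lemma measurable_maxwell (β : ℝ) : Measurable (maxwell β : E → ℝ) :=
  (continuous_maxwell β).measurable

lemma maxwell_congr_norm {β : ℝ} {v w : E} (h : ‖v‖ = ‖w‖) : maxwell β v = maxwell β w := by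
  simp [maxwell, h]

lemma integrable_exp_neg_mul_sq_norm {b : ℝ} (hb : 0 < b) :
    Integrable (fun v : E => Real.exp (-b * ‖v‖ ^ 2)) := by
  have := GaussianFourier.integrable_cexp_neg_mul_sq_norm_add (V := E) (b := (b : ℂ))
    (by simpa using hb) 0 0
  have h2 := this.norm
  refine h2.congr (Eventually.of_forall fun v => ?_)
  simp [Complex.norm_exp, ← Complex.ofReal_pow]

lemma integral_maxwell {β : ℝ} (hβ : 0 < β) : ∫ v : E, maxwell β v = 1 := by
  simp only [maxwell_eq]
  rw [integral_const_mul, GaussianFourier.integral_rexp_neg_mul_sq_norm (by positivity),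
    maxwellConst, ← Real.mul_rpow (by positivity) (by positivity)]
  have : β / (2 * Real.pi) * (Real.pi / (β / 2)) = 1 := by field_simp
  rw [this, Real.one_rpow]

lemma integrable_maxwell {β : ℝ} (hβ : 0 < β) : Integrable (maxwell β : E → ℝ) := by
  simp only [funext (maxwell_eq β)]
  exact (integrable_exp_neg_mul_sq_norm (by positivity)).const_mul _

lemma isProbabilityMeasure_gauss {β : ℝ} (hβ : 0 < β) : IsProbabilityMeasure (gauss E β) := by
  constructor
  rw [gauss, withDensity_apply _ MeasurableSet.univ, setLIntegral_univ,
    ← ofReal_integral_eq_lintegral_ofReal (integrable_maxwell hβ)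
      (Eventually.of_forall fun v => (maxwell_pos hβ v).le), integral_maxwell hβ]
  simp

lemma gauss_absolutelyContinuous (β : ℝ) : gauss E β ≪ (volume : Measure E) :=
  withDensity_absolutelyContinuous _ _

lemma absolutelyContinuous_gauss {β : ℝ} (hβ : 0 < β) : (volume : Measure E) ≪ gauss E β :=
  withDensity_absolutelyContinuous' (measurable_maxwell β).ennreal_ofReal.aemeasurable
    (Eventually.of_forall fun v => by simpa using maxwell_pos hβ v)

lemma ae_gauss_iff {β : ℝ} (hβ : 0 < β) {p : E → Prop} :
    (∀ᵐ v ∂gauss E β, p v) ↔ ∀ᵐ v, p v :=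
  ⟨fun h => (absolutelyContinuous_gauss hβ).ae_le h,
    fun h => (gauss_absolutelyContinuous β).ae_le h⟩

lemma integral_gauss {G : Type*} [NormedAddCommGroup G] [NormedSpace ℝ G] {β : ℝ} (hβ : 0 < β)
    (f : E → G) : ∫ v, f v ∂gauss E β = ∫ v, maxwell β v • f v := by
  rw [gauss, integral_withDensity_eq_integral_toReal_smul
    (measurable_maxwell β).ennreal_ofReal (Eventually.of_forall fun _ => ENNReal.ofReal_lt_top)]
  simp [ENNReal.toReal_ofReal (maxwell_pos hβ _).le]

lemma integrable_gauss_iff {G : Type*} [NormedAddCommGroup G] [NormedSpace ℝ G] {β : ℝ}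
    (hβ : 0 < β) {f : E → G} :
    Integrable f (gauss E β) ↔ Integrable (fun v => maxwell β v • f v) := by
  rw [gauss, integrable_withDensity_iff_integrable_smul'
    (measurable_maxwell β).ennreal_ofReal (Eventually.of_forall fun _ => ENNReal.ofReal_lt_top)]
  simp [ENNReal.toReal_ofReal (maxwell_pos hβ _).le]

/-- A linear map of `E × F` that preserves `‖x‖² + ‖y‖²` preserves the product Gaussian. -/
lemma measurePreserving_gauss_prod {β : ℝ} (hβ : 0 < β) (L : E × F →ₗ[ℝ] E × F)
    (hL : ∀ p, ‖(L p).1‖ ^ 2 + ‖(L p).2‖ ^ 2 = ‖p.1‖ ^ 2 + ‖p.2‖ ^ 2) :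
    MeasurePreserving L ((gauss E β).prod (gauss F β)) ((gauss E β).prod (gauss F β)) := by
  have hLm : Measurable L := (LinearMap.continuous_of_finiteDimensional L).measurable
  -- `E × F` carries the sup norm. On the `L²` product the hypothesis makes `L` a linear isometry,
  -- which preserves volume; the density is a function of `‖x‖² + ‖y‖²` and is preserved as well.
  let e := WithLp.linearEquiv 2 ℝ (E × F)
  let L₀ : WithLp 2 (E × F) →ₗ[ℝ] WithLp 2 (E × F) := e.symm.toLinearMap ∘ₗ L ∘ₗ e.toLinearMap
  let L₁ : WithLp 2 (E × F) →ₗᵢ[ℝ] WithLp 2 (E × F) :=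
    { L₀ with
      norm_map' := fun x => by
        have h := hL (WithLp.ofLp x)
        rw [← sq_eq_sq₀ (norm_nonneg _) (norm_nonneg _), WithLp.prod_norm_sq_eq_of_L2,
          WithLp.prod_norm_sq_eq_of_L2]
        exact h }
  have hvol : MeasurePreserving L ((volume : Measure E).prod (volume : Measure F))
      ((volume : Measure E).prod (volume : Measure F)) := by
    have h1 := (WithLp.volume_preserving_ofLp E F).comp
      ((L₁.toLinearIsometryEquiv rfl).measurePreserving.comp (WithLp.volume_preserving_toLp E F))
    exact h1
  have hd : (gauss E β).prod (gauss F β) =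
      ((volume : Measure E).prod (volume : Measure F)).withDensity
        fun p => ENNReal.ofReal (maxwell β p.1) * ENNReal.ofReal (maxwell β p.2) := by
    rw [gauss, gauss, prod_withDensity (measurable_maxwell β).ennreal_ofReal
      (measurable_maxwell β).ennreal_ofReal]
  have hinv : ∀ p, ENNReal.ofReal (maxwell β p.1) * ENNReal.ofReal (maxwell β p.2) =
      ENNReal.ofReal (maxwell β (L p).1) * ENNReal.ofReal (maxwell β (L p).2) := by
    intro p
    rw [← ENNReal.ofReal_mul (maxwell_pos hβ _).le, ← ENNReal.ofReal_mul (maxwell_pos hβ _).le]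
    congr 1
    simp only [maxwell_eq]
    have h2 := hL p
    have : ∀ A B C D : ℝ, A * Real.exp B * (C * Real.exp D) = A * C * Real.exp (B + D) := by
      intro A B C D; rw [Real.exp_add]; ring
    rw [this, this]
    congr 2
    linear_combination (β / 2) * h2
  have hdm : Measurable fun p : E × F =>
      ENNReal.ofReal (maxwell β p.1) * ENNReal.ofReal (maxwell β p.2) :=
    ((measurable_maxwell β).comp measurable_fst).ennreal_ofReal.mul
      ((measurable_maxwell β).comp measurable_snd).ennreal_ofReal
  refine ⟨hLm, ?_⟩
  ext s hs
  rw [Measure.map_apply hLm hs, hd, withDensity_apply _ (hLm hs), withDensity_apply _ hs]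
  conv_lhs => rw [setLIntegral_congr_fun (hLm hs) (fun p _ => hinv p)]
  exact hvol.setLIntegral_comp_preimage hs hdm

lemma measurePreserving_gauss_prod_fun {β : ℝ} (hβ : 0 < β) (T : E × F → E × F)
    (hadd : ∀ p q, T (p + q) = T p + T q) (hsmul : ∀ (c : ℝ) p, T (c • p) = c • T p)
    (hT : ∀ p, ‖(T p).1‖ ^ 2 + ‖(T p).2‖ ^ 2 = ‖p.1‖ ^ 2 + ‖p.2‖ ^ 2) :
    MeasurePreserving T ((gauss E β).prod (gauss F β)) ((gauss E β).prod (gauss F β)) :=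
  measurePreserving_gauss_prod hβ
    { toFun := T, map_add' := hadd, map_smul' := hsmul } hT

/-- A norm preserving linear self-map preserves the Gaussian. -/
lemma measurePreserving_gauss {β : ℝ} (hβ : 0 < β) (T : E → E)
    (hadd : ∀ p q, T (p + q) = T p + T q) (hsmul : ∀ (c : ℝ) p, T (c • p) = c • T p)
    (hT : ∀ p, ‖T p‖ ^ 2 = ‖p‖ ^ 2) :
    MeasurePreserving T (gauss E β) (gauss E β) := by
  have := isProbabilityMeasure_gauss (E := E) hβ
  have hTm : Measurable T :=
    (LinearMap.continuous_of_finiteDimensional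
      ({ toFun := T, map_add' := hadd, map_smul' := hsmul } : E →ₗ[ℝ] E)).measurable
  -- The product statement for `T × id`, projected to the first factor.
  have h := measurePreserving_gauss_prod_fun (E := E) (F := E) hβ (fun p => (T p.1, p.2))
    (fun p q => by simp [hadd]) (fun c p => by simp [hsmul]) (fun p => by simp [hT])
  have h1 := measurePreserving_fst.comp h
  refine ⟨hTm, ?_⟩
  have h2 : MeasurePreserving (Prod.fst : E × E → E) ((gauss E β).prod (gauss E β)) (gauss E β) :=
    measurePreserving_fst
  have h3 := h1.map_eq
  rw [← h2.map_eq, Measure.map_map hTm measurable_fst]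
  conv_rhs => rw [h2.map_eq, ← h3]
  rfl

/-- `(x, y) ↦ a x + b y` with `a² + b² = 1` maps the product Gaussian to the Gaussian. -/
lemma measurePreserving_rotate {β : ℝ} (hβ : 0 < β) {a b : ℝ} (hab : a ^ 2 + b ^ 2 = 1) :
    MeasurePreserving (fun p : E × E => (a • p.1 + b • p.2, b • p.1 - a • p.2))
      ((gauss E β).prod (gauss E β)) ((gauss E β).prod (gauss E β)) := by
  refine measurePreserving_gauss_prod_fun hβ _ (fun p q => ?_) (fun c p => ?_) (fun p => ?_)
  · ext <;> simp <;> module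
  · ext <;> simp <;> module
  · simp only [norm_add_sq_real, norm_sub_sq_real, norm_smul, inner_smul_left, inner_smul_right,
      mul_pow, Real.norm_eq_abs, sq_abs, RCLike.conj_to_real]
    linear_combination (‖p.1‖ ^ 2 + ‖p.2‖ ^ 2) * hab

lemma measurePreserving_mehler {β : ℝ} (hβ : 0 < β) {a b : ℝ} (hab : a ^ 2 + b ^ 2 = 1) :
    MeasurePreserving (fun p : E × E => a • p.1 + b • p.2)
      ((gauss E β).prod (gauss E β)) (gauss E β) :=
  have := isProbabilityMeasure_gauss (E := E) hβ
  measurePreserving_fst.comp (measurePreserving_rotate hβ hab)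

lemma sq_mul_exp_neg_le {ε : ℝ} (hε : 0 < ε) (r : ℝ) :
    r ^ 2 * Real.exp (-(2 * ε) * r ^ 2) ≤ ε⁻¹ * Real.exp (-ε * r ^ 2) := by
  have h1 : ε * r ^ 2 ≤ Real.exp (ε * r ^ 2) := by
    linarith [Real.add_one_le_exp (ε * r ^ 2)]
  have h2 : r ^ 2 ≤ ε⁻¹ * Real.exp (ε * r ^ 2) := by
    rw [← div_eq_inv_mul, le_div_iff₀ hε]; linarith
  calc r ^ 2 * Real.exp (-(2 * ε) * r ^ 2)
      ≤ (ε⁻¹ * Real.exp (ε * r ^ 2)) * Real.exp (-(2 * ε) * r ^ 2) := by gcongr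
    _ = ε⁻¹ * Real.exp (-ε * r ^ 2) := by
      rw [mul_assoc, ← Real.exp_add]; congr 2; ring

lemma integrable_norm_sq_gauss {β : ℝ} (hβ : 0 < β) :
    Integrable (fun v : E => ‖v‖ ^ 2) (gauss E β) := by
  rw [integrable_gauss_iff hβ]
  have h := ((integrable_exp_neg_mul_sq_norm (E := E) (b := β / 4) (by positivity)).const_mul
    ((β / 4)⁻¹)).const_mul (maxwellConst E β)
  refine h.mono' (by
    exact ((continuous_maxwell β).smul (by fun_prop)).aestronglyMeasurable)
    (Eventually.of_forall fun v => ?_)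
  have h1 := sq_mul_exp_neg_le (ε := β / 4) (by positivity) ‖v‖
  have h2 := maxwellConst_pos (E := E) hβ
  rw [smul_eq_mul, Real.norm_of_nonneg (mul_nonneg (maxwell_pos hβ v).le (by positivity)),
    maxwell_eq, mul_assoc]
  refine mul_le_mul_of_nonneg_left ?_ h2.le
  rw [mul_comm, show -(β / 2) = -(2 * (β / 4)) by ring]
  exact h1.trans (le_of_eq (by rw [neg_mul]))

lemma integrable_norm_gauss {β : ℝ} (hβ : 0 < β) :
    Integrable (fun v : E => ‖v‖) (gauss E β) := by
  have := isProbabilityMeasure_gauss (E := E) hβ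
  refine ((integrable_norm_sq_gauss hβ).add (integrable_const (1 : ℝ))).mono'
    continuous_norm.aestronglyMeasurable (Eventually.of_forall fun v => ?_)
  simp only [norm_norm, Pi.add_apply]
  nlinarith [sq_nonneg (‖v‖ - 1 / 2)]

lemma integral_inner_gauss {β : ℝ} (hβ : 0 < β) (e : E) : ∫ x, ⟪e, x⟫_ℝ ∂gauss E β = 0 := by
  have h := (measurePreserving_gauss (E := E) hβ (fun x => -x) (fun p q => by abel)
    (fun c p => by simp) (fun p => by simp))
  have h1 := h.integral_comp (MeasurableEquiv.neg E).measurableEmbedding (fun x => ⟪e, x⟫_ℝ)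
  simp only [inner_neg_right, integral_neg] at h1
  linarith

lemma hasFDerivAt_maxwell (β : ℝ) (v : E) :
    HasFDerivAt (maxwell β) ((-β * maxwell β v) • innerSL ℝ v) v := by
  have h1 : HasFDerivAt (fun v : E => ‖v‖ ^ 2) (2 • innerSL ℝ v) v :=
    (hasStrictFDerivAt_norm_sq v).hasFDerivAt
  have h2 := ((h1.const_mul (-(β / 2))).exp).const_mul (maxwellConst E β)
  refine h2.congr_fderiv ?_
  ext w
  simp [maxwell_eq]
  ring

/-- The variance of the Gaussian in direction `e`. -/
lemma integral_inner_sq_gauss {β : ℝ} (hβ : 0 < β) (e : E) :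
    ∫ x, ⟪e, x⟫_ℝ ^ 2 ∂gauss E β = ‖e‖ ^ 2 / β := by
  have hI1 : Integrable (fun x => ⟪e, x⟫_ℝ ^ 2) (gauss E β) := by
    refine ((integrable_norm_sq_gauss hβ).const_mul (‖e‖ ^ 2)).mono'
      (by fun_prop) (Eventually.of_forall fun v => ?_)
    rw [Real.norm_of_nonneg (sq_nonneg _), ← mul_pow, ← sq_abs]
    exact pow_le_pow_left₀ (abs_nonneg _) (abs_real_inner_le_norm e v) 2
  have hI2 : Integrable (fun x => ⟪e, x⟫_ℝ) (gauss E β) := by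
    refine ((integrable_norm_gauss hβ).const_mul ‖e‖).mono'
      (by fun_prop) (Eventually.of_forall fun v => ?_)
    exact abs_real_inner_le_norm e v
  rw [integrable_gauss_iff hβ] at hI1 hI2
  -- Integration by parts with `∇γ = -β v γ`: `‖e‖² = ∫ ∂_e⟨e,x⟩ γ = β ∫ ⟨e,x⟩² γ`.
  have key := integral_mul_fderiv_eq_neg_fderiv_mul_of_integrable (μ := (volume : Measure E))
    (f := fun x : E => ⟪e, x⟫_ℝ) (g := maxwell β) (v := e) ?_ ?_ ?_ ?_ ?_
  · have hd : ∀ x : E, fderiv ℝ (fun x : E => ⟪e, x⟫_ℝ) x = innerSL ℝ e := fun x =>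
      (innerSL ℝ e).hasFDerivAt.fderiv
    have hm : ∀ x : E, fderiv ℝ (maxwell β) x = (-β * maxwell β x) • innerSL ℝ x := fun x =>
      (hasFDerivAt_maxwell β x).fderiv
    simp only [hd, hm] at key
    simp only [smul_apply, innerSL_apply_apply, smul_eq_mul] at key
    rw [integral_gauss hβ]
    simp only [smul_eq_mul]
    have h3 : ∀ x : E, ⟪e, x⟫_ℝ * (-β * maxwell β x * ⟪x, e⟫_ℝ) =
        -β * (maxwell β x * ⟪e, x⟫_ℝ ^ 2) := fun x => by
      rw [real_inner_comm x e]; ring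
    simp only [h3, integral_const_mul, integral_maxwell hβ, real_inner_self_eq_norm_sq] at key
    field_simp
    linarith
  · have : (fun x : E => fderiv ℝ (fun x : E => ⟪e, x⟫_ℝ) x e * maxwell β x) =
        fun x => ‖e‖ ^ 2 * maxwell β x := by
      funext x
      rw [show fderiv ℝ (fun x : E => ⟪e, x⟫_ℝ) x = innerSL ℝ e from (innerSL ℝ e).hasFDerivAt.fderiv,
        innerSL_apply_apply, real_inner_self_eq_norm_sq]
    rw [this]
    exact (integrable_maxwell hβ).const_mul _
  · have : (fun x : E => ⟪e, x⟫_ℝ * fderiv ℝ (maxwell β) x e) =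
        fun x => -β * (maxwell β x • ⟪e, x⟫_ℝ ^ 2) := by
      funext x
      rw [(hasFDerivAt_maxwell β x).fderiv]
      simp only [smul_apply, innerSL_apply_apply, smul_eq_mul, real_inner_comm x e]
      ring
    rw [this]
    exact hI1.const_mul _
  · refine hI2.congr (Eventually.of_forall fun x => ?_)
    simp [mul_comm]
  · exact fun x _ => (innerSL ℝ e).differentiable x
  · exact fun x _ => (hasFDerivAt_maxwell β x).differentiableAt
end GaussBasics

/-! ### Averages over measure preserving random displacements, and their entropy -/

section Averaging

variable {X Ω Ω' : Type*} [MeasurableSpace X] [MeasurableSpace Ω] [MeasurableSpace Ω']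

/-- Average of `h` over a random displacement `Φ (v, z)` of the argument. -/
def avg (κ : Measure Ω) (Φ : X × Ω → X) (h : X → ℝ) (v : X) : ℝ := ∫ z, h (Φ (v, z)) ∂κ

variable {μ : Measure X} {κ : Measure Ω} {κ' : Measure Ω'} [IsProbabilityMeasure μ]
  [IsProbabilityMeasure κ] [IsProbabilityMeasure κ'] {Φ : X × Ω → X} {Ψ : X × Ω' → X}
  {f g h : X → ℝ}

lemma avg_ae_integrable (hΦ : MeasurePreserving Φ (μ.prod κ) μ) (hh : Integrable h μ) :
    ∀ᵐ v ∂μ, Integrable (fun z => h (Φ (v, z))) κ :=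
  (hΦ.integrable_comp_of_integrable hh).prod_right_ae

lemma integrable_avg (hΦ : MeasurePreserving Φ (μ.prod κ) μ) (hh : Integrable h μ) :
    Integrable (avg κ Φ h) μ :=
  (hΦ.integrable_comp_of_integrable hh).integral_prod_left

lemma avg_congr (hΦ : MeasurePreserving Φ (μ.prod κ) μ) (hfg : f =ᵐ[μ] g) :
    avg κ Φ f =ᵐ[μ] avg κ Φ g := by
  filter_upwards [Measure.ae_ae_of_ae_prod (hΦ.quasiMeasurePreserving.ae_eq_comp hfg)] with v hv
  exact integral_congr_ae hv

lemma avg_add (hΦ : MeasurePreserving Φ (μ.prod κ) μ) (hf : Integrable f μ) (hg : Integrable g μ) :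
    avg κ Φ (f + g) =ᵐ[μ] avg κ Φ f + avg κ Φ g := by
  filter_upwards [avg_ae_integrable hΦ hf, avg_ae_integrable hΦ hg] with v h1 h2
  exact integral_add h1 h2

lemma avg_smul (c : ℝ) : avg κ Φ (c • f) = c • avg κ Φ f := by
  funext v
  exact integral_const_mul c _

lemma integral_avg (hΦ : MeasurePreserving Φ (μ.prod κ) μ) (hh : Integrable h μ) :
    ∫ v, avg κ Φ h v ∂μ = ∫ v, h v ∂μ := by
  have h1 := hΦ.integrable_comp_of_integrable hh
  have h2 := integral_prod _ h1
  simp only [avg]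
  rw [Function.comp_def] at h2
  rw [← h2]
  conv_rhs => rw [← hΦ.map_eq]
  rw [integral_map hΦ.measurable.aemeasurable (by rw [hΦ.map_eq]; exact hh.aestronglyMeasurable)]

lemma avg_nonneg (hΦ : MeasurePreserving Φ (μ.prod κ) μ) (hh : 0 ≤ᵐ[μ] h) :
    0 ≤ᵐ[μ] avg κ Φ h := by
  filter_upwards [Measure.ae_ae_of_ae_prod (hΦ.quasiMeasurePreserving.ae hh)] with v hv
  exact integral_nonneg_of_ae hv

lemma abs_avg_le (v : X) : |avg κ Φ h v| ≤ avg κ Φ (fun x => |h x|) v :=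
  abs_integral_le_integral_abs

lemma integral_abs_avg_le (hΦ : MeasurePreserving Φ (μ.prod κ) μ) (hh : Integrable h μ) :
    ∫ v, |avg κ Φ h v| ∂μ ≤ ∫ v, |h v| ∂μ := by
  rw [← integral_avg hΦ hh.abs]
  exact integral_mono (integrable_avg hΦ hh).abs (integrable_avg hΦ hh.abs) abs_avg_le

/-- Jensen's inequality for the noise distribution `κ`, at almost every starting point. -/
lemma klFun_avg_le (hΦ : MeasurePreserving Φ (μ.prod κ) μ) (hh : Integrable h μ)
    (h0 : 0 ≤ᵐ[μ] h) (hk : Integrable (fun v => klFun (h v)) μ) :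
    ∀ᵐ v ∂μ, klFun (avg κ Φ h v) ≤ avg κ Φ (fun x => klFun (h x)) v := by
  filter_upwards [avg_ae_integrable hΦ hh, avg_ae_integrable hΦ hk,
    Measure.ae_ae_of_ae_prod (hΦ.quasiMeasurePreserving.ae h0)] with v h1 h2 h3
  exact convexOn_klFun.map_integral_le continuous_klFun.continuousOn isClosed_Ici h3 h1 h2

lemma integrable_klFun_of_lintegral {S : ENNReal} (hS : S ≠ ⊤) (hh : AEStronglyMeasurable h μ)
    (h0 : 0 ≤ᵐ[μ] h) (hk : ∫⁻ v, ENNReal.ofReal (klFun (h v)) ∂μ ≤ S) :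
    Integrable (fun v => klFun (h v)) μ := by
  refine ⟨continuous_klFun.comp_aestronglyMeasurable hh, ?_⟩
  rw [hasFiniteIntegral_iff_ofReal (by filter_upwards [h0] with v hv using klFun_nonneg hv)]
  exact lt_of_le_of_lt hk hS.lt_top

lemma integrable_klFun_avg (hΦ : MeasurePreserving Φ (μ.prod κ) μ) (hh : Integrable h μ)
    (h0 : 0 ≤ᵐ[μ] h) (hk : Integrable (fun v => klFun (h v)) μ) :
    Integrable (fun v => klFun (avg κ Φ h v)) μ := by
  refine (integrable_avg hΦ hk).mono'
    (continuous_klFun.comp_aestronglyMeasurable (integrable_avg hΦ hh).aestronglyMeasurable) ?_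
  filter_upwards [klFun_avg_le hΦ hh h0 hk, avg_nonneg hΦ h0] with v h1 h2
  rw [Real.norm_of_nonneg (klFun_nonneg h2)]
  exact h1

lemma integral_klFun_avg_le (hΦ : MeasurePreserving Φ (μ.prod κ) μ) (hh : Integrable h μ)
    (h0 : 0 ≤ᵐ[μ] h) (hk : Integrable (fun v => klFun (h v)) μ) :
    ∫ v, klFun (avg κ Φ h v) ∂μ ≤ ∫ v, klFun (h v) ∂μ := by
  rw [← integral_avg hΦ hk]
  exact integral_mono_ae (integrable_klFun_avg hΦ hh h0 hk) (integrable_avg hΦ hk)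
    (klFun_avg_le hΦ hh h0 hk)

lemma lintegral_klFun_avg_le (hΦ : MeasurePreserving Φ (μ.prod κ) μ) (hh : Integrable h μ)
    (h0 : 0 ≤ᵐ[μ] h) (hk : Integrable (fun v => klFun (h v)) μ) :
    ∫⁻ v, ENNReal.ofReal (klFun (avg κ Φ h v)) ∂μ ≤ ∫⁻ v, ENNReal.ofReal (klFun (h v)) ∂μ := by
  rw [← ofReal_integral_eq_lintegral_ofReal (integrable_klFun_avg hΦ hh h0 hk)
      (by filter_upwards [avg_nonneg hΦ h0] with v hv using klFun_nonneg hv),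
    ← ofReal_integral_eq_lintegral_ofReal hk (by filter_upwards [h0] with v hv using klFun_nonneg hv)]
  exact ENNReal.ofReal_le_ofReal (integral_klFun_avg_le hΦ hh h0 hk)

/-- Both compositions are, by Fubini, integrals over the pair of noises. `Θ` is a change of
variables in this pair, allowed to mix the two noises, that carries one double displacement into the
other. Fubini is available only at almost every `v`, hence the a.e. equality. -/
lemma avg_comm (hΦ : MeasurePreserving Φ (μ.prod κ) μ) (hΨ : MeasurePreserving Ψ (μ.prod κ') μ)
    {Θ : Ω × Ω' → Ω × Ω'} (hΘ : MeasurePreserving Θ (κ.prod κ') (κ.prod κ'))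
    (hcomm : ∀ v p, Ψ (Φ (v, (Θ p).1), (Θ p).2) = Φ (Ψ (v, p.2), p.1)) (hh : Integrable h μ) :
    avg κ Φ (avg κ' Ψ h) =ᵐ[μ] avg κ' Ψ (avg κ Φ h) := by
  have h1 : MeasurePreserving (fun p : X × (Ω × Ω') => Ψ (Φ (p.1, p.2.1), p.2.2))
      (μ.prod (κ.prod κ')) μ :=
    hΨ.comp ((hΦ.prod (MeasurePreserving.id κ')).comp
      ((measurePreserving_prodAssoc μ κ κ').symm MeasurableEquiv.prodAssoc))
  have h2 : MeasurePreserving (fun p : X × (Ω × Ω') => Φ (Ψ (p.1, p.2.2), p.2.1))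
      (μ.prod (κ.prod κ')) μ :=
    hΦ.comp ((hΨ.prod (MeasurePreserving.id κ)).comp
      (((measurePreserving_prodAssoc μ κ' κ).symm MeasurableEquiv.prodAssoc).comp
        ((MeasurePreserving.id μ).prod Measure.measurePreserving_swap)))
  filter_upwards [(h1.integrable_comp_of_integrable hh).prod_right_ae,
    (h2.integrable_comp_of_integrable hh).prod_right_ae] with v hv1 hv2
  calc avg κ Φ (avg κ' Ψ h) v = ∫ p, h (Ψ (Φ (v, p.1), p.2)) ∂(κ.prod κ') :=
        (integral_prod _ hv1).symm
    _ = ∫ p, h (Ψ (Φ (v, (Θ p).1), (Θ p).2)) ∂(κ.prod κ') := by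
        conv_lhs => rw [← hΘ.map_eq]
        exact integral_map hΘ.measurable.aemeasurable
          (by rw [hΘ.map_eq]; exact hv1.aestronglyMeasurable)
    _ = ∫ p, h (Φ (Ψ (v, p.2), p.1)) ∂(κ.prod κ') := by simp only [hcomm]
    _ = avg κ' Ψ (avg κ Φ h) v := integral_prod_symm _ hv2

/-- The operator `avg κ Φ` on `L¹`. -/
def avgL1 (hΦ : MeasurePreserving Φ (μ.prod κ) μ) : Lp ℝ 1 μ →L[ℝ] Lp ℝ 1 μ :=
  LinearMap.mkContinuous
    { toFun := fun h => (integrable_avg hΦ (L1.integrable_coeFn h)).toL1 _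
      map_add' := fun f g => by
        rw [← Integrable.toL1_add]
        refine (Integrable.toL1_eq_toL1_iff _ _ _ _).2 ?_
        exact (avg_congr hΦ (Lp.coeFn_add f g)).trans
          (avg_add hΦ (L1.integrable_coeFn f) (L1.integrable_coeFn g))
      map_smul' := fun c f => by
        rw [RingHom.id_apply, ← Integrable.toL1_smul]
        refine (Integrable.toL1_eq_toL1_iff _ _ _ _).2 ?_
        refine (avg_congr hΦ (Lp.coeFn_smul c f)).trans ?_
        rw [avg_smul]
        rfl }
    1 (fun f => by
      rw [one_mul, L1.norm_eq_integral_norm, L1.norm_eq_integral_norm]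
      refine le_trans (le_of_eq ?_) (integral_abs_avg_le hΦ (L1.integrable_coeFn f))
      refine integral_congr_ae ?_
      filter_upwards [Integrable.coeFn_toL1 (integrable_avg hΦ (L1.integrable_coeFn f))] with v hv
      rw [← Real.norm_eq_abs, ← hv]
      rfl)

lemma coeFn_avgL1 (hΦ : MeasurePreserving Φ (μ.prod κ) μ) (f : Lp ℝ 1 μ) :
    avgL1 hΦ f =ᵐ[μ] avg κ Φ f :=
  Integrable.coeFn_toL1 (integrable_avg hΦ (L1.integrable_coeFn f))

lemma avgL1_toL1 (hΦ : MeasurePreserving Φ (μ.prod κ) μ) (hf : Integrable f μ) :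
    avgL1 hΦ (hf.toL1 f) = (integrable_avg hΦ hf).toL1 _ :=
  (Integrable.toL1_eq_toL1_iff _ _ (integrable_avg hΦ (L1.integrable_coeFn _))
    (integrable_avg hΦ hf)).2 (avg_congr hΦ hf.coeFn_toL1)

lemma avgL1_comm (hΦ : MeasurePreserving Φ (μ.prod κ) μ)
    (hΨ : MeasurePreserving Ψ (μ.prod κ') μ)
    {Θ : Ω × Ω' → Ω × Ω'} (hΘ : MeasurePreserving Θ (κ.prod κ') (κ.prod κ'))
    (hcomm : ∀ v p, Ψ (Φ (v, (Θ p).1), (Θ p).2) = Φ (Ψ (v, p.2), p.1)) :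
    Commute (avgL1 hΦ) (avgL1 hΨ) := by
  refine ContinuousLinearMap.ext fun f => ?_
  have hf := L1.integrable_coeFn f
  have h := avg_comm hΦ hΨ hΘ hcomm hf
  change avgL1 hΦ (avgL1 hΨ f) = avgL1 hΨ (avgL1 hΦ f)
  rw [← Integrable.toL1_coeFn f hf, avgL1_toL1 hΨ hf, avgL1_toL1 hΦ hf, avgL1_toL1 hΦ, avgL1_toL1 hΨ]
  exact (Integrable.toL1_eq_toL1_iff _ _ _ _).2 h

variable (μ) in
/-- Probability densities in `L¹(μ)` whose entropy is at most `S`. -/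
def entropySublevel (S : ENNReal) : Set (Lp ℝ 1 μ) :=
  {f | 0 ≤ᵐ[μ] f ∧ ∫ v, f v ∂μ = 1 ∧ ∫⁻ v, ENNReal.ofReal (klFun (f v)) ∂μ ≤ S}

/-- Nonnegativity, mass one and the entropy bound are convex conditions. Together with closedness in
`L¹` and stability under averaging, this makes the set invariant under the exponential of the
generator. -/
lemma convex_entropySublevel (S : ENNReal) : Convex ℝ (entropySublevel μ S) := by
  rintro f ⟨hf0, hf1, hfS⟩ g ⟨hg0, hg1, hgS⟩ a b ha hb hab
  have hfg : ((a • f + b • g : Lp ℝ 1 μ) : X → ℝ) =ᵐ[μ] fun v => a * f v + b * g v := by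
    filter_upwards [Lp.coeFn_add (a • f) (b • g), Lp.coeFn_smul a f, Lp.coeFn_smul b g]
      with v h1 h2 h3
    rw [h1, Pi.add_apply, h2, h3]
    rfl
  have hfm := (Lp.aestronglyMeasurable f).aemeasurable
  have hgm := (Lp.aestronglyMeasurable g).aemeasurable
  refine ⟨?_, ?_, ?_⟩
  · filter_upwards [hfg, hf0, hg0] with v h1 h2 h3
    rw [h1]
    exact add_nonneg (mul_nonneg ha h2) (mul_nonneg hb h3)
  · rw [integral_congr_ae hfg, integral_add ((L1.integrable_coeFn f).const_mul a)
      ((L1.integrable_coeFn g).const_mul b), integral_const_mul, integral_const_mul, hf1, hg1]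
    linarith
  · calc ∫⁻ v, ENNReal.ofReal (klFun ((a • f + b • g : Lp ℝ 1 μ) v)) ∂μ
        ≤ ∫⁻ v, (ENNReal.ofReal a * ENNReal.ofReal (klFun (f v)) +
            ENNReal.ofReal b * ENNReal.ofReal (klFun (g v))) ∂μ := by
          refine lintegral_mono_ae ?_
          filter_upwards [hfg, hf0, hg0] with v h1 h2 h3
          rw [h1, ← ENNReal.ofReal_mul ha, ← ENNReal.ofReal_mul hb,
            ← ENNReal.ofReal_add (mul_nonneg ha (klFun_nonneg h2)) (mul_nonneg hb (klFun_nonneg h3))]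
          exact ENNReal.ofReal_le_ofReal (convexOn_klFun.2 h2 h3 ha hb hab)
      _ = ENNReal.ofReal a * ∫⁻ v, ENNReal.ofReal (klFun (f v)) ∂μ +
            ENNReal.ofReal b * ∫⁻ v, ENNReal.ofReal (klFun (g v)) ∂μ := by
          rw [lintegral_add_left' (by fun_prop), lintegral_const_mul' _ _ ENNReal.ofReal_ne_top,
            lintegral_const_mul' _ _ ENNReal.ofReal_ne_top]
      _ ≤ ENNReal.ofReal a * S + ENNReal.ofReal b * S := by gcongr
      _ = S := by rw [← add_mul, ← ENNReal.ofReal_add ha hb, hab, ENNReal.ofReal_one, one_mul]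

/-- Lower semicontinuity of the entropy with respect to convergence in `L¹`. -/
lemma lintegral_klFun_le_of_tendsto {u : ℕ → X → ℝ} {S : ENNReal}
    (hu : ∀ n, AEStronglyMeasurable (u n) μ) (hf : AEStronglyMeasurable f μ)
    (hlim : Tendsto (fun n => eLpNorm (u n - f) 1 μ) atTop (𝓝 0))
    (hS : ∀ n, ∫⁻ v, ENNReal.ofReal (klFun (u n v)) ∂μ ≤ S) :
    ∫⁻ v, ENNReal.ofReal (klFun (f v)) ∂μ ≤ S := by
  obtain ⟨ns, -, hns⟩ := (tendstoInMeasure_of_tendsto_eLpNorm one_ne_zero hu hf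
    hlim).exists_seq_tendsto_ae
  have hF : Continuous fun x => ENNReal.ofReal (klFun x) :=
    ENNReal.continuous_ofReal.comp continuous_klFun
  calc ∫⁻ v, ENNReal.ofReal (klFun (f v)) ∂μ
      = ∫⁻ v, liminf (fun i => ENNReal.ofReal (klFun (u (ns i) v))) atTop ∂μ := by
        refine lintegral_congr_ae ?_
        filter_upwards [hns] with v hv
        exact (((hF.tendsto _).comp hv).liminf_eq).symm
    _ ≤ liminf (fun i => ∫⁻ v, ENNReal.ofReal (klFun (u (ns i) v)) ∂μ) atTop :=
        lintegral_liminf_le' fun i => hF.measurable.comp_aemeasurable (hu _).aemeasurable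
    _ ≤ S := by
        refine liminf_le_of_le (by isBoundedDefault) fun b hb => ?_
        obtain ⟨i, hi⟩ := hb.exists
        exact hi.trans (hS _)

lemma isClosed_entropySublevel (S : ENNReal) : IsClosed (entropySublevel μ S) := by
  refine IsSeqClosed.isClosed ?_
  intro u f hu hlim
  have h1 : Tendsto (fun n => eLpNorm (⇑(u n) - ⇑f) 1 μ) atTop (𝓝 0) :=
    (Lp.tendsto_Lp_iff_tendsto_eLpNorm' u f).1 hlim
  refine ⟨?_, ?_, ?_⟩
  · obtain ⟨ns, -, hns⟩ := (tendstoInMeasure_of_tendsto_eLpNorm one_ne_zero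
      (f := fun n => ⇑(u n)) (g := ⇑f) (fun n => Lp.aestronglyMeasurable (u n))
      (Lp.aestronglyMeasurable f) h1).exists_seq_tendsto_ae
    filter_upwards [hns, ae_all_iff.2 fun n => (hu n).1] with v h2 h3
    exact ge_of_tendsto h2 (Eventually.of_forall fun i => h3 _)
  · have h3 : Tendsto (fun n => ∫ v, u n v ∂μ) atTop (𝓝 (∫ v, f v ∂μ)) :=
      ((continuous_integral (μ := μ) (G := ℝ)).tendsto f).comp hlim
    have h4 : (fun n => ∫ v, u n v ∂μ) = fun _ => 1 := funext fun n => (hu n).2.1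
    rw [h4] at h3
    exact tendsto_nhds_unique h3 tendsto_const_nhds
  · exact lintegral_klFun_le_of_tendsto (u := fun n => ⇑(u n)) (f := ⇑f) (fun n => Lp.aestronglyMeasurable (u n))
      (Lp.aestronglyMeasurable f) h1 fun n => (hu n).2.2

lemma avgL1_mem_entropySublevel (hΦ : MeasurePreserving Φ (μ.prod κ) μ) {S : ENNReal}
    (hS : S ≠ ⊤) {u : Lp ℝ 1 μ} (hu : u ∈ entropySublevel μ S) :
    avgL1 hΦ u ∈ entropySublevel μ S := by
  have hui := L1.integrable_coeFn u
  have h := coeFn_avgL1 hΦ u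
  have hk := integrable_klFun_of_lintegral hS (Lp.aestronglyMeasurable u) hu.1 hu.2.2
  refine ⟨?_, ?_, ?_⟩
  · filter_upwards [h, avg_nonneg hΦ hu.1] with v h1 h2
    rw [h1]; exact h2
  · rw [integral_congr_ae h, integral_avg hΦ hui, hu.2.1]
  · refine le_trans (le_of_eq (lintegral_congr_ae ?_))
      ((lintegral_klFun_avg_le hΦ hui hu.1 hk).trans hu.2.2)
    filter_upwards [h] with v hv
    rw [hv]

end Averaging

/-! ### Measure preserving maps depending on a random parameter -/

section Param

variable {A B D : Type*} [MeasurableSpace A] [MeasurableSpace B] [MeasurableSpace D]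

/-- A skew product over the identity of the parameter space. The parameter remains in the output, so
that the map can serve as a change of noise in `avg_comm`. -/
lemma measurePreserving_param {μA : Measure A} {μB : Measure B} {ρ : Measure D}
    [IsProbabilityMeasure μA] [IsProbabilityMeasure μB] [IsProbabilityMeasure ρ] {T : D → A → B}
    (hTm : Measurable (Function.uncurry T)) (hT : ∀ σ, MeasurePreserving (T σ) μA μB) :
    MeasurePreserving (fun p : A × D => (T p.2 p.1, p.2)) (μA.prod ρ) (μB.prod ρ) := by
  have h1 : MeasurePreserving (fun p : D × A => (p.1, T p.1 p.2)) (ρ.prod μA) (ρ.prod μB) :=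
    (MeasurePreserving.id ρ).skew_product hTm (Eventually.of_forall fun σ => (hT σ).map_eq)
  exact Measure.measurePreserving_swap.comp (h1.comp Measure.measurePreserving_swap)

end Param

/-! ### The Ornstein-Uhlenbeck semigroup as an average -/

section OU

variable {E : Type*} [NormedAddCommGroup E] [InnerProductSpace ℝ E] [FiniteDimensional ℝ E]
  [MeasurableSpace E] [BorelSpace E]

/-- The displacement of the Ornstein-Uhlenbeck semigroup. -/
def mehler (s : ℝ) (p : E × E) : E := Real.exp (-s) • p.1 + √(1 - Real.exp (-2 * s)) • p.2

lemma mehler_sq {s : ℝ} (hs : 0 ≤ s) :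
    Real.exp (-s) ^ 2 + √(1 - Real.exp (-2 * s)) ^ 2 = 1 := by
  rw [Real.sq_sqrt (by linarith [Real.exp_le_one_iff.2 (by linarith : -2 * s ≤ 0)]), ← Real.exp_nat_mul]
  norm_num

lemma measurePreserving_mehlerMap {β s : ℝ} (hβ : 0 < β) (hs : 0 ≤ s) :
    MeasurePreserving (mehler s) ((gauss E β).prod (gauss E β)) (gauss E β) :=
  measurePreserving_mehler hβ (mehler_sq hs)

lemma ornsteinUhlenbeck_eq_avg (β s : ℝ) (h : E → ℝ) :
    ornsteinUhlenbeck β s h = avg (gauss E β) (mehler s) h := rfl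

end OU

/-! ### Collisions as linear maps -/

variable {d N : ℕ}

/-- The state with velocity `x` for particle `j` and velocity zero for all others. -/
def inj (j : Fin N) (x : Vel d) : State d N := WithLp.toLp 2 (Pi.single j x)

lemma inj_smul (j : Fin N) (c : ℝ) (x : Vel d) : inj j (c • x) = c • inj j x := by
  simp [inj, Pi.single_smul]

lemma inj_apply_same (j : Fin N) (x : Vel d) : (inj j x) j = x := by simp [inj]

lemma inj_apply_ne {i j : Fin N} (h : i ≠ j) (x : Vel d) : (inj j x) i = 0 := by simp [inj, h]

lemma inner_inj (v : State d N) (j : Fin N) (x : Vel d) : ⟪v, inj j x⟫_ℝ = ⟪v j, x⟫_ℝ := by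
  rw [PiLp.inner_apply, Finset.sum_eq_single j]
  · rw [inj_apply_same]
  · intro i _ hi
    rw [inj_apply_ne hi, inner_zero_right]
  · simp

lemma norm_inj_sq (j : Fin N) (x : Vel d) : ‖inj j x‖ ^ 2 = ‖x‖ ^ 2 := by
  rw [← real_inner_self_eq_norm_sq, inner_inj, inj_apply_same, real_inner_self_eq_norm_sq]

lemma continuous_inj (j : Fin N) : Continuous (inj j : Vel d → State d N) :=
  (PiLp.continuous_toLp 2 _).comp (continuous_single (A := fun _ : Fin N => Vel d) j)

lemma setVel_eq (v : State d N) (j : Fin N) (a : Vel d) : setVel v j a = v + inj j (a - v j) := by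
  ext i : 1
  rw [PiLp.add_apply]
  by_cases h : i = j
  · subst h
    rw [inj_apply_same]
    simp [setVel]
  · rw [inj_apply_ne h]
    simp [setVel, h]

lemma norm_dir (σ : Direction d) : ‖(σ : Vel d)‖ ^ 2 = 1 := by
  rw [norm_eq_of_mem_sphere]; norm_num

lemma setVel_collideFst (σ : Direction d) (v : State d N) (j : Fin N) (w : Vel d) :
    setVel v j (collideFst σ (v j) w) =
      v + (-⟪(σ : Vel d), v j - w⟫_ℝ) • inj j (σ : Vel d) := by
  rw [setVel_eq, collideFst, ← inj_smul]
  congr 2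
  module

/-- The collision moves `v` along the single vector `inj i σ - inj j σ`: for `i ≠ j` it is the
reflection in the orthogonal hyperplane, for `i = j` the identity. Linearity, energy conservation
and involutivity are read off from this form. -/
lemma collidePair_eq (σ : Direction d) (i j : Fin N) (v : State d N) :
    collidePair σ i j v =
      v + (-⟪(σ : Vel d), v i - v j⟫_ℝ) • (inj i (σ : Vel d) - inj j (σ : Vel d)) := by
  rw [collidePair, setVel_collideFst, setVel_eq, collideSnd, PiLp.add_apply, PiLp.smul_apply]
  by_cases h : i = j
  · subst h
    simp [inj]
  · rw [inj_apply_ne (Ne.symm h), smul_zero, add_zero, add_sub_cancel_left, inj_smul]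
    module

/-- The displacement of `T_j`. -/
def thermostatMap (j : Fin N) (p : State d N × (Vel d × Direction d)) : State d N :=
  setVel p.1 j (collideFst p.2.2 (p.1 j) p.2.1)

/-- The displacement of the collision of the pair `i, j`. -/
def pairMap (i j : Fin N) (p : State d N × Direction d) : State d N := collidePair p.2 i j p.1

lemma norm_add_smul_inj_sq (v : State d N) (c : ℝ) (j : Fin N) (σ : Direction d) :
    ‖v + c • inj j (σ : Vel d)‖ ^ 2 = ‖v‖ ^ 2 + 2 * c * ⟪(σ : Vel d), v j⟫_ℝ + c ^ 2 := by
  rw [norm_add_sq_real, inner_smul_right, inner_inj, norm_smul, mul_pow, norm_inj_sq, norm_dir,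
    real_inner_comm, Real.norm_eq_abs, sq_abs]
  ring

lemma norm_add_smul_dir_sq (w : Vel d) (c : ℝ) (σ : Direction d) :
    ‖w + c • (σ : Vel d)‖ ^ 2 = ‖w‖ ^ 2 + 2 * c * ⟪(σ : Vel d), w⟫_ℝ + c ^ 2 := by
  rw [norm_add_sq_real, inner_smul_right, norm_smul, mul_pow, norm_dir,
    real_inner_comm, Real.norm_eq_abs, sq_abs]
  ring

lemma norm_collidePair_sq (σ : Direction d) (i j : Fin N) (v : State d N) :
    ‖collidePair σ i j v‖ ^ 2 = ‖v‖ ^ 2 := by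
  rw [collidePair_eq]
  by_cases h : i = j
  · subst h; simp
  rw [norm_add_sq_real, inner_smul_right, inner_sub_right v, inner_inj, inner_inj, norm_smul, mul_pow,
    norm_sub_sq_real, inner_inj, inj_apply_ne (Ne.symm h), norm_inj_sq, norm_inj_sq, norm_dir,
    inner_zero_left, inner_sub_right, Real.norm_eq_abs, sq_abs, real_inner_comm (v i),
    real_inner_comm (v j)]
  ring

lemma collidePair_involutive (σ : Direction d) (i j : Fin N) (v : State d N) :
    collidePair σ i j (collidePair σ i j v) = v := by
  by_cases h : i = j
  · subst h; simp [collidePair_eq]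
  rw [collidePair_eq σ i j v]
  set c := -⟪(σ : Vel d), v i - v j⟫_ℝ with hc
  rw [collidePair_eq]
  simp only [PiLp.add_apply, PiLp.smul_apply, PiLp.sub_apply, inj_apply_same, inj_apply_ne h,
    inj_apply_ne (Ne.symm h), sub_zero, zero_sub]
  have : ⟪(σ : Vel d), v i + c • (σ : Vel d) - (v j + c • -(σ : Vel d))⟫_ℝ = c := by
    rw [show v i + c • (σ : Vel d) - (v j + c • -(σ : Vel d)) = (v i - v j) + (2 * c) • (σ : Vel d)
      by module, inner_add_right, inner_smul_right, real_inner_self_eq_norm_sq, norm_dir]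
    linarith
  rw [this]
  module

lemma collidePair_add (σ : Direction d) (i j : Fin N) (v w : State d N) :
    collidePair σ i j (v + w) = collidePair σ i j v + collidePair σ i j w := by
  simp only [collidePair_eq, PiLp.add_apply]
  rw [show v i + w i - (v j + w j) = (v i - v j) + (w i - w j) by module, inner_add_right]
  module

lemma collidePair_smul (σ : Direction d) (i j : Fin N) (c : ℝ) (v : State d N) :
    collidePair σ i j (c • v) = c • collidePair σ i j v := by
  simp only [collidePair_eq, PiLp.smul_apply]
  rw [← smul_sub, inner_smul_right]
  module

lemma measurable_pairMap (i j : Fin N) : Measurable (pairMap (d := d) i j) := by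
  have hi := continuous_inj (d := d) i
  have hj := continuous_inj (d := d) j
  have : Continuous (pairMap (d := d) i j) := by
    unfold pairMap
    simp only [collidePair_eq]
    fun_prop
  exact this.measurable

lemma measurePreserving_collidePair {β : ℝ} (hβ : 0 < β) (i j : Fin N) (σ : Direction d) :
    MeasurePreserving (collidePair σ i j) (gauss (State d N) β) (gauss (State d N) β) :=
  measurePreserving_gauss hβ _ (collidePair_add σ i j) (collidePair_smul σ i j)
    (norm_collidePair_sq σ i j)

/-! ### Collision operators on `L¹(γ)` and their commutation with the semigroup -/

section Markov

variable {β : ℝ} {ρ : Measure (Direction d)} [IsProbabilityMeasure ρ]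

lemma measurePreserving_pair_param (hβ : 0 < β) (i j : Fin N) :
    MeasurePreserving (fun p : State d N × Direction d => (collidePair p.2 i j p.1, p.2))
      ((gauss (State d N) β).prod ρ) ((gauss (State d N) β).prod ρ) := by
  have := isProbabilityMeasure_gauss (E := State d N) hβ
  exact measurePreserving_param (T := fun σ v => collidePair σ i j v)
    ((measurable_pairMap i j).comp measurable_swap) (measurePreserving_collidePair hβ i j)

lemma measurePreserving_pairMap (hβ : 0 < β) (i j : Fin N) :
    MeasurePreserving (pairMap i j) ((gauss (State d N) β).prod ρ) (gauss (State d N) β) :=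
  measurePreserving_fst.comp (measurePreserving_pair_param hβ i j)

/-- A map of `State × Vel` that only changes the components of the velocity of particle `j` and of
the thermostat particle in direction `σ`, by a matrix with rows `(a, b)` and `(a', b')`. -/
def mixMap (a b a' b' : ℝ) (j : Fin N) (σ : Direction d) (p : State d N × Vel d) :
    State d N × Vel d :=
  (p.1 + ((a - 1) * ⟪(σ : Vel d), p.1 j⟫_ℝ + b * ⟪(σ : Vel d), p.2⟫_ℝ) • inj j (σ : Vel d),
    p.2 + (a' * ⟪(σ : Vel d), p.1 j⟫_ℝ + (b' - 1) * ⟪(σ : Vel d), p.2⟫_ℝ) • (σ : Vel d))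

/-- The three hypotheses say that the columns of the matrix are orthonormal, so the map is
orthogonal on `State × Vel`. -/
lemma measurePreserving_mixMap (hβ : 0 < β) {a b a' b' : ℝ} (h1 : a ^ 2 + a' ^ 2 = 1)
    (h2 : b ^ 2 + b' ^ 2 = 1) (h3 : a * b + a' * b' = 0) (j : Fin N) (σ : Direction d) :
    MeasurePreserving (mixMap a b a' b' j σ)
      ((gauss (State d N) β).prod (gauss (Vel d) β))
      ((gauss (State d N) β).prod (gauss (Vel d) β)) := by
  refine measurePreserving_gauss_prod_fun hβ _ (fun p q => ?_) (fun c p => ?_) (fun p => ?_)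
  · refine Prod.ext ?_ ?_ <;>
    · simp only [mixMap, Prod.fst_add, Prod.snd_add, PiLp.add_apply, inner_add_right]
      module
  · refine Prod.ext ?_ ?_ <;>
    · simp only [mixMap, Prod.smul_fst, Prod.smul_snd, PiLp.smul_apply, inner_smul_right]
      module
  · simp only [mixMap, norm_add_smul_inj_sq, norm_add_smul_dir_sq]
    generalize ⟪(σ : Vel d), p.1 j⟫_ℝ = x
    generalize ⟪(σ : Vel d), p.2⟫_ℝ = y
    linear_combination x ^ 2 * h1 + y ^ 2 * h2 + 2 * x * y * h3

lemma measurable_mixMap (a b a' b' : ℝ) (j : Fin N) :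
    Measurable (Function.uncurry (mixMap (d := d) a b a' b' j)) := by
  have hj := continuous_inj (d := d) j
  have : Continuous (Function.uncurry (mixMap (d := d) a b a' b' j)) := by
    unfold mixMap Function.uncurry
    fun_prop
  exact this.measurable

lemma measurePreserving_mix_param (hβ : 0 < β) {a b a' b' : ℝ} (h1 : a ^ 2 + a' ^ 2 = 1)
    (h2 : b ^ 2 + b' ^ 2 = 1) (h3 : a * b + a' * b' = 0) (j : Fin N) :
    MeasurePreserving (fun p : State d N × (Vel d × Direction d) =>
        ((mixMap a b a' b' j p.2.2 (p.1, p.2.1)).1, (mixMap a b a' b' j p.2.2 (p.1, p.2.1)).2, p.2.2))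
      ((gauss (State d N) β).prod ((gauss (Vel d) β).prod ρ))
      ((gauss (State d N) β).prod ((gauss (Vel d) β).prod ρ)) := by
  have := isProbabilityMeasure_gauss (E := State d N) hβ
  have := isProbabilityMeasure_gauss (E := Vel d) hβ
  exact (measurePreserving_prodAssoc _ _ _).comp ((measurePreserving_param (ρ := ρ)
    (measurable_mixMap a b a' b' j) (measurePreserving_mixMap hβ h1 h2 h3 j)).comp
    ((measurePreserving_prodAssoc _ _ _).symm MeasurableEquiv.prodAssoc))

lemma measurePreserving_thermostatMap (hβ : 0 < β) (j : Fin N) :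
    MeasurePreserving (thermostatMap j)
      ((gauss (State d N) β).prod ((gauss (Vel d) β).prod ρ)) (gauss (State d N) β) := by
  have := isProbabilityMeasure_gauss (E := State d N) hβ
  have := isProbabilityMeasure_gauss (E := Vel d) hβ
  -- A thermostat collision exchanges the components along `σ` of `v_j` and `w`: the matrix is the
  -- transposition.
  have h := measurePreserving_fst.comp (measurePreserving_mix_param (ρ := ρ) (d := d) (β := β) hβ
    (a := 0) (b := 1) (a' := 1) (b' := 0) (by norm_num) (by norm_num) (by norm_num) j)
  convert! h using 1
  funext p
  simp only [thermostatMap, setVel_collideFst, mixMap, Function.comp, inner_sub_right]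
  module

/-- The operator `P_s` on `L¹(γ)`. -/
def ouL1 {E : Type*} [NormedAddCommGroup E] [InnerProductSpace ℝ E] [FiniteDimensional ℝ E]
    [MeasurableSpace E] [BorelSpace E] {s : ℝ} (hβ : 0 < β) (hs : 0 ≤ s) :
    Lp ℝ 1 (gauss E β) →L[ℝ] Lp ℝ 1 (gauss E β) :=
  have := isProbabilityMeasure_gauss (E := E) hβ
  avgL1 (measurePreserving_mehlerMap hβ hs)

variable (ρ) in
/-- The pair collision operator on `L¹(γ)`. -/
def pairL1 (hβ : 0 < β) (i j : Fin N) :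
    Lp ℝ 1 (gauss (State d N) β) →L[ℝ] Lp ℝ 1 (gauss (State d N) β) :=
  have := isProbabilityMeasure_gauss (E := State d N) hβ
  avgL1 (measurePreserving_pairMap (ρ := ρ) hβ i j)

variable (ρ) in
/-- The operator `T_j` on `L¹(γ)`. -/
def thermostatL1 (hβ : 0 < β) (j : Fin N) :
    Lp ℝ 1 (gauss (State d N) β) →L[ℝ] Lp ℝ 1 (gauss (State d N) β) :=
  have := isProbabilityMeasure_gauss (E := State d N) hβ
  have := isProbabilityMeasure_gauss (E := Vel d) hβ
  avgL1 (measurePreserving_thermostatMap (ρ := ρ) hβ j)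

/-- For fixed `σ` the collision `C` is a linear involution, so `C(a v + b C x) = a C v + b x`.
Replacing the noise `x` by `C x`, which has the same law, interchanges the two operations. -/
lemma commute_ouL1_pairL1 {s : ℝ} (hβ : 0 < β) (hs : 0 ≤ s) (i j : Fin N) :
    Commute (ouL1 hβ hs) (pairL1 (d := d) ρ hβ i j) := by
  have := isProbabilityMeasure_gauss (E := State d N) hβ
  refine avgL1_comm (measurePreserving_mehlerMap hβ hs) (measurePreserving_pairMap (ρ := ρ) hβ i j)
    (measurePreserving_pair_param hβ i j) fun v p => ?_
  simp only [pairMap, mehler, collidePair_add, collidePair_smul, collidePair_involutive]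

/-- The thermostat replaces the component of `v_j` along `σ` by that of `w`. With `P_s` acting on
the collided state, this component becomes `a w_σ + b x_σ`; with the collision acting on the
displaced state, it is the incoming `w_σ`. The rotation of `(x_σ, w_σ)` with rows `(a, -b)` and `(b,
a)` makes them agree and preserves the law of the noises; the other components do not involve `w`.
-/
lemma commute_ouL1_thermostatL1 {s : ℝ} (hβ : 0 < β) (hs : 0 ≤ s) (j : Fin N) :
    Commute (ouL1 hβ hs) (thermostatL1 (d := d) ρ hβ j) := by
  have := isProbabilityMeasure_gauss (E := State d N) hβ
  have := isProbabilityMeasure_gauss (E := Vel d) hβ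
  have hab := mehler_sq hs
  refine avgL1_comm (measurePreserving_mehlerMap hβ hs)
    (measurePreserving_thermostatMap (ρ := ρ) hβ j) (measurePreserving_mix_param hβ (a := Real.exp (-s))
    (b := -√(1 - Real.exp (-2 * s))) (a' := √(1 - Real.exp (-2 * s))) (b' := Real.exp (-s))
    hab (by linarith) (by ring) j) fun v p => ?_
  simp only [mehler]
  generalize Real.exp (-s) = a at *
  generalize √(1 - Real.exp (-2 * s)) = b at *
  simp only [thermostatMap, setVel_collideFst]
  simp only [mixMap, PiLp.add_apply, PiLp.smul_apply,
    inj_apply_same, inner_sub_right, inner_add_right, inner_smul_right, real_inner_self_eq_norm_sq,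
    norm_dir]
  generalize ⟪(p.2.2 : Vel d), p.1 j⟫_ℝ = x
  generalize ⟪(p.2.2 : Vel d), p.2.1⟫_ℝ = y
  generalize ⟪(p.2.2 : Vel d), v j⟫_ℝ = z
  match_scalars <;> ring

end Markov

/-! ### Exponentials of bounded Markov type generators -/

section Flow

variable {V : Type*} [NormedAddCommGroup V] [NormedSpace ℝ V] [CompleteSpace V]

/-- `e^{-r} e^{rK} x` is a Poisson average of the iterates `Kⁿ x`. The partial sums, divided by
their total weight, are convex combinations of points of `C` and converge to it. -/
lemma exp_smul_mem_of_convex {C : Set V} (hC : Convex ℝ C) (hCc : IsClosed C) {K : V →L[ℝ] V}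
    (hK : ∀ x ∈ C, K x ∈ C) {r : ℝ} (hr : 0 ≤ r) {x : V} (hx : x ∈ C) :
    Real.exp (-r) • (NormedSpace.exp (r • K)) x ∈ C := by
  have hKn : ∀ n : ℕ, (K ^ n) x ∈ C := by
    intro n
    induction n with
    | zero => simpa using hx
    | succ n ih => rw [pow_succ']; exact hK _ ih
  have h1 : HasSum (fun n : ℕ => ((n.factorial : ℝ)⁻¹ * r ^ n) • (K ^ n) x)
      (NormedSpace.exp (r • K) x) := by
    have h := (NormedSpace.exp_series_hasSum_exp' (𝕂 := ℝ) (r • K))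
    have h2 := h.mapL (ContinuousLinearMap.apply ℝ V x)
    refine h2.congr_fun ?_
    intro n
    simp [smul_pow, smul_smul]
  have h2 : HasSum (fun n : ℕ => (n.factorial : ℝ)⁻¹ * r ^ n) (Real.exp r) := by
    rw [Real.exp_eq_exp_ℝ]
    simpa using NormedSpace.exp_series_hasSum_exp' (𝕂 := ℝ) r
  have h3 : Tendsto (fun n => (∑ k ∈ Finset.range n, (k.factorial : ℝ)⁻¹ * r ^ k)⁻¹ •
      ∑ k ∈ Finset.range n, ((k.factorial : ℝ)⁻¹ * r ^ k) • (K ^ k) x) atTop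
      (𝓝 ((Real.exp r)⁻¹ • (NormedSpace.exp (r • K)) x)) :=
    (h2.tendsto_sum_nat.inv₀ (Real.exp_pos r).ne').smul h1.tendsto_sum_nat
  rw [Real.exp_neg]
  refine hCc.mem_of_tendsto h3 ?_
  filter_upwards [eventually_gt_atTop 0] with n hn
  have hpos : 0 < ∑ k ∈ Finset.range n, (k.factorial : ℝ)⁻¹ * r ^ k := by
    refine Finset.sum_pos' (fun k _ => by positivity) ⟨0, Finset.mem_range.2 hn, by simp⟩
  rw [Finset.smul_sum]
  simp only [smul_smul]
  refine hC.sum_mem (fun k _ => by positivity) ?_ (fun k _ => hKn k)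
  rw [← Finset.mul_sum, inv_mul_cancel₀ hpos.ne']

/-- The field `l (K - 1)` is bounded linear, hence Lipschitz, so the solution is unique; since `K`
commutes with `1`, its exponential splits off the scalar `e^{-tl}`. -/
lemma eq_exp_of_hasDerivWithinAt {K : V →L[ℝ] V} {l : ℝ} {x : ℝ → V}
    (hx : ∀ t, 0 ≤ t → HasDerivWithinAt x (l • (K (x t) - x t)) (Set.Ici 0) t) {t : ℝ}
    (ht : 0 ≤ t) : x t = Real.exp (-(t * l)) • (NormedSpace.exp ((t * l) • K)) (x 0) := by
  set y : ℝ → V := fun t => Real.exp (-(t * l)) • (NormedSpace.exp ((t * l) • K)) (x 0) with hy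
  have hyd : ∀ t, HasDerivAt y (l • (K (y t) - y t)) t := by
    intro t
    have h1 := (hasDerivAt_exp_smul_const' (𝕂 := ℝ) (l • K) t)
    have h2 := (h1.clm_apply (hasDerivAt_const t (x 0)))
    have h3 : HasDerivAt (fun t : ℝ => Real.exp (-(t * l))) (Real.exp (-(t * l)) * (-(1 * l))) t :=
      ((hasDerivAt_id t).mul_const l).neg.exp
    have h4 := h3.smul h2
    simp only [smul_smul] at h4
    refine h4.congr_deriv ?_
    simp only [hy, map_zero, add_zero, mul_apply_eq_comp, smul_apply, map_smul]
    module
  have := ODE_solution_unique (v := fun _ z => l • (K z - z)) (a := 0) (b := t) (f := x) (g := y)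
    (K := ‖l • (K - 1)‖₊) (fun _ => ?_) ?_ ?_ ?_ ?_ ?_
  · exact this ⟨ht, le_rfl⟩
  · exact (l • (K - 1)).lipschitz
  · exact fun s hs => ((hx s hs.1).continuousWithinAt).mono Set.Icc_subset_Ici_self
  · exact fun s hs => (hx s hs.1).mono (Set.Ici_subset_Ici.2 hs.1)
  · exact fun s _ => (hyd s).continuousAt.continuousWithinAt
  · exact fun s _ => (hyd s).hasDerivWithinAt
  · simp [hy]

end Flow

/-! ### Solutions as differentiable curves in `L¹` -/

section Solutions

variable {E : Type*} [NormedAddCommGroup E] [InnerProductSpace ℝ E] [FiniteDimensional ℝ E]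
  [MeasurableSpace E] [BorelSpace E] {m : Measure E}

/-- The curve in `L¹(m)` given by a family of functions. -/
def toL1Curve (m : Measure E) (f : ℝ → E → ℝ) (t : ℝ) : Lp ℝ 1 m :=
  open Classical in if h : Integrable (f t) m then h.toL1 (f t) else 0

lemma toL1Curve_eq {f : ℝ → E → ℝ} {t : ℝ} (h : Integrable (f t) m) :
    toL1Curve m f t = h.toL1 (f t) := dif_pos h

/-- The `L¹` norm in the definition is the distance between the slope of the curve and `G` of its
value. The value `0` given to `toL1Curve` at nonintegrable times is never seen, since only times in
`[0,∞)` enter. -/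
lemma isL1Solution_iff {A : (E → ℝ) → E → ℝ} {G : Lp ℝ 1 m →L[ℝ] Lp ℝ 1 m}
    (hG : ∀ f (hf : Integrable f m), G (hf.toL1 f) =ᵐ[m] A f) {f : ℝ → E → ℝ} :
    IsL1Solution m A f ↔ (∀ t, 0 ≤ t → Integrable (f t) m) ∧
      ∀ t, 0 ≤ t → HasDerivWithinAt (toL1Curve m f) (G (toL1Curve m f t)) (Set.Ici 0) t := by
  refine and_congr_right fun hf => forall_congr' fun t => forall_congr' fun ht => ?_
  rw [hasDerivWithinAt_iff_tendsto_slope, tendsto_iff_edist_tendsto_0]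
  refine tendsto_congr' ?_
  filter_upwards [self_mem_nhdsWithin] with s hs
  have hs0 : 0 ≤ s := hs.1
  rw [Lp.edist_def]
  refine eLpNorm_congr_ae ?_
  rw [slope_def_module, toL1Curve_eq (hf t ht), toL1Curve_eq (hf s hs0), ← Integrable.toL1_sub,
    ← Integrable.toL1_smul]
  filter_upwards [hG _ (hf t ht), Integrable.coeFn_toL1 (((hf s hs0).sub (hf t ht)).smul (s - t)⁻¹)]
    with v h1 h2
  rw [Pi.sub_apply, h1]
  exact congrArg (· - A (f t) v) h2.symm

end Solutions

/-! ### The transformed generator: commutation with the semigroup, decrease of entropy -/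

variable {d N : ℕ} {β lam mu : ℝ} {ρ : Measure (Direction d)} [IsProbabilityMeasure ρ]

variable (N ρ) in
/-- The operator `Q` on `L¹(γ)`. -/
def qL1 (hβ : 0 < β) : Lp ℝ 1 (gauss (State d N) β) →L[ℝ] Lp ℝ 1 (gauss (State d N) β) :=
  if N ≤ 1 then 1
  else ((N.choose 2 : ℕ) : ℝ)⁻¹ • ∑ i : Fin N, ∑ j ∈ Finset.Ioi i, pairL1 ρ hβ i j

variable (N ρ) in
/-- The operator `T` on `L¹(γ)`. -/
def tL1 (hβ : 0 < β) : Lp ℝ 1 (gauss (State d N) β) →L[ℝ] Lp ℝ 1 (gauss (State d N) β) :=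
  (N : ℝ)⁻¹ • ∑ j : Fin N, thermostatL1 ρ hβ j

variable (N lam mu ρ) in
/-- The generator of the transformed equation on `L¹(γ)`. -/
def generatorL1 (hβ : 0 < β) :
    Lp ℝ 1 (gauss (State d N) β) →L[ℝ] Lp ℝ 1 (gauss (State d N) β) :=
  (lam * N) • (qL1 N ρ hβ - 1) + (mu * N) • (tL1 N ρ hβ - 1)

lemma commute_ouL1_generatorL1 (hβ : 0 < β) {s : ℝ} (hs : 0 ≤ s) :
    Commute (ouL1 hβ hs) (generatorL1 N lam mu ρ hβ) := by
  have h1 : Commute (ouL1 hβ hs) (qL1 N ρ hβ) := by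
    unfold qL1
    split_ifs
    · exact Commute.one_right _
    · exact (Commute.sum_right _ _ _ fun i _ => Commute.sum_right _ _ _ fun j _ =>
        commute_ouL1_pairL1 hβ hs i j).smul_right _
  have h2 : Commute (ouL1 hβ hs) (tL1 N ρ hβ) :=
    (Commute.sum_right _ _ _ fun j _ => commute_ouL1_thermostatL1 hβ hs j).smul_right _
  exact ((h1.sub_right (Commute.one_right _)).smul_right _).add_right
    ((h2.sub_right (Commute.one_right _)).smul_right _)

/-- Makes the weights in `Q` add up to one, so that `Q` is a convex combination of pair operators.
-/
lemma sum_card_Ioi (N : ℕ) : ∑ i : Fin N, (Finset.Ioi i).card = N.choose 2 := by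
  have h : ∀ i : Fin N, (Finset.Ioi i).card = N - 1 - i := fun i => by
    rw [Fin.card_Ioi]
  simp only [h]
  rw [Fin.sum_univ_eq_sum_range (fun i => N - 1 - i) N, Finset.sum_range_reflect (fun i => i) N,
    Finset.sum_range_id, Nat.choose_two_right]

lemma qL1_mem {S : ENNReal} (hβ : 0 < β) (hS : S ≠ ⊤) {u : Lp ℝ 1 (gauss (State d N) β)}
    (hu : u ∈ entropySublevel (gauss (State d N) β) S) :
    qL1 N ρ hβ u ∈ entropySublevel (gauss (State d N) β) S := by
  have := isProbabilityMeasure_gauss (E := State d N) hβ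
  unfold qL1
  split_ifs with hN
  · exact hu
  have h1 : (((N.choose 2 : ℕ) : ℝ)⁻¹ • ∑ i : Fin N, ∑ j ∈ Finset.Ioi i, pairL1 ρ hβ i j) u =
      ∑ p ∈ (Finset.univ : Finset (Fin N)).sigma fun i => Finset.Ioi i,
        ((N.choose 2 : ℕ) : ℝ)⁻¹ • pairL1 ρ hβ p.1 p.2 u := by
    rw [Finset.sum_sigma', smul_apply, sum_apply, Finset.smul_sum]
  rw [h1]
  refine (convex_entropySublevel S).sum_mem (fun _ _ => by positivity) ?_
    (fun p _ => avgL1_mem_entropySublevel (measurePreserving_pairMap hβ p.1 p.2) hS hu)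
  rw [Finset.sum_const, Finset.card_sigma, sum_card_Ioi, nsmul_eq_mul, mul_inv_cancel₀]
  exact_mod_cast (Nat.choose_pos (by omega : 2 ≤ N)).ne'

lemma tL1_mem {S : ENNReal} (hN : 1 ≤ N) (hβ : 0 < β) (hS : S ≠ ⊤)
    {u : Lp ℝ 1 (gauss (State d N) β)} (hu : u ∈ entropySublevel (gauss (State d N) β) S) :
    tL1 N ρ hβ u ∈ entropySublevel (gauss (State d N) β) S := by
  have := isProbabilityMeasure_gauss (E := State d N) hβ
  have := isProbabilityMeasure_gauss (E := Vel d) hβ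
  rw [tL1, smul_apply, sum_apply, Finset.smul_sum]
  refine (convex_entropySublevel S).sum_mem (fun _ _ => by positivity) ?_
    (fun j _ => avgL1_mem_entropySublevel (measurePreserving_thermostatMap hβ j) hS hu)
  rw [Finset.sum_const, Finset.card_univ, Fintype.card_fin, nsmul_eq_mul, mul_inv_cancel₀]
  exact_mod_cast (by omega : N ≠ 0)

lemma qL1_ae (hβ : 0 < β) (f : State d N → ℝ) (hf : Integrable f (gauss (State d N) β)) :
    qL1 N ρ hβ (hf.toL1 f) =ᵐ[gauss (State d N) β] opQ ρ f := by
  have := isProbabilityMeasure_gauss (E := State d N) hβ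
  unfold qL1
  split_ifs with hN
  · filter_upwards [hf.coeFn_toL1] with v hv
    rw [opQ, if_pos hN, ← hv]
    rfl
  have h1 : ∀ i j : Fin N, (pairL1 ρ hβ i j (hf.toL1 f) : State d N → ℝ)
      =ᵐ[gauss (State d N) β] fun v => ∫ σ, f (collidePair σ i j v) ∂ρ := fun i j => by
    unfold pairL1
    rw [avgL1_toL1]
    exact Integrable.coeFn_toL1 _
  rw [smul_apply]
  simp only [sum_apply]
  refine (Lp.coeFn_smul _ _).trans ?_
  have h2 : ∀ᵐ v ∂gauss (State d N) β, ∀ i j : Fin N,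
      (pairL1 ρ hβ i j (hf.toL1 f)) v = ∫ σ, f (collidePair σ i j v) ∂ρ :=
    ae_all_iff.2 fun i => ae_all_iff.2 fun j => h1 i j
  have h3 : ∀ᵐ v ∂gauss (State d N) β, ∀ i : Fin N,
      (∑ j ∈ Finset.Ioi i, pairL1 ρ hβ i j (hf.toL1 f) : Lp ℝ 1 (gauss (State d N) β)) v =
        ∑ j ∈ Finset.Ioi i, (pairL1 ρ hβ i j (hf.toL1 f)) v :=
    ae_all_iff.2 fun i => by
      filter_upwards [Lp.coeFn_finsetSum (Finset.Ioi i) fun j => pairL1 ρ hβ i j (hf.toL1 f)]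
        with v hv
      rw [hv, Finset.sum_apply]
  filter_upwards [h2, h3, Lp.coeFn_finsetSum (Finset.univ : Finset (Fin N))
    fun i => ∑ j ∈ Finset.Ioi i, pairL1 ρ hβ i j (hf.toL1 f)] with v hv2 hv3 hv4
  rw [Pi.smul_apply, hv4, opQ, if_neg hN, smul_eq_mul, Finset.sum_apply]
  simp only [hv3, hv2]

lemma tL1_ae (hβ : 0 < β) (f : State d N → ℝ) (hf : Integrable f (gauss (State d N) β)) :
    tL1 N ρ hβ (hf.toL1 f) =ᵐ[gauss (State d N) β] opT β ρ f := by
  have := isProbabilityMeasure_gauss (E := State d N) hβ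
  have := isProbabilityMeasure_gauss (E := Vel d) hβ
  have h1 : ∀ j : Fin N, (thermostatL1 ρ hβ j (hf.toL1 f) : State d N → ℝ)
      =ᵐ[gauss (State d N) β] opTj β ρ j f := fun j => by
    have hT := measurePreserving_thermostatMap (d := d) (ρ := ρ) hβ j
    unfold thermostatL1
    rw [avgL1_toL1 hT hf]
    filter_upwards [Integrable.coeFn_toL1 (integrable_avg hT hf), avg_ae_integrable hT hf]
      with v hv1 hv2
    rw [hv1, avg, integral_prod _ hv2, integral_gauss hβ]
    rfl
  rw [tL1, smul_apply]
  simp only [sum_apply]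
  refine (Lp.coeFn_smul _ _).trans ?_
  have h2 : ∀ᵐ v ∂gauss (State d N) β, ∀ j : Fin N,
      (thermostatL1 ρ hβ j (hf.toL1 f)) v = opTj β ρ j f v := ae_all_iff.2 h1
  filter_upwards [h2, Lp.coeFn_finsetSum (Finset.univ : Finset (Fin N))
    fun j => thermostatL1 ρ hβ j (hf.toL1 f)] with v hv2 hv4
  rw [Pi.smul_apply, hv4, opT, smul_eq_mul, Finset.sum_apply]
  simp only [hv2]

lemma generatorL1_ae (hβ : 0 < β) (f : State d N → ℝ)
    (hf : Integrable f (gauss (State d N) β)) :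
    generatorL1 N lam mu ρ hβ (hf.toL1 f) =ᵐ[gauss (State d N) β]
      transformedGenerator β lam mu ρ f := by
  have : generatorL1 N lam mu ρ hβ (hf.toL1 f) =
      (lam * N) • (qL1 N ρ hβ (hf.toL1 f) - hf.toL1 f) +
        (mu * N) • (tL1 N ρ hβ (hf.toL1 f) - hf.toL1 f) := rfl
  rw [this]
  filter_upwards [qL1_ae (ρ := ρ) hβ f hf, tL1_ae (ρ := ρ) hβ f hf, hf.coeFn_toL1,
    Lp.coeFn_add ((lam * N) • (qL1 N ρ hβ (hf.toL1 f) - hf.toL1 f))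
      ((mu * N) • (tL1 N ρ hβ (hf.toL1 f) - hf.toL1 f)),
    Lp.coeFn_smul (lam * N) (qL1 N ρ hβ (hf.toL1 f) - hf.toL1 f),
    Lp.coeFn_smul (mu * N) (tL1 N ρ hβ (hf.toL1 f) - hf.toL1 f),
    Lp.coeFn_sub (qL1 N ρ hβ (hf.toL1 f)) (hf.toL1 f),
    Lp.coeFn_sub (tL1 N ρ hβ (hf.toL1 f)) (hf.toL1 f)] with v h1 h2 h3 h4 h5 h6 h7 h8
  rw [h4, Pi.add_apply, h5, h6, Pi.smul_apply, Pi.smul_apply, h7, h8, Pi.sub_apply, Pi.sub_apply,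
    h1, h2, h3]
  rfl

lemma isTransformedSolution_iff (hβ : 0 < β) {h : ℝ → State d N → ℝ} :
    IsTransformedSolution β lam mu ρ h ↔
      (∀ t, 0 ≤ t → Integrable (h t) (gauss (State d N) β)) ∧
      ∀ t, 0 ≤ t → HasDerivWithinAt (toL1Curve (gauss (State d N) β) h)
        (generatorL1 N lam mu ρ hβ (toL1Curve (gauss (State d N) β) h t)) (Set.Ici 0) t :=
  isL1Solution_iff (generatorL1_ae hβ)

/-- The Ornstein-Uhlenbeck semigroup maps solutions to solutions. -/
lemma IsTransformedSolution.ornsteinUhlenbeck (hβ : 0 < β) {h : ℝ → State d N → ℝ}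
    (hh : IsTransformedSolution β lam mu ρ h) {s : ℝ} (hs : 0 ≤ s) :
    IsTransformedSolution β lam mu ρ fun t => ornsteinUhlenbeck β s (h t) := by
  have := isProbabilityMeasure_gauss (E := State d N) hβ
  rw [isTransformedSolution_iff hβ] at hh ⊢
  have hM := measurePreserving_mehlerMap (E := State d N) hβ hs
  have hint : ∀ t, 0 ≤ t → Integrable (KacThermostat.ornsteinUhlenbeck β s (h t))
      (gauss (State d N) β) := fun t ht => integrable_avg hM (hh.1 t ht)
  have hcurve : ∀ t, 0 ≤ t → toL1Curve (gauss (State d N) β)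
      (fun t => KacThermostat.ornsteinUhlenbeck β s (h t)) t =
      ouL1 hβ hs (toL1Curve (gauss (State d N) β) h t) := fun t ht => by
    rw [toL1Curve_eq (hint t ht), toL1Curve_eq (hh.1 t ht)]
    exact (avgL1_toL1 hM (hh.1 t ht)).symm
  refine ⟨hint, fun t ht => ?_⟩
  have h1 := (ouL1 hβ hs).hasFDerivAt.comp_hasDerivWithinAt t (hh.2 t ht)
  have h2 : ouL1 hβ hs (generatorL1 N lam mu ρ hβ (toL1Curve (gauss (State d N) β) h t)) =
      generatorL1 N lam mu ρ hβ (ouL1 hβ hs (toL1Curve (gauss (State d N) β) h t)) :=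
    DFunLike.congr_fun (commute_ouL1_generatorL1 hβ hs).eq _
  rw [hcurve t ht, ← h2]
  exact h1.congr (fun x hx => hcurve x hx) (hcurve t ht)

/-- The generator equals `(λ+μ) N (K - 1)`, where `K` is the convex combination of `Q` and `T` with
weights `λ/(λ+μ)` and `μ/(λ+μ)`. `K` preserves the closed convex set, hence so does the flow. -/
lemma IsTransformedSolution.mem_entropySublevel (hN : 1 ≤ N) (hβ : 0 < β) (hlam : 0 < lam)
    (hmu : 0 < mu) {h : ℝ → State d N → ℝ} (hh : IsTransformedSolution β lam mu ρ h)
    {S : ENNReal} (hS : S ≠ ⊤)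
    (h0 : toL1Curve (gauss (State d N) β) h 0 ∈ entropySublevel (gauss (State d N) β) S)
    {t : ℝ} (ht : 0 ≤ t) :
    toL1Curve (gauss (State d N) β) h t ∈ entropySublevel (gauss (State d N) β) S := by
  have := isProbabilityMeasure_gauss (E := State d N) hβ
  rw [isTransformedSolution_iff hβ] at hh
  have hNr : (0 : ℝ) < N := by exact_mod_cast hN
  have hpos : 0 < lam + mu := by positivity
  set K := (lam / (lam + mu)) • qL1 N ρ hβ + (mu / (lam + mu)) • tL1 N ρ hβ with hK
  have hgen : ∀ u, generatorL1 N lam mu ρ hβ u = ((lam + mu) * N) • (K u - u) := fun u => by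
    have e1 : generatorL1 N lam mu ρ hβ u =
      (lam * N) • (qL1 N ρ hβ u - u) + (mu * N) • (tL1 N ρ hβ u - u) := rfl
    have e2 : K u = (lam / (lam + mu)) • qL1 N ρ hβ u + (mu / (lam + mu)) • tL1 N ρ hβ u := rfl
    rw [e1, e2]
    match_scalars <;> field_simp
    ring
  have hKm : ∀ u ∈ entropySublevel (gauss (State d N) β) S,
      K u ∈ entropySublevel (gauss (State d N) β) S := fun u hu =>
    convex_entropySublevel S (qL1_mem hβ hS hu) (tL1_mem hN hβ hS hu) (by positivity)
      (by positivity) (by rw [← add_div, div_self hpos.ne'])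
  have hd := hh.2
  simp only [hgen] at hd
  rw [eq_exp_of_hasDerivWithinAt hd ht]
  exact exp_smul_mem_of_convex (convex_entropySublevel S) (isClosed_entropySublevel S) hKm
    (by positivity) h0

/-- Solutions that start from a probability density of finite entropy keep these properties. -/
lemma IsTransformedSolution.isProbDensity (hN : 1 ≤ N) (hβ : 0 < β) (hlam : 0 < lam)
    (hmu : 0 < mu) {h : ℝ → State d N → ℝ} (hh : IsTransformedSolution β lam mu ρ h)
    (h0 : IsProbDensity (gauss (State d N) β) (h 0))
    (hk : Integrable (fun v => klFun (h 0 v)) (gauss (State d N) β)) {t : ℝ} (ht : 0 ≤ t) :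
    IsProbDensity (gauss (State d N) β) (h t) ∧
      Integrable (fun v => klFun (h t v)) (gauss (State d N) β) := by
  have := isProbabilityMeasure_gauss (E := State d N) hβ
  set S := ∫⁻ v, ENNReal.ofReal (klFun (h 0 v)) ∂gauss (State d N) β with hSdef
  have hS : S ≠ ⊤ := hk.lintegral_lt_top.ne
  have hc : ∀ t, (ht : 0 ≤ t) → toL1Curve (gauss (State d N) β) h t =ᵐ[gauss (State d N) β] h t :=
    fun t ht => by
      rw [toL1Curve_eq (hh.1 t ht)]
      exact Integrable.coeFn_toL1 _
  have hmem := hh.mem_entropySublevel hN hβ hlam hmu hS (t := t) ⟨?_, ?_, ?_⟩ ht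
  · have h1 : 0 ≤ᵐ[gauss (State d N) β] h t := by
      filter_upwards [hc t ht, hmem.1] with v e1 e2
      rw [← e1]; exact e2
    refine ⟨⟨h1, hh.1 t ht, ?_⟩, ?_⟩
    · rw [← integral_congr_ae (hc t ht)]; exact hmem.2.1
    · refine integrable_klFun_of_lintegral hS (hh.1 t ht).aestronglyMeasurable h1 ?_
      refine le_trans (le_of_eq (lintegral_congr_ae ?_)) hmem.2.2
      filter_upwards [hc t ht] with v e1
      rw [e1]
  · filter_upwards [hc 0 le_rfl, h0.1] with v e1 e2
    rw [e1]; exact e2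
  · rw [integral_congr_ae (hc 0 le_rfl)]; exact h0.2.2
  · refine le_of_eq (lintegral_congr_ae ?_)
    filter_upwards [hc 0 le_rfl] with v e1
    rw [e1]

/-! ### Ground state transformation -/

lemma norm_setVel_collideFst (σ : Direction d) (v : State d N) (j : Fin N) (w : Vel d) :
    ‖setVel v j (collideFst σ (v j) w)‖ ^ 2 + ‖collideSnd σ (v j) w‖ ^ 2 = ‖v‖ ^ 2 + ‖w‖ ^ 2 := by
  rw [setVel_collideFst, collideSnd, norm_add_smul_inj_sq, norm_add_smul_dir_sq, inner_sub_right]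
  ring

lemma maxwell_mul_congr {E F : Type*} [NormedAddCommGroup E] [InnerProductSpace ℝ E]
    [NormedAddCommGroup F] [InnerProductSpace ℝ F]
    (v v' : E) (w w' : F) (h : ‖v‖ ^ 2 + ‖w‖ ^ 2 = ‖v'‖ ^ 2 + ‖w'‖ ^ 2) :
    maxwell β v * maxwell β w = maxwell β v' * maxwell β w' := by
  simp only [maxwell]
  have : ∀ A B C D : ℝ, A * Real.exp B * (C * Real.exp D) = A * C * Real.exp (B + D) := by
    intro A B C D; rw [Real.exp_add]; ring
  rw [this, this]
  congr 2
  linear_combination (-(β / 2)) * h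

/-- Energy conservation: `γ` is unchanged by a pair collision, and `γ(v') γ₁(w*) = γ(v) γ₁(w)` for a
thermostat collision. The latter turns the weight `γ₁(w*)` of `R_j` into the weight `γ₁(w)` of
`T_j`. The identity holds pointwise. -/
lemma kacGenerator_eq (hβ : 0 < β) (f : State d N → ℝ) (v : State d N) :
    kacGenerator β lam mu ρ f v =
      maxwell β v * transformedGenerator β lam mu ρ (fun v => f v / maxwell β v) v := by
  have hm : ∀ v : State d N, maxwell β v ≠ 0 := fun v => (maxwell_pos hβ v).ne'
  have hfe : f v = maxwell β v * (f v / maxwell β v) := by field_simp [hm v]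
  have hQ : opQ ρ f v = maxwell β v * opQ ρ (fun v => f v / maxwell β v) v := by
    unfold opQ
    split_ifs
    · exact hfe
    · rw [mul_left_comm]
      congr 1
      rw [Finset.mul_sum]
      refine Finset.sum_congr rfl fun i _ => ?_
      rw [Finset.mul_sum]
      refine Finset.sum_congr rfl fun j _ => ?_
      rw [← integral_const_mul]
      refine integral_congr_ae (Eventually.of_forall fun σ => ?_)
      have : maxwell β (collidePair σ i j v) = maxwell β v :=
        maxwell_congr_norm ((sq_eq_sq₀ (norm_nonneg _) (norm_nonneg _)).1
          (norm_collidePair_sq σ i j v))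
      simp only [this]
      field_simp [hm v]
  have hR : opR β ρ f v = maxwell β v * opT β ρ (fun v => f v / maxwell β v) v := by
    unfold opR opT
    rw [mul_left_comm]
    congr 1
    rw [Finset.mul_sum]
    refine Finset.sum_congr rfl fun j _ => ?_
    unfold opRj opTj
    rw [← integral_const_mul]
    refine integral_congr_ae (Eventually.of_forall fun w => ?_)
    simp only
    rw [← mul_assoc, ← integral_const_mul]
    refine integral_congr_ae (Eventually.of_forall fun σ => ?_)
    have h1 := maxwell_mul_congr (β := β) _ _ _ _ (norm_setVel_collideFst σ v j w)
    have h2 := hm (setVel v j (collideFst σ (v j) w))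
    simp only
    rw [← h1]
    field_simp
  rw [kacGenerator, transformedGenerator, hQ, hR]
  conv_lhs => rw [hfe]
  ring

lemma eLpNorm_gauss_one {E : Type*} [NormedAddCommGroup E] [InnerProductSpace ℝ E]
    [FiniteDimensional ℝ E] [MeasurableSpace E] [BorelSpace E] (hβ : 0 < β) (f : E → ℝ) :
    eLpNorm f 1 (gauss E β) = eLpNorm (fun v => maxwell β v * f v) 1 volume := by
  rw [eLpNorm_one_eq_lintegral_enorm, eLpNorm_one_eq_lintegral_enorm, gauss,
    lintegral_withDensity_eq_lintegral_mul_non_measurable _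
      (measurable_maxwell β).ennreal_ofReal (Eventually.of_forall fun _ => ENNReal.ofReal_lt_top)]
  refine lintegral_congr fun v => ?_
  rw [Pi.mul_apply, enorm_mul, Real.enorm_of_nonneg (maxwell_pos hβ v).le]

lemma integrable_gauss_div_maxwell {E : Type*} [NormedAddCommGroup E] [InnerProductSpace ℝ E]
    [FiniteDimensional ℝ E] [MeasurableSpace E] [BorelSpace E] (hβ : 0 < β) {f : E → ℝ} :
    Integrable (fun v => f v / maxwell β v) (gauss E β) ↔ Integrable f := by
  rw [integrable_gauss_iff hβ]
  refine integrable_congr (Eventually.of_forall fun v => ?_)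
  have := (maxwell_pos hβ v).ne'
  simp only [smul_eq_mul]
  field_simp

/-- The ground state transformation maps solutions of the Kac equation to solutions of the
transformed equation. -/
lemma IsKacSolution.groundState (hβ : 0 < β) {f : ℝ → State d N → ℝ}
    (hf : IsKacSolution β lam mu ρ f) :
    IsTransformedSolution β lam mu ρ (groundState β f) := by
  refine ⟨fun t ht => (integrable_gauss_div_maxwell hβ).2 (hf.1 t ht), fun t ht => ?_⟩
  refine (hf.2 t ht).congr fun s => ?_
  rw [eLpNorm_gauss_one hβ]
  congr 1
  funext v
  have := (maxwell_pos hβ v).ne'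
  rw [kacGenerator_eq hβ]
  simp only [KacThermostat.groundState]
  have e : transformedGenerator β lam mu ρ (KacThermostat.groundState β f t) v =
    transformedGenerator β lam mu ρ (fun v => f t v / maxwell β v) v := rfl
  rw [e]
  field_simp

/-! ### Regularising effect of the semigroup -/

section Smoothing

variable {E : Type*} [NormedAddCommGroup E] [InnerProductSpace ℝ E] [FiniteDimensional ℝ E]
  [MeasurableSpace E] [BorelSpace E] {β a b s : ℝ} {h : E → ℝ}

/-- Coefficients of a genuine Ornstein-Uhlenbeck step. -/
structure IsMehlerPair (a b : ℝ) : Prop where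
  pos_left : 0 < a
  pos_right : 0 < b
  sq_add_sq : a ^ 2 + b ^ 2 = 1

lemma isMehlerPair_exp (hs : 0 < s) :
    IsMehlerPair (Real.exp (-s)) (√(1 - Real.exp (-2 * s))) where
  pos_left := Real.exp_pos _
  pos_right := Real.sqrt_pos.2 (by linarith [Real.exp_lt_one_iff.2 (by linarith : -2 * s < 0)])
  sq_add_sq := mehler_sq hs.le

/-- Put `w = z - (a/b) v`, so that `b z = b w + a v`. As `b² = 1 - a² < 1`, the Gaussian in `w`
decays faster than the one in `b z`; the surplus `β a² ‖w‖²/2` in the exponent absorbs the cross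
term and the factor `1 + ‖w‖`. The right side is the weight against which `h(b z)` is integrable,
which gives dominating functions locally uniform in `v`. -/
lemma maxwell_shift_le (hβ : 0 < β) (hab : IsMehlerPair a b) (R : ℝ) :
    ∃ C, 0 < C ∧ ∀ v z : E, ‖v‖ ≤ R →
      (1 + ‖z - (a / b) • v‖) * maxwell β (z - (a / b) • v) ≤ C * maxwell β (b • z) := by
  obtain ⟨ha, hb, hsq⟩ := hab
  -- The first summand is the maximum over `r = ‖w‖` of `(1 + β a b R) r - β a² r²/2`; the second
  -- comes from the square of `a R`.
  refine ⟨Real.exp ((1 + β * a * b * R) ^ 2 / (2 * β * a ^ 2) + β / 2 * (a ^ 2 * R ^ 2)),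
    Real.exp_pos _, fun v z hv => ?_⟩
  set w := z - (a / b) • v with hw
  have hz : b • z = b • w + a • v := by
    rw [hw, smul_sub, smul_smul, mul_div_cancel₀ _ hb.ne']; abel
  have hR : 0 ≤ R := (norm_nonneg v).trans hv
  have h1 : 1 + ‖w‖ ≤ Real.exp ‖w‖ := by linarith [Real.add_one_le_exp ‖w‖]
  have h2 : ‖b • z‖ ^ 2 ≤ (b * ‖w‖ + a * R) ^ 2 := by
    rw [hz]
    refine pow_le_pow_left₀ (norm_nonneg _) ((norm_add_le _ _).trans ?_) 2
    rw [norm_smul, norm_smul, Real.norm_of_nonneg ha.le, Real.norm_of_nonneg hb.le]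
    gcongr
  rw [maxwell_eq, maxwell_eq, mul_left_comm, mul_left_comm (Real.exp _)]
  refine mul_le_mul_of_nonneg_left ?_ (maxwellConst_pos hβ).le
  calc (1 + ‖w‖) * Real.exp (-(β / 2) * ‖w‖ ^ 2)
      ≤ Real.exp ‖w‖ * Real.exp (-(β / 2) * ‖w‖ ^ 2) := by gcongr
    _ = Real.exp (‖w‖ - β / 2 * ‖w‖ ^ 2) := by rw [← Real.exp_add]; congr 1; ring
    _ ≤ Real.exp ((1 + β * a * b * R) ^ 2 / (2 * β * a ^ 2) + β / 2 * (a ^ 2 * R ^ 2) +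
          -(β / 2) * ‖b • z‖ ^ 2) := by
        refine Real.exp_le_exp.2 ?_
        have h3 : ‖w‖ * (1 + β * a * b * R) - β * a ^ 2 / 2 * ‖w‖ ^ 2 ≤
            (1 + β * a * b * R) ^ 2 / (2 * β * a ^ 2) := by
          rw [le_div_iff₀ (by positivity)]
          nlinarith [sq_nonneg (β * a ^ 2 * ‖w‖ - (1 + β * a * b * R))]
        have h4 : β / 2 * ‖b • z‖ ^ 2 ≤ β / 2 * (b * ‖w‖ + a * R) ^ 2 := by gcongr
        have h5 : b ^ 2 = 1 - a ^ 2 := by linarith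
        have h6 : (b * ‖w‖ + a * R) ^ 2 = (1 - a ^ 2) * ‖w‖ ^ 2 + 2 * a * b * R * ‖w‖ + a ^ 2 * R ^ 2 := by
          rw [← h5]; ring
        rw [h6] at h4
        linarith
    _ = _ := Real.exp_add _ _

lemma integrable_dilate (hβ : 0 < β) (hb : 0 < b) (hh : Integrable h (gauss E β)) :
    Integrable (fun z : E => maxwell β (b • z) * h (b • z)) := by
  rw [integrable_gauss_iff hβ] at hh
  exact hh.comp_smul hb.ne'

lemma mehler_shift (hb : 0 < b) (v z : E) : a • v + b • (z - (a / b) • v) = b • z := by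
  rw [smul_sub, smul_smul, mul_div_cancel₀ _ hb.ne']; abel

/-- The substitution `x = z - (a/b) v` moves the dependence on `v` from `h` to the Gaussian kernel.
All smoothness of `P_s h` comes from this. -/
lemma integral_mehler_eq {G : Type*} [NormedAddCommGroup G] [NormedSpace ℝ G] (hβ : 0 < β)
    (hb : 0 < b) (X : E → G) (v : E) :
    ∫ x, h (a • v + b • x) • X x ∂gauss E β =
      ∫ z, h (b • z) • maxwell β (z - (a / b) • v) • X (z - (a / b) • v) := by
  rw [integral_gauss hβ, ← integral_sub_right_eq_self _ ((a / b) • v)]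
  simp only [mehler_shift hb]
  refine integral_congr_ae (Eventually.of_forall fun z => ?_)
  exact smul_comm _ _ _

lemma integrable_mehler_iff {G : Type*} [NormedAddCommGroup G] [NormedSpace ℝ G] (hβ : 0 < β)
    (hb : 0 < b) (X : E → G) (v : E) :
    Integrable (fun x => h (a • v + b • x) • X x) (gauss E β) ↔
      Integrable fun z => h (b • z) • maxwell β (z - (a / b) • v) • X (z - (a / b) • v) := by
  rw [integrable_gauss_iff hβ, ← (measurePreserving_sub_right volume ((a / b) • v)).integrable_comp_emb
    (MeasurableEquiv.subRight ((a / b) • v)).measurableEmbedding]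
  refine integrable_congr (Eventually.of_forall fun z => ?_)
  simp only [Function.comp, mehler_shift hb]
  exact smul_comm _ _ _

lemma aestronglyMeasurable_dilate (hβ : 0 < β) (hb : 0 < b) (hh : Integrable h (gauss E β)) :
    AEStronglyMeasurable (fun z : E => h (b • z)) := by
  have h1 := (integrable_dilate hβ hb hh).aestronglyMeasurable
  have h2 : Continuous fun z : E => (maxwell β (b • z))⁻¹ :=
    ((continuous_maxwell β).comp (continuous_const_smul b)).inv₀ fun z => (maxwell_pos hβ _).ne'
  refine (h2.aestronglyMeasurable.mul h1).congr (Eventually.of_forall fun z => ?_)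
  have := (maxwell_pos hβ (b • z)).ne'
  simp only [Pi.mul_apply]
  field_simp

/-- For every `v`, the displaced function has an integrable first moment. -/
lemma integrable_mehler_of_growth {G : Type*} [NormedAddCommGroup G] [NormedSpace ℝ G]
    (hβ : 0 < β) (hab : IsMehlerPair a b) (hh : Integrable h (gauss E β)) {X : E → G}
    (hX : Continuous X) (hXb : ∀ x, ‖X x‖ ≤ 1 + ‖x‖) (v : E) :
    Integrable (fun x => h (a • v + b • x) • X x) (gauss E β) := by
  rw [integrable_mehler_iff hβ hab.pos_right]
  obtain ⟨C, hC, hb⟩ := maxwell_shift_le (E := E) hβ hab ‖v‖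
  refine ((integrable_dilate hβ hab.pos_right hh).norm.const_mul C).mono'
    ((aestronglyMeasurable_dilate hβ hab.pos_right hh).smul
      (Continuous.aestronglyMeasurable (by have := continuous_maxwell (E := E) β; fun_prop)))
    (Eventually.of_forall fun z => ?_)
  have h1 := hb v z le_rfl
  have h2 := maxwell_pos hβ (z - (a / b) • v)
  have h3 := maxwell_pos hβ (b • z)
  rw [norm_smul, norm_smul, norm_mul, Real.norm_of_nonneg h2.le, Real.norm_of_nonneg h3.le]
  calc ‖h (b • z)‖ * (maxwell β (z - (a / b) • v) * ‖X (z - (a / b) • v)‖)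
      ≤ ‖h (b • z)‖ * (C * maxwell β (b • z)) := by
        refine mul_le_mul_of_nonneg_left (le_trans ?_ h1) (norm_nonneg _)
        rw [mul_comm]
        exact mul_le_mul_of_nonneg_right (hXb _) h2.le
    _ = C * (maxwell β (b • z) * ‖h (b • z)‖) := by ring

lemma integrable_mehler (hβ : 0 < β) (hab : IsMehlerPair a b) (hh : Integrable h (gauss E β))
    (v : E) : Integrable (fun x => h (a • v + b • x)) (gauss E β) := by
  have := integrable_mehler_of_growth hβ hab hh (X := fun _ => (1 : ℝ)) continuous_const
    (fun x => by simp) v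
  simpa using this

lemma integrable_mehler_smul (hβ : 0 < β) (hab : IsMehlerPair a b)
    (hh : Integrable h (gauss E β)) (v : E) :
    Integrable (fun x => h (a • v + b • x) • x) (gauss E β) :=
  integrable_mehler_of_growth hβ hab hh (X := fun x => x) continuous_id
    (fun x => by simp) v

lemma quasiMeasurePreserving_affine (hb : b ≠ 0) (w : E) :
    Measure.QuasiMeasurePreserving (fun x : E => w + b • x) volume volume := by
  have h1 : Measure.QuasiMeasurePreserving (fun x : E => b • x) volume volume := by
    refine ⟨measurable_const_smul b, ?_⟩
    rw [Measure.map_addHaar_smul _ hb]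
    exact Measure.smul_absolutelyContinuous
  exact (measurePreserving_add_left volume w).quasiMeasurePreserving.comp h1

/-- For `b ≠ 0` the noise has a density around every single point `w`, so null sets are avoided for
each starting point and not just for almost every one. -/
lemma ae_mehler (hβ : 0 < β) (hb : b ≠ 0) {p : E → Prop} (hp : ∀ᵐ y ∂gauss E β, p y) (w : E) :
    ∀ᵐ x ∂gauss E β, p (w + b • x) :=
  (ae_gauss_iff hβ).2 ((quasiMeasurePreserving_affine hb w).ae ((ae_gauss_iff hβ).1 hp))

/-- The gradient of `P_s h`. -/
def ouGrad (β s : ℝ) (h : E → ℝ) (v : E) : E :=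
  (β * Real.exp (-s) / √(1 - Real.exp (-2 * s))) •
    ∫ x, h (Real.exp (-s) • v + √(1 - Real.exp (-2 * s)) • x) • x ∂gauss E β

/-- After the shift only the kernel is differentiated, and `∇γ = -β x γ` brings down the factor `x`.
Integrability of `h` is enough. -/
lemma hasFDerivAt_mehler (hβ : 0 < β) (hab : IsMehlerPair a b) (hh : Integrable h (gauss E β))
    (v : E) :
    HasFDerivAt (fun v : E => ∫ x, h (a • v + b • x) ∂gauss E β)
      (innerSL ℝ ((β * a / b) • ∫ x, h (a • v + b • x) • x ∂gauss E β)) v := by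
  have hb := hab.pos_right
  have e1 : (fun v : E => ∫ x, h (a • v + b • x) ∂gauss E β) =
      fun v => ∫ z, h (b • z) * maxwell β (z - (a / b) • v) := by
    funext v
    have := integral_mehler_eq (a := a) (h := h) hβ hb (fun _ => (1 : ℝ)) v
    simpa using this
  obtain ⟨C, hC, hCb⟩ := maxwell_shift_le (E := E) hβ hab (‖v‖ + 1)
  have hm := aestronglyMeasurable_dilate hβ hb hh
  have hmax := continuous_maxwell (E := E) β
  have key := hasFDerivAt_integral_of_dominated_of_fderiv_le (μ := (volume : Measure E))
    (F := fun v z => h (b • z) * maxwell β (z - (a / b) • v))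
    (F' := fun v z => (h (b • z) * (β * (a / b) * maxwell β (z - (a / b) • v))) •
      innerSL ℝ (z - (a / b) • v))
    (bound := fun z => β * (a / b) * C * ‖maxwell β (b • z) * h (b • z)‖)
    (Metric.ball_mem_nhds v one_pos) ?_ ?_ ?_ ?_ ?_ ?_
  · rw [e1]
    refine key.congr_fderiv ?_
    ext w
    have hint := integrable_mehler_smul hβ hab hh v
    rw [integrable_mehler_iff hβ hb] at hint
    rw [integral_mehler_eq hβ hb (fun x => x), innerSL_apply_apply, inner_smul_left, real_inner_comm,
      ← integral_inner hint, ← integral_const_mul, ContinuousLinearMap.integral_apply]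
    · refine integral_congr_ae (Eventually.of_forall fun z => ?_)
      simp only [smul_apply, innerSL_apply_apply, smul_eq_mul, inner_smul_right, RCLike.conj_to_real,
        real_inner_comm w]
      ring
    · have h2 : (fun z => (h (b • z) * (β * (a / b) * maxwell β (z - (a / b) • v))) •
        innerSL ℝ (z - (a / b) • v)) = fun z => (β * (a / b)) • (innerSL ℝ : E →L[ℝ] E →L[ℝ] ℝ)
          (h (b • z) • maxwell β (z - (a / b) • v) • (z - (a / b) • v)) := by
        funext z
        simp only [map_smul, smul_smul]
        congr 1
        ring
      rw [h2]
      exact ((innerSL ℝ : E →L[ℝ] E →L[ℝ] ℝ).integrable_comp hint).smul (β * (a / b))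
  · refine Eventually.of_forall fun v => hm.mul (Continuous.aestronglyMeasurable (by fun_prop))
  · have := integrable_mehler hβ hab hh v
    have h2 := (integrable_mehler_iff (h := h) (a := a) hβ hb (fun _ => (1 : ℝ)) v).1
      (by simpa using this)
    simpa using h2
  · refine (hm.mul (Continuous.aestronglyMeasurable (by fun_prop))).smul
      (Continuous.aestronglyMeasurable (by fun_prop))
  · refine Eventually.of_forall fun z w hw => ?_
    have hwn : ‖w‖ ≤ ‖v‖ + 1 := by
      have := norm_le_norm_add_norm_sub' w v
      have h3 := mem_ball_iff_norm.1 hw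
      linarith
    have h1 := hCb w z hwn
    have h2 := maxwell_pos hβ (z - (a / b) • w)
    have h3 := maxwell_pos hβ (b • z)
    have hc : 0 < β * (a / b) := mul_pos hβ (div_pos hab.pos_left hb)
    rw [norm_smul, innerSL_apply_norm, norm_mul, norm_mul (β * (a / b)),
      norm_mul (maxwell β (b • z)), Real.norm_of_nonneg h2.le,
      Real.norm_of_nonneg h3.le, Real.norm_of_nonneg hc.le]
    calc ‖h (b • z)‖ * (β * (a / b) * maxwell β (z - (a / b) • w)) * ‖z - (a / b) • w‖
        = (β * (a / b) * ‖h (b • z)‖) * (‖z - (a / b) • w‖ * maxwell β (z - (a / b) • w)) := by ring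
      _ ≤ (β * (a / b) * ‖h (b • z)‖) * (C * maxwell β (b • z)) := by
          refine mul_le_mul_of_nonneg_left (le_trans ?_ h1) (by positivity)
          exact mul_le_mul_of_nonneg_right (by linarith) h2.le
      _ = β * (a / b) * C * (maxwell β (b • z) * ‖h (b • z)‖) := by ring
  · exact ((integrable_dilate hβ hb hh).norm).const_mul _
  · refine Eventually.of_forall fun z w _ => ?_
    have h1 : HasFDerivAt (fun w : E => z - (a / b) • w) (-((a / b) • ContinuousLinearMap.id ℝ E)) w := by
      exact ((hasFDerivAt_id w).const_smul (a / b)).const_sub z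
    have h2 := (((hasFDerivAt_maxwell β (z - (a / b) • w)).comp w h1).const_mul (h (b • z)))
    refine h2.congr_fderiv ?_
    ext y
    simp
    ring

lemma hasFDerivAt_ou (hβ : 0 < β) (hs : 0 < s) (hh : Integrable h (gauss E β)) (v : E) :
    HasFDerivAt (ornsteinUhlenbeck β s h) (innerSL ℝ (ouGrad β s h v)) v :=
  hasFDerivAt_mehler hβ (isMehlerPair_exp hs) hh v

lemma continuous_ouGrad (hβ : 0 < β) (hs : 0 < s) (hh : Integrable h (gauss E β)) :
    Continuous (ouGrad β s h) := by
  have hab := isMehlerPair_exp hs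
  unfold ouGrad
  generalize Real.exp (-s) = a at *
  generalize √(1 - Real.exp (-2 * s)) = b at *
  have hb := hab.pos_right
  refine Continuous.const_smul ?_ _
  simp only [integral_mehler_eq (h := h) hβ hb (fun x : E => x)]
  have hm := aestronglyMeasurable_dilate hβ hb hh
  have hmax := continuous_maxwell (E := E) β
  rw [continuous_iff_continuousAt]
  intro v
  obtain ⟨C, hC, hCb⟩ := maxwell_shift_le (E := E) hβ hab (‖v‖ + 1)
  refine continuousAt_of_dominated (bound := fun z => C * ‖maxwell β (b • z) * h (b • z)‖)
    (Eventually.of_forall fun w => hm.smul (Continuous.aestronglyMeasurable (by fun_prop))) ?_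
    ((integrable_dilate hβ hb hh).norm.const_mul _)
    (Eventually.of_forall fun z => Continuous.continuousAt (by fun_prop))
  filter_upwards [Metric.ball_mem_nhds v one_pos] with w hw
  refine Eventually.of_forall fun z => ?_
  have hwn : ‖w‖ ≤ ‖v‖ + 1 := by
    have := norm_le_norm_add_norm_sub' w v
    have h3 := mem_ball_iff_norm.1 hw
    linarith
  have h1 := hCb w z hwn
  have h2 := maxwell_pos hβ (z - (a / b) • w)
  have h3 := maxwell_pos hβ (b • z)
  rw [norm_smul, norm_smul, norm_mul, Real.norm_of_nonneg h2.le, Real.norm_of_nonneg h3.le]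
  calc ‖h (b • z)‖ * (maxwell β (z - (a / b) • w) * ‖z - (a / b) • w‖)
      ≤ ‖h (b • z)‖ * (C * maxwell β (b • z)) := by
        refine mul_le_mul_of_nonneg_left (le_trans ?_ h1) (norm_nonneg _)
        rw [mul_comm]
        exact mul_le_mul_of_nonneg_right (by linarith) h2.le
    _ = C * (maxwell β (b • z) * ‖h (b • z)‖) := by ring

lemma ou_congr_ae (hβ : 0 < β) (hs : 0 < s) {g : E → ℝ} (hhg : h =ᵐ[gauss E β] g) :
    ornsteinUhlenbeck β s h = ornsteinUhlenbeck β s g := by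
  funext v
  refine integral_congr_ae ?_
  filter_upwards [ae_mehler hβ (isMehlerPair_exp hs).pos_right.ne' hhg (Real.exp (-s) • v)] with x hx
  exact hx

end Smoothing

/-- Cauchy-Schwarz for the measure `p κ`, from the discriminant of `t ↦ ∫ p (t - ‖X‖)²`. -/
lemma norm_integral_smul_sq_le {α G : Type*} [MeasurableSpace α] [NormedAddCommGroup G]
    [NormedSpace ℝ G] {κ : Measure α} {p : α → ℝ} {X : α → G} (hp : 0 ≤ᵐ[κ] p)
    (hpi : Integrable p κ) (hX : Integrable (fun x => p x * ‖X x‖ ^ 2) κ)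
    (hXm : AEStronglyMeasurable X κ) :
    ‖∫ x, p x • X x ∂κ‖ ^ 2 ≤ (∫ x, p x ∂κ) * ∫ x, p x * ‖X x‖ ^ 2 ∂κ := by
  have hB : Integrable (fun x => p x * ‖X x‖) κ := by
    refine (hpi.add hX).mono' (hpi.aestronglyMeasurable.mul hXm.norm) ?_
    filter_upwards [hp] with x hx
    have hx : 0 ≤ p x := hx
    rw [Real.norm_of_nonneg (mul_nonneg hx (norm_nonneg _)), Pi.add_apply]
    nlinarith [mul_nonneg hx (sq_nonneg (‖X x‖ - 1 / 2))]
  have h1 : ‖∫ x, p x • X x ∂κ‖ ≤ ∫ x, p x * ‖X x‖ ∂κ := by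
    refine (norm_integral_le_integral_norm _).trans (le_of_eq (integral_congr_ae ?_))
    filter_upwards [hp] with x hx
    rw [norm_smul, Real.norm_of_nonneg hx]
  have h2 : ∀ t : ℝ, 0 ≤ (∫ x, p x ∂κ) * (t * t) + (-2 * ∫ x, p x * ‖X x‖ ∂κ) * t +
      ∫ x, p x * ‖X x‖ ^ 2 ∂κ := fun t => by
    have h3 : 0 ≤ ∫ x, (p x * (t * t) + p x * ‖X x‖ * (-2 * t) + p x * ‖X x‖ ^ 2) ∂κ := by
      refine integral_nonneg_of_ae ?_
      filter_upwards [hp] with x hx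
      have hx : 0 ≤ p x := hx
      change 0 ≤ p x * (t * t) + p x * ‖X x‖ * (-2 * t) + p x * ‖X x‖ ^ 2
      nlinarith [mul_nonneg hx (sq_nonneg (t - ‖X x‖))]
    have hI : Integrable (fun x => p x * (t * t) + p x * ‖X x‖ * (-2 * t)) κ :=
      (hpi.mul_const _).add (hB.mul_const _)
    rw [integral_add hI hX,
      integral_add (hpi.mul_const _) (hB.mul_const _), integral_mul_const, integral_mul_const] at h3
    linarith
  have h4 := discrim_le_zero h2
  rw [discrim] at h4
  have h5 := pow_le_pow_left₀ (norm_nonneg _) h1 2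
  linarith

/-- `log x` is the derivative of `klFun` at `x`, so the left side is the first order Taylor
remainder, equal to `y log(y/x) - (y - x)`. The bound `log r ≤ r - 1` makes it quadratic. -/
lemma klFun_sub_le {x y : ℝ} (hx : 0 < x) (hy : 0 < y) :
    klFun y - klFun x - Real.log x * (y - x) ≤ (y - x) ^ 2 / x := by
  have h1 : Real.log (y / x) ≤ y / x - 1 := Real.log_le_sub_one_of_pos (by positivity)
  rw [Real.log_div hy.ne' hx.ne'] at h1
  have h2 : y * (Real.log y - Real.log x) ≤ y * (y / x - 1) := by gcongr
  have h3 : y * (y / x - 1) - (y - x) = (y - x) ^ 2 / x := by field_simp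
  rw [← h3, klFun_apply, klFun_apply]
  linarith

lemma le_klFun_sub {x y : ℝ} (hx : 0 < x) (hy : 0 < y) :
    0 ≤ klFun y - klFun x - Real.log x * (y - x) := by
  have h1 : Real.log (x / y) ≤ x / y - 1 := Real.log_le_sub_one_of_pos (by positivity)
  rw [Real.log_div hx.ne' hy.ne'] at h1
  have h2 : y * (Real.log x - Real.log y) ≤ y * (x / y - 1) := by gcongr
  have h3 : y * (x / y - 1) = x - y := by field_simp
  rw [klFun_apply, klFun_apply]
  linarith

/-! ### Increments of the Ornstein-Uhlenbeck process for nice functions -/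

section Nice

variable {E : Type*} [NormedAddCommGroup E] [InnerProductSpace ℝ E] [FiniteDimensional ℝ E]
  [MeasurableSpace E] [BorelSpace E] {β a b s : ℝ} {h : E → ℝ}

lemma abs_sub_le_of_gradient {f : E → ℝ} {G : E → E} {L : ℝ}
    (hf : ∀ v, HasFDerivAt f (innerSL ℝ (G v)) v) (hG : ∀ v, ‖G v‖ ≤ L) (x y : E) :
    |f y - f x| ≤ L * ‖y - x‖ := by
  have := convex_univ.norm_image_sub_le_of_norm_hasFDerivWithin_le (𝕜 := ℝ) (f := f)
    (f' := fun v => innerSL ℝ (G v)) (C := L) (s := Set.univ)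
    (fun v _ => (hf v).hasFDerivWithinAt) (fun v _ => by rw [innerSL_apply_norm]; exact hG v)
    (Set.mem_univ x) (Set.mem_univ y)
  exact this

/-- The increment of the Ornstein-Uhlenbeck process. -/
lemma mehler_eq_add (s : ℝ) (y x : E) : mehler s (y, x) =
    y + ((Real.exp (-s) - 1) • y + √(1 - Real.exp (-2 * s)) • x) := by
  rw [mehler]; module

lemma continuous_mehler (s : ℝ) : Continuous (mehler (E := E) s) := by
  unfold mehler; fun_prop

lemma continuous_mehler_time (p : E × E) : Continuous fun s => mehler s p := by
  unfold mehler; fun_prop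

lemma tendsto_sqrt_inv_mul_sqrt :
    Tendsto (fun s : ℝ => (√s)⁻¹ * √(1 - Real.exp (-2 * s))) (𝓝[>] 0) (𝓝 (√2)) := by
  have h1 : HasDerivAt (fun s : ℝ => 1 - Real.exp (-2 * s)) 2 0 := by
    have := (((hasDerivAt_id (0 : ℝ)).const_mul (-2)).exp).const_sub 1
    simpa using this
  have h2 := h1.tendsto_slope.mono_left (nhdsGT_le_nhdsNE 0)
  have h3 := (Real.continuous_sqrt.tendsto 2).comp h2
  refine h3.congr' ?_
  filter_upwards [self_mem_nhdsWithin] with s hs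
  have hs : 0 < s := hs
  simp only [Function.comp, slope_def_field]
  norm_num
  rw [Real.sqrt_div (by linarith [Real.exp_le_one_iff.2 (by linarith : -(2 * s) ≤ 0)])]
  field_simp

lemma tendsto_sqrt_inv_mul_exp :
    Tendsto (fun s : ℝ => (√s)⁻¹ * (Real.exp (-s) - 1)) (𝓝[>] 0) (𝓝 0) := by
  have h1 : HasDerivAt (fun s : ℝ => Real.exp (-s)) (-1) 0 := by
    have := ((hasDerivAt_id (0 : ℝ)).neg).exp
    simpa using this
  have h2 := h1.tendsto_slope.mono_left (nhdsGT_le_nhdsNE 0)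
  have h3 : Tendsto (fun s : ℝ => √s) (𝓝[>] 0) (𝓝 0) := by
    have := (Real.continuous_sqrt.tendsto 0).mono_left (nhdsWithin_le_nhds (s := Set.Ioi 0))
    simpa using this
  have h4 := h3.mul h2
  rw [zero_mul] at h4
  refine h4.congr' ?_
  filter_upwards [self_mem_nhdsWithin] with s hs
  have hs : 0 < s := hs
  simp only [slope_def_field, neg_zero, Real.exp_zero, sub_zero]
  have h5 : √s * √s = s := Real.mul_self_sqrt hs.le
  have h6 : 0 < √s := Real.sqrt_pos.2 hs
  rw [inv_mul_eq_div, mul_div_assoc', div_eq_div_iff hs.ne' h6.ne']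
  linear_combination (Real.exp (-s) - 1) * h5

/-- At scale `√s` the drift coefficient `e^{-s} - 1 = O(s)` disappears, and the noise coefficient,
asymptotic to `√(2s)`, leaves `√2 x`. -/
lemma tendsto_increment {f : E → ℝ} {f' : E →L[ℝ] ℝ} {y : E} (hf : HasFDerivAt f f' y) (x : E) :
    Tendsto (fun s => (√s)⁻¹ * (f (mehler s (y, x)) - f y)) (𝓝[>] 0) (𝓝 (√2 * f' x)) := by
  have hd : Tendsto (fun s : ℝ => (√s)⁻¹ •
      ((Real.exp (-s) - 1) • y + √(1 - Real.exp (-2 * s)) • x)) (𝓝[>] 0) (𝓝 (√2 • x)) := by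
    have := (tendsto_sqrt_inv_mul_exp.smul_const y).add (tendsto_sqrt_inv_mul_sqrt.smul_const x)
    rw [zero_smul, zero_add] at this
    refine this.congr fun s => ?_
    rw [smul_add, smul_smul, smul_smul]
  have hd0 : Tendsto (fun s : ℝ => (Real.exp (-s) - 1) • y + √(1 - Real.exp (-2 * s)) • x)
      (𝓝[>] 0) (𝓝 0) := by
    have h : Continuous fun s : ℝ => (Real.exp (-s) - 1) • y + √(1 - Real.exp (-2 * s)) • x := by
      fun_prop
    simpa using (h.tendsto 0).mono_left (nhdsWithin_le_nhds (s := Set.Ioi 0))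
  have := (hasFDerivWithinAt_univ.2 hf).lim hd0 (Eventually.of_forall fun _ => Set.mem_univ _) hd
  rw [map_smul, smul_eq_mul] at this
  refine this.congr fun s => ?_
  rw [mehler_eq_add, smul_eq_mul]

lemma norm_increment_le {s : ℝ} (hs : 0 < s) (hs1 : s ≤ 1) (y x : E) :
    (√s)⁻¹ * ‖mehler s (y, x) - y‖ ≤ ‖y‖ + 2 * ‖x‖ := by
  have h0 : 0 < √s := Real.sqrt_pos.2 hs
  have h5 : √s * √s = s := Real.mul_self_sqrt hs.le
  have h6 : √s ≤ 1 := Real.sqrt_le_one.2 hs1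
  have h1 : |Real.exp (-s) - 1| ≤ √s := by
    rw [abs_of_nonpos (by linarith [Real.exp_le_one_iff.2 (by linarith : -s ≤ 0)])]
    nlinarith [Real.add_one_le_exp (-s)]
  have h2 : √(1 - Real.exp (-2 * s)) ≤ 2 * √s := by
    refine Real.sqrt_le_iff.2 ⟨by positivity, ?_⟩
    nlinarith [Real.add_one_le_exp (-2 * s)]
  rw [mehler_eq_add, add_sub_cancel_left, inv_mul_le_iff₀ h0]
  refine (norm_add_le _ _).trans ?_
  rw [norm_smul, norm_smul, Real.norm_eq_abs, Real.norm_of_nonneg (Real.sqrt_nonneg _)]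
  have h3 : |Real.exp (-s) - 1| * ‖y‖ ≤ √s * ‖y‖ := by gcongr
  have h4 : √(1 - Real.exp (-2 * s)) * ‖x‖ ≤ 2 * √s * ‖x‖ := by gcongr
  linarith

/-- `g` is `C¹` with gradient `G`, bounded, bounded away from zero, and has bounded gradient. -/
structure IsNice (ε M L : ℝ) (g : E → ℝ) (G : E → E) : Prop where
  pos : 0 < ε
  lower : ∀ v, ε ≤ g v
  upper : ∀ v, g v ≤ M
  hasFDerivAt : ∀ v, HasFDerivAt g (innerSL ℝ (G v)) v
  continuous_grad : Continuous G
  bound : ∀ v, ‖G v‖ ≤ L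

namespace IsNice

variable {ε M L : ℝ} {g : E → ℝ} {G : E → E}

lemma continuous (hg : IsNice ε M L g G) : Continuous g :=
  continuous_iff_continuousAt.2 fun v => (hg.hasFDerivAt v).continuousAt

lemma pos' (hg : IsNice ε M L g G) (v : E) : 0 < g v := hg.pos.trans_le (hg.lower v)

lemma abs_le (hg : IsNice ε M L g G) (v : E) : |g v| ≤ M := by rw [abs_of_pos (hg.pos' v)]; exact hg.upper v

lemma nonneg_bound (hg : IsNice ε M L g G) : 0 ≤ L := (norm_nonneg _).trans (hg.bound 0)

lemma log_hasFDerivAt (hg : IsNice ε M L g G) (v : E) :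
    HasFDerivAt (fun v => Real.log (g v)) (innerSL ℝ ((g v)⁻¹ • G v)) v := by
  refine ((hg.hasFDerivAt v).log (hg.pos' v).ne').congr_fderiv ?_
  rw [map_smul]

lemma log_bound (hg : IsNice ε M L g G) (v : E) : ‖(g v)⁻¹ • G v‖ ≤ ε⁻¹ * L := by
  rw [norm_smul, norm_inv, Real.norm_of_nonneg (hg.pos' v).le]
  exact mul_le_mul (inv_anti₀ hg.pos (hg.lower v)) (hg.bound v) (norm_nonneg _)
    (inv_nonneg.2 hg.pos.le)

lemma abs_log_le (hg : IsNice ε M L g G) (v : E) : |Real.log (g v)| ≤ |Real.log ε| + |Real.log M| := by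
  have h1 := Real.log_le_log hg.pos (hg.lower v)
  have h2 := Real.log_le_log (hg.pos' v) (hg.upper v)
  rw [_root_.abs_le]
  constructor
  · linarith [neg_abs_le (Real.log ε), abs_nonneg (Real.log M)]
  · linarith [le_abs_self (Real.log M), abs_nonneg (Real.log ε)]

lemma continuous_log (hg : IsNice ε M L g G) : Continuous fun v => Real.log (g v) :=
  hg.continuous.log fun v => (hg.pos' v).ne'

lemma klFun_le (hg : IsNice ε M L g G) (v : E) : klFun (g v) ≤ 1 + klFun M := by
  have hM := (hg.pos' v).le.trans (hg.upper v)
  have h1 := convexOn_klFun.le_max_of_mem_Icc (Set.mem_Ici.2 le_rfl) (Set.mem_Ici.2 hM)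
    ⟨(hg.pos' v).le, hg.upper v⟩
  rw [klFun_zero] at h1
  exact h1.trans (max_le (by linarith [klFun_nonneg hM]) (by linarith))

lemma norm_fderiv (hg : IsNice ε M L g G) (v : E) : ‖fderiv ℝ g v‖ = ‖G v‖ := by
  rw [(hg.hasFDerivAt v).fderiv, innerSL_apply_norm]

end IsNice

lemma Continuous.integrable_of_bound {X : Type*} [TopologicalSpace X] [MeasurableSpace X]
    [BorelSpace X] {G : Type*} [NormedAddCommGroup G] [SecondCountableTopologyEither X G]
    {μ : Measure X} [IsFiniteMeasure μ] {f : X → G}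
    (hf : Continuous f) (C : ℝ) (hC : ∀ x, ‖f x‖ ≤ C) : Integrable f μ :=
  Integrable.of_bound hf.aestronglyMeasurable C (Eventually.of_forall hC)

/-- The Dirichlet form of one Ornstein-Uhlenbeck step, by reversibility. -/
lemma integral_mul_ou_sub (hβ : 0 < β) (hs : 0 ≤ s) {w u : E → ℝ} (hw : Continuous w)
    (hu : Continuous u) {W U : ℝ} (hW : ∀ v, |w v| ≤ W) (hU : ∀ v, |u v| ≤ U) :
    ∫ v, w v * (ornsteinUhlenbeck β s u v - u v) ∂gauss E β =
      -(1 / 2) * ∫ p, (w (mehler s p) - w p.1) * (u (mehler s p) - u p.1)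
        ∂(gauss E β).prod (gauss E β) := by
  have := isProbabilityMeasure_gauss (E := E) hβ
  have hm := continuous_mehler (E := E) s
  have hM := measurePreserving_mehlerMap (E := E) hβ hs
  have hR := measurePreserving_rotate (E := E) hβ (mehler_sq hs)
  have hbd : ∀ x y, ‖w x * u y‖ ≤ W * U := fun x y => by
    rw [norm_mul]
    exact mul_le_mul (hW x) (hU y) (abs_nonneg _) ((abs_nonneg _).trans (hW x))
  have i1 : Integrable (fun p : E × E => w p.1 * u (mehler s p)) ((gauss E β).prod (gauss E β)) :=
    Continuous.integrable_of_bound (by fun_prop) (W * U) fun p => hbd _ _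
  have i2 : Integrable (fun p : E × E => w (mehler s p) * u p.1) ((gauss E β).prod (gauss E β)) :=
    Continuous.integrable_of_bound (by fun_prop) (W * U) fun p => hbd _ _
  have i3 : Integrable (fun p : E × E => w (mehler s p) * u (mehler s p))
      ((gauss E β).prod (gauss E β)) :=
    Continuous.integrable_of_bound (by fun_prop) (W * U) fun p => hbd _ _
  have i4 : Integrable (fun p : E × E => w p.1 * u p.1) ((gauss E β).prod (gauss E β)) :=
    Continuous.integrable_of_bound (by fun_prop) (W * U) fun p => hbd _ _
  have i0 : Integrable (fun v => w v * u v) (gauss E β) :=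
    Continuous.integrable_of_bound (by fun_prop) (W * U) fun p => hbd _ _
  have e1 : ∫ v, w v * ornsteinUhlenbeck β s u v ∂gauss E β =
      ∫ p : E × E, w p.1 * u (mehler s p) ∂(gauss E β).prod (gauss E β) := by
    rw [integral_prod _ i1]
    refine integral_congr_ae (Eventually.of_forall fun v => ?_)
    exact (integral_const_mul _ _).symm
  -- Reversibility: `(y, x) ↦ (a y + b x, b y - a x)` is an involution preserving the product
  -- Gaussian, and it interchanges `p.1` with `mehler s p`.
  have e2 : ∫ p : E × E, w (mehler s p) * u p.1 ∂(gauss E β).prod (gauss E β) =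
      ∫ p : E × E, w p.1 * u (mehler s p) ∂(gauss E β).prod (gauss E β) := by
    conv_rhs => rw [← hR.map_eq]
    rw [integral_map hR.measurable.aemeasurable
      (Continuous.aestronglyMeasurable (by fun_prop))]
    refine integral_congr_ae (Eventually.of_forall fun p => ?_)
    have h1 : mehler s (Real.exp (-s) • p.1 + √(1 - Real.exp (-2 * s)) • p.2,
        √(1 - Real.exp (-2 * s)) • p.1 - Real.exp (-s) • p.2) = p.1 := by
      have := mehler_sq hs
      rw [mehler]
      simp only
      generalize Real.exp (-s) = a at *
      generalize √(1 - Real.exp (-2 * s)) = b at *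
      calc a • (a • p.1 + b • p.2) + b • (b • p.1 - a • p.2) = (a ^ 2 + b ^ 2) • p.1 := by module
        _ = p.1 := by rw [this, one_smul]
    simp only [h1]
    rfl
  have e3 : ∫ p : E × E, w (mehler s p) * u (mehler s p) ∂(gauss E β).prod (gauss E β) =
      ∫ v, w v * u v ∂gauss E β := by
    conv_rhs => rw [← hM.map_eq]
    rw [integral_map hM.measurable.aemeasurable (Continuous.aestronglyMeasurable (by fun_prop))]
  have e4 : ∫ p : E × E, w p.1 * u p.1 ∂(gauss E β).prod (gauss E β) =
      ∫ v, w v * u v ∂gauss E β := by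
    rw [integral_prod _ i4]
    simp
  have hou : Integrable (fun v => w v * ornsteinUhlenbeck β s u v) (gauss E β) := by
    have h := i1.integral_prod_left
    refine h.congr (Eventually.of_forall fun v => ?_)
    exact integral_const_mul (w v) fun x => u (mehler s (v, x))
  have hexp : ∀ p : E × E, (w (mehler s p) - w p.1) * (u (mehler s p) - u p.1) =
      (w (mehler s p) * u (mehler s p) - w (mehler s p) * u p.1) -
        (w p.1 * u (mehler s p) - w p.1 * u p.1) := fun p => by ring
  simp only [hexp, mul_sub]
  have i32 : Integrable (fun p : E × E => w (mehler s p) * u (mehler s p) - w (mehler s p) * u p.1)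
      ((gauss E β).prod (gauss E β)) := i3.sub i2
  have i14 : Integrable (fun p : E × E => w p.1 * u (mehler s p) - w p.1 * u p.1)
      ((gauss E β).prod (gauss E β)) := i1.sub i4
  rw [integral_sub i32 i14, integral_sub i3 i2, integral_sub i1 i4, e2, e3, e4,
    integral_sub hou i0, e1]
  ring

end Nice

/-! ### Dissipation of entropy at time zero -/

section Dissipation

variable {E : Type*} [NormedAddCommGroup E] [InnerProductSpace ℝ E] [FiniteDimensional ℝ E]
  [MeasurableSpace E] [BorelSpace E] {β a b s : ℝ} {h : E → ℝ}

/-- The Fisher information of a differentiable function, with the classical derivative. -/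
def smoothFisher (β : ℝ) (g : E → ℝ) : ℝ := ∫ v, ‖fderiv ℝ g v‖ ^ 2 / g v ∂gauss E β

lemma integrable_norm_add_sq (hβ : 0 < β) (c : ℝ) :
    Integrable (fun p : E × E => c * (‖p.1‖ + 2 * ‖p.2‖) ^ 2) ((gauss E β).prod (gauss E β)) := by
  have := isProbabilityMeasure_gauss (E := E) hβ
  have h1 : Integrable (fun p : E × E => ‖p.1‖ ^ 2) ((gauss E β).prod (gauss E β)) :=
    (measurePreserving_fst (μ := gauss E β) (ν := gauss E β)).integrable_comp_of_integrable
      (integrable_norm_sq_gauss hβ)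
  have h2 : Integrable (fun p : E × E => ‖p.2‖ ^ 2) ((gauss E β).prod (gauss E β)) :=
    (measurePreserving_snd (μ := gauss E β) (ν := gauss E β)).integrable_comp_of_integrable
      (integrable_norm_sq_gauss hβ)
  refine Integrable.const_mul ?_ c
  refine ((h1.const_mul 2).add (h2.const_mul 8)).mono'
    (Continuous.aestronglyMeasurable (by fun_prop)) (Eventually.of_forall fun p => ?_)
  rw [Real.norm_of_nonneg (sq_nonneg _), Pi.add_apply]
  nlinarith [sq_nonneg (‖p.1‖ - 2 * ‖p.2‖)]

variable {ε M L : ℝ} {g : E → ℝ} {G : E → E}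

lemma eventually_small : ∀ᶠ s : ℝ in 𝓝[>] 0, 0 < s ∧ s ≤ 1 := by
  filter_upwards [Ioc_mem_nhdsGT (one_pos : (0 : ℝ) < 1)] with s hs
  exact ⟨hs.1, hs.2⟩

lemma IsNice.abs_increment_le (hg : IsNice ε M L g G) {s : ℝ} (hs : 0 < s) (hs1 : s ≤ 1)
    (y x : E) : (√s)⁻¹ * |g (mehler s (y, x)) - g y| ≤ L * (‖y‖ + 2 * ‖x‖) := by
  have h0 : 0 < √s := Real.sqrt_pos.2 hs
  calc (√s)⁻¹ * |g (mehler s (y, x)) - g y| ≤ (√s)⁻¹ * (L * ‖mehler s (y, x) - y‖) := by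
        refine mul_le_mul_of_nonneg_left ?_ (by positivity)
        exact abs_sub_le_of_gradient hg.hasFDerivAt hg.bound _ _
    _ = L * ((√s)⁻¹ * ‖mehler s (y, x) - y‖) := by ring
    _ ≤ _ := mul_le_mul_of_nonneg_left (norm_increment_le hs hs1 y x) hg.nonneg_bound

/-- By reversibility the left side is `-1/2` times the mean of the product of the increments of `log
g` and `g`, each divided by `√s`. The increments converge to `√2 ⟨∇log g, x⟩` and `√2 ⟨∇g, x⟩`,
dominated through the Lipschitz bounds. No second derivative of `g` is needed. -/
lemma IsNice.tendsto_dirichlet (hg : IsNice ε M L g G) (hβ : 0 < β) :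
    Tendsto (fun s => s⁻¹ * ∫ v, Real.log (g v) * (ornsteinUhlenbeck β s g v - g v) ∂gauss E β)
      (𝓝[>] 0) (𝓝 (-(1 / β) * smoothFisher β g)) := by
  have := isProbabilityMeasure_gauss (E := E) hβ
  have hgc := hg.continuous
  have hlc := hg.continuous_log
  have hGc := hg.continuous_grad
  have hL := hg.nonneg_bound
  have key : Tendsto (fun s => ∫ p : E × E,
      ((√s)⁻¹ * (Real.log (g (mehler s p)) - Real.log (g p.1))) *
        ((√s)⁻¹ * (g (mehler s p) - g p.1)) ∂(gauss E β).prod (gauss E β)) (𝓝[>] 0)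
      (𝓝 (∫ p : E × E, (√2 * ⟪(g p.1)⁻¹ • G p.1, p.2⟫_ℝ) * (√2 * ⟪G p.1, p.2⟫_ℝ)
        ∂(gauss E β).prod (gauss E β))) := by
    refine tendsto_integral_filter_of_dominated_convergence
      (fun p => (ε⁻¹ * L * L) * (‖p.1‖ + 2 * ‖p.2‖) ^ 2) ?_ ?_ (integrable_norm_add_sq hβ _) ?_
    · refine Eventually.of_forall fun s => Continuous.aestronglyMeasurable ?_
      have := continuous_mehler (E := E) s
      have h1 : Continuous fun p : E × E => Real.log (g (mehler s p)) := hlc.comp this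
      have h2 : Continuous fun p : E × E => Real.log (g p.1) := hlc.comp continuous_fst
      fun_prop
    · filter_upwards [eventually_small] with s ⟨hs, hs1⟩
      refine Eventually.of_forall fun ⟨y, x⟩ => ?_
      have h0 : 0 < √s := Real.sqrt_pos.2 hs
      have h1 : (√s)⁻¹ * |Real.log (g (mehler s (y, x))) - Real.log (g y)| ≤
          ε⁻¹ * L * (‖y‖ + 2 * ‖x‖) := by
        calc (√s)⁻¹ * |Real.log (g (mehler s (y, x))) - Real.log (g y)|
            ≤ (√s)⁻¹ * (ε⁻¹ * L * ‖mehler s (y, x) - y‖) := by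
              refine mul_le_mul_of_nonneg_left ?_ (by positivity)
              exact abs_sub_le_of_gradient hg.log_hasFDerivAt hg.log_bound y (mehler s (y, x))
          _ = ε⁻¹ * L * ((√s)⁻¹ * ‖mehler s (y, x) - y‖) := by ring
          _ ≤ _ := mul_le_mul_of_nonneg_left (norm_increment_le hs hs1 y x)
              (mul_nonneg (inv_nonneg.2 hg.pos.le) hL)
      have h2 := hg.abs_increment_le hs hs1 y x
      rw [norm_mul, norm_mul, norm_mul, Real.norm_of_nonneg (inv_nonneg.2 h0.le), Real.norm_eq_abs,
        Real.norm_eq_abs]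
      calc _ ≤ (ε⁻¹ * L * (‖y‖ + 2 * ‖x‖)) * (L * (‖y‖ + 2 * ‖x‖)) := by
            refine mul_le_mul h1 h2 (by positivity) (le_trans (by positivity) h1)
        _ = ε⁻¹ * L * L * (‖y‖ + 2 * ‖x‖) ^ 2 := by ring
    · refine Eventually.of_forall fun ⟨y, x⟩ => ?_
      exact (tendsto_increment (hg.log_hasFDerivAt y) x).mul (tendsto_increment (hg.hasFDerivAt y) x)
  -- Integrating out the noise replaces `⟨G, x⟩²` by `‖G‖²/β`; the factor `2` is `√2 · √2`.
  have hlim : ∫ p : E × E, (√2 * ⟪(g p.1)⁻¹ • G p.1, p.2⟫_ℝ) * (√2 * ⟪G p.1, p.2⟫_ℝ)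
        ∂(gauss E β).prod (gauss E β) = 2 / β * smoothFisher β g := by
    have e1 : ∀ p : E × E, (√2 * ⟪(g p.1)⁻¹ • G p.1, p.2⟫_ℝ) * (√2 * ⟪G p.1, p.2⟫_ℝ) =
        2 * (g p.1)⁻¹ * ⟪G p.1, p.2⟫_ℝ ^ 2 := fun p => by
      have : √2 * √2 = 2 := Real.mul_self_sqrt (by norm_num)
      rw [inner_smul_left, RCLike.conj_to_real]
      linear_combination ((g p.1)⁻¹ * ⟪G p.1, p.2⟫_ℝ ^ 2) * this
    simp only [e1]
    rw [integral_prod]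
    · simp only [integral_const_mul, integral_inner_sq_gauss hβ, smoothFisher]
      rw [← integral_const_mul]
      refine integral_congr_ae (Eventually.of_forall fun v => ?_)
      simp only [hg.norm_fderiv]
      ring
    · refine (integrable_norm_add_sq hβ (2 * ε⁻¹ * L ^ 2)).mono'
        (Continuous.aestronglyMeasurable ?_) (Eventually.of_forall fun p => ?_)
      · have : Continuous fun p : E × E => (g p.1)⁻¹ :=
          (hgc.comp continuous_fst).inv₀ fun p => (hg.pos' _).ne'
        fun_prop
      · have h1 := (hg.pos' p.1)
        have h2 : (g p.1)⁻¹ ≤ ε⁻¹ := inv_anti₀ hg.pos (hg.lower _)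
        have h3 : ⟪G p.1, p.2⟫_ℝ ^ 2 ≤ (L * (‖p.1‖ + 2 * ‖p.2‖)) ^ 2 := by
          rw [← sq_abs]
          refine pow_le_pow_left₀ (abs_nonneg _) ((abs_real_inner_le_norm _ _).trans ?_) 2
          refine mul_le_mul (hg.bound _) ?_ (norm_nonneg _) hL
          linarith [norm_nonneg p.1, norm_nonneg p.2]
        rw [Real.norm_of_nonneg (by positivity)]
        calc 2 * (g p.1)⁻¹ * ⟪G p.1, p.2⟫_ℝ ^ 2 ≤ 2 * ε⁻¹ * (L * (‖p.1‖ + 2 * ‖p.2‖)) ^ 2 := by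
              have := hg.pos
              gcongr
          _ = _ := by ring
  rw [hlim] at key
  have h3 := key.const_mul (-(1 / 2))
  rw [show -(1 / 2) * (2 / β * smoothFisher β g) = -(1 / β) * smoothFisher β g by ring] at h3
  refine h3.congr' ?_
  filter_upwards [eventually_small] with s ⟨hs, hs1⟩
  rw [integral_mul_ou_sub hβ hs.le hlc hgc hg.abs_log_le hg.abs_le, ← integral_const_mul,
    ← integral_const_mul, ← integral_const_mul]
  refine integral_congr_ae (Eventually.of_forall fun p => ?_)
  have h5 : √s * √s = s := Real.mul_self_sqrt hs.le
  have h6 : 0 < √s := Real.sqrt_pos.2 hs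
  simp only
  rw [← h5, Real.sqrt_mul_self h6.le]
  field_simp

/-- The increments at scale `√s` converge to `√2 ⟨∇g, x⟩`, whose mean vanishes because the noise is
centred. -/
lemma IsNice.tendsto_ou_sub_div (hg : IsNice ε M L g G) (hβ : 0 < β) (v : E) :
    Tendsto (fun s => (√s)⁻¹ * (ornsteinUhlenbeck β s g v - g v)) (𝓝[>] 0) (𝓝 0) := by
  have := isProbabilityMeasure_gauss (E := E) hβ
  have hgc := hg.continuous
  have h1 : Tendsto (fun s => ∫ x, (√s)⁻¹ * (g (mehler s (v, x)) - g v) ∂gauss E β) (𝓝[>] 0)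
      (𝓝 (∫ x, √2 * ⟪G v, x⟫_ℝ ∂gauss E β)) := by
    refine tendsto_integral_filter_of_dominated_convergence (fun x => L * (‖v‖ + 2 * ‖x‖))
      ?_ ?_ ?_ ?_
    · refine Eventually.of_forall fun s => Continuous.aestronglyMeasurable ?_
      have := continuous_mehler (E := E) s
      fun_prop
    · filter_upwards [eventually_small] with s ⟨hs, hs1⟩
      refine Eventually.of_forall fun x => ?_
      rw [norm_mul, Real.norm_of_nonneg (inv_nonneg.2 (Real.sqrt_nonneg _))]
      exact hg.abs_increment_le hs hs1 v x
    · exact ((integrable_const _).add ((integrable_norm_gauss hβ).const_mul 2)).const_mul L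
    · exact Eventually.of_forall fun x => tendsto_increment (hg.hasFDerivAt v) x
  rw [integral_const_mul, integral_inner_gauss hβ, mul_zero] at h1
  refine h1.congr fun s => ?_
  have := continuous_mehler (E := E) s
  rw [integral_const_mul, integral_sub
    (Continuous.integrable_of_bound (by fun_prop) M fun x => hg.abs_le _) (integrable_const _)]
  simp [ornsteinUhlenbeck_eq_avg, avg]

lemma IsNice.ou_bounds (hg : IsNice ε M L g G) (hβ : 0 < β) (s : ℝ) (v : E) :
    ε ≤ ornsteinUhlenbeck β s g v ∧ ornsteinUhlenbeck β s g v ≤ M := by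
  have := isProbabilityMeasure_gauss (E := E) hβ
  have hgc := hg.continuous
  have hm := continuous_mehler (E := E) s
  have hi : Integrable (fun x => g (mehler s (v, x))) (gauss E β) :=
    Continuous.integrable_of_bound (by fun_prop) M fun x => hg.abs_le _
  constructor
  · have := integral_mono (μ := gauss E β) (integrable_const ε) hi fun x => hg.lower _
    rw [integral_const, probReal_univ, one_smul] at this
    exact this
  · have := integral_mono (μ := gauss E β) hi (integrable_const M) fun x => hg.upper _
    rw [integral_const, probReal_univ, one_smul] at this
    exact this

/-- The Ornstein-Uhlenbeck semigroup on vector fields, with the factor `e^{-s}`. -/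
def ouField (β s : ℝ) (G : E → E) (v : E) : E :=
  Real.exp (-s) • ∫ x, G (mehler s (v, x)) ∂gauss E β

/-- Values and gradients are averaged, and the gradient gains the factor `e^{-s} ≤ 1`, so the same
constants serve at all later times. -/
lemma IsNice.ou (hg : IsNice ε M L g G) (hβ : 0 < β) (hs : 0 ≤ s) :
    IsNice ε M L (ornsteinUhlenbeck β s g) (ouField β s G) := by
  have := isProbabilityMeasure_gauss (E := E) hβ
  have hgc := hg.continuous
  have hGc := hg.continuous_grad
  have hm := continuous_mehler (E := E) s
  have hexp : Real.exp (-s) ≤ 1 := Real.exp_le_one_iff.2 (by linarith)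
  have hGi : ∀ v, Integrable (fun x => G (mehler s (v, x))) (gauss E β) := fun v =>
    Continuous.integrable_of_bound (by fun_prop) L fun x => hg.bound _
  refine ⟨hg.pos, fun v => (hg.ou_bounds hβ s v).1, fun v => (hg.ou_bounds hβ s v).2,
    fun v => ?_, ?_, fun v => ?_⟩
  · have key := hasFDerivAt_integral_of_dominated_of_fderiv_le (μ := gauss E β)
      (F := fun v x => g (mehler s (v, x)))
      (F' := fun v x => Real.exp (-s) • innerSL ℝ (G (mehler s (v, x))))
      (bound := fun _ => L) (x₀ := v) (univ_mem)
      (Eventually.of_forall fun v => Continuous.aestronglyMeasurable (by fun_prop))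
      (Continuous.integrable_of_bound (by fun_prop) M fun x => hg.abs_le _)
      (Continuous.aestronglyMeasurable (by fun_prop))
      (Eventually.of_forall fun x v _ => ?_) (integrable_const L)
      (Eventually.of_forall fun x v _ => ?_)
    · refine key.congr_fderiv ?_
      ext w
      rw [ouField, innerSL_apply_apply, inner_smul_left, real_inner_comm, ← integral_inner (hGi v),
        RCLike.conj_to_real, ← integral_const_mul, ContinuousLinearMap.integral_apply]
      · refine integral_congr_ae (Eventually.of_forall fun x => ?_)
        simp [real_inner_comm w]
      · exact Continuous.integrable_of_bound (by fun_prop) L fun x => by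
          rw [norm_smul, innerSL_apply_norm, Real.norm_of_nonneg (Real.exp_pos _).le]
          exact (mul_le_of_le_one_left (norm_nonneg _) hexp).trans (hg.bound _)
    · rw [norm_smul, innerSL_apply_norm, Real.norm_of_nonneg (Real.exp_pos _).le]
      exact (mul_le_of_le_one_left (norm_nonneg _) hexp).trans (hg.bound _)
    · have h1 : HasFDerivAt (fun v : E => mehler s (v, x))
          (Real.exp (-s) • ContinuousLinearMap.id ℝ E) v :=
        ((hasFDerivAt_id v).const_smul (Real.exp (-s))).add_const
          (√(1 - Real.exp (-2 * s)) • x)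
      refine ((hg.hasFDerivAt (mehler s (v, x))).comp v h1).congr_fderiv ?_
      ext w
      simp
  · unfold ouField
    refine Continuous.const_smul ?_ _
    refine continuous_of_dominated (bound := fun _ => L) (fun v => ?_) (fun v => ?_)
      (integrable_const L) (Eventually.of_forall fun x => ?_)
    · exact (hGi v).aestronglyMeasurable
    · exact Eventually.of_forall fun x => hg.bound _
    · fun_prop
  · rw [ouField, norm_smul, Real.norm_of_nonneg (Real.exp_pos _).le]
    refine (mul_le_of_le_one_left (norm_nonneg _) hexp).trans ?_
    refine (norm_integral_le_of_norm_le_const (Eventually.of_forall fun x => hg.bound _)).trans ?_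
    simp

/-- The dissipation of entropy is the Fisher information (at time zero, from the right). -/
lemma IsNice.tendsto_entropy_slope (hg : IsNice ε M L g G) (hβ : 0 < β) :
    Tendsto (fun s => s⁻¹ * ((∫ v, klFun (ornsteinUhlenbeck β s g v) ∂gauss E β) -
      ∫ v, klFun (g v) ∂gauss E β)) (𝓝[>] 0) (𝓝 (-(1 / β) * smoothFisher β g)) := by
  have := isProbabilityMeasure_gauss (E := E) hβ
  have hgc := hg.continuous
  have hlc := hg.continuous_log
  have hL := hg.nonneg_bound
  -- The Taylor remainder is at most `ε⁻¹ (P_s g - g)²`, and `P_s g - g` is `o(√s)` pointwise.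
  -- Divided by `s` it vanishes in the limit, leaving only the Dirichlet form.
  have hrem : Tendsto (fun s => ∫ v, s⁻¹ * (klFun (ornsteinUhlenbeck β s g v) - klFun (g v) -
      Real.log (g v) * (ornsteinUhlenbeck β s g v - g v)) ∂gauss E β) (𝓝[>] 0) (𝓝 0) := by
    have h0 : Tendsto (fun s => ∫ v, s⁻¹ * (klFun (ornsteinUhlenbeck β s g v) - klFun (g v) -
      Real.log (g v) * (ornsteinUhlenbeck β s g v - g v)) ∂gauss E β) (𝓝[>] 0)
      (𝓝 (∫ v, (0 : ℝ) ∂gauss E β)) := by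
      set c₁ := ∫ x : E, ‖x‖ ∂gauss E β with hc₁
      have hsmall : ∀ s v, 0 < s → s ≤ 1 →
          ‖s⁻¹ * (klFun (ornsteinUhlenbeck β s g v) - klFun (g v) -
            Real.log (g v) * (ornsteinUhlenbeck β s g v - g v))‖ ≤
          ε⁻¹ * ((√s)⁻¹ * (ornsteinUhlenbeck β s g v - g v)) ^ 2 := by
        intro s v hs hs1
        have h5 : √s * √s = s := Real.mul_self_sqrt hs.le
        have h6 : 0 < √s := Real.sqrt_pos.2 hs
        have hpos : 0 < ornsteinUhlenbeck β s g v := hg.pos.trans_le (hg.ou_bounds hβ s v).1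
        rw [Real.norm_of_nonneg (mul_nonneg (by positivity) (le_klFun_sub (hg.pos' v) hpos))]
        calc _ ≤ s⁻¹ * ((ornsteinUhlenbeck β s g v - g v) ^ 2 / g v) :=
              mul_le_mul_of_nonneg_left (klFun_sub_le (hg.pos' v) hpos) (by positivity)
          _ ≤ s⁻¹ * ((ornsteinUhlenbeck β s g v - g v) ^ 2 / ε) := by
              have := hg.pos
              have := hg.lower v
              gcongr
          _ = _ := by
              have := hg.pos
              rw [mul_pow, inv_pow, sq (√s), h5]
              ring
      refine tendsto_integral_filter_of_dominated_convergence
        (fun v => ε⁻¹ * (L ^ 2 * (2 * ‖v‖ ^ 2 + 8 * c₁ ^ 2))) ?_ ?_ ?_ ?_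
      · filter_upwards [eventually_small] with s ⟨hs, hs1⟩
        have h1 := (hg.ou hβ hs.le).continuous
        have h2 : Continuous fun v => klFun (ornsteinUhlenbeck β s g v) := continuous_klFun.comp h1
        have h3 : Continuous fun v => klFun (g v) := continuous_klFun.comp hgc
        exact Continuous.aestronglyMeasurable (by fun_prop)
      · filter_upwards [eventually_small] with s ⟨hs, hs1⟩
        refine Eventually.of_forall fun v => (hsmall s v hs hs1).trans ?_
        refine mul_le_mul_of_nonneg_left ?_ (inv_nonneg.2 hg.pos.le)
        have hm := continuous_mehler (E := E) s
        have h1 : (√s)⁻¹ * (ornsteinUhlenbeck β s g v - g v) =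
            ∫ x, (√s)⁻¹ * (g (mehler s (v, x)) - g v) ∂gauss E β := by
          rw [integral_const_mul, integral_sub
            (Continuous.integrable_of_bound (by fun_prop) M fun x => hg.abs_le _)
            (integrable_const _)]
          simp [ornsteinUhlenbeck_eq_avg, avg]
        have h2 : |(√s)⁻¹ * (ornsteinUhlenbeck β s g v - g v)| ≤ L * (‖v‖ + 2 * c₁) := by
          rw [h1, ← Real.norm_eq_abs]
          calc _ ≤ ∫ x, L * (‖v‖ + 2 * ‖x‖) ∂gauss E β := by
                have hi : Integrable (fun x : E => L * (‖v‖ + 2 * ‖x‖)) (gauss E β) :=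
                  ((integrable_const _).add ((integrable_norm_gauss hβ).const_mul 2)).const_mul L
                refine norm_integral_le_of_norm_le hi
                  (Eventually.of_forall fun x => ?_)
                rw [norm_mul, Real.norm_of_nonneg (inv_nonneg.2 (Real.sqrt_nonneg _))]
                exact hg.abs_increment_le hs hs1 v x
            _ = L * (‖v‖ + 2 * c₁) := by
                rw [integral_const_mul, integral_add (integrable_const _)
                  ((integrable_norm_gauss hβ).const_mul 2), integral_const_mul]
                simp [hc₁]
        rw [← sq_abs]
        refine (pow_le_pow_left₀ (abs_nonneg _) h2 2).trans ?_
        rw [mul_pow]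
        refine mul_le_mul_of_nonneg_left ?_ (sq_nonneg _)
        nlinarith [sq_nonneg (‖v‖ - 2 * c₁)]
      · have h1 : Integrable (fun v : E => 2 * ‖v‖ ^ 2 + 8 * c₁ ^ 2) (gauss E β) :=
          ((integrable_norm_sq_gauss hβ).const_mul 2).add (integrable_const _)
        exact (h1.const_mul _).const_mul _
      · refine Eventually.of_forall fun v => ?_
        refine squeeze_zero_norm' (a := fun s => ε⁻¹ * ((√s)⁻¹ * (ornsteinUhlenbeck β s g v - g v)) ^ 2)
          ?_ ?_
        · filter_upwards [eventually_small] with s ⟨hs, hs1⟩ using hsmall s v hs hs1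
        · have := ((hg.tendsto_ou_sub_div hβ v).pow 2).const_mul ε⁻¹
          simpa using this
    simpa using h0
  have h := hrem.add (hg.tendsto_dirichlet hβ)
  rw [zero_add] at h
  refine h.congr' ?_
  filter_upwards [eventually_small] with s ⟨hs, hs1⟩
  have hn := hg.ou hβ hs.le
  have hoc := hn.continuous
  have i1 : Integrable (fun v => klFun (ornsteinUhlenbeck β s g v)) (gauss E β) :=
    Continuous.integrable_of_bound (continuous_klFun.comp hoc) (1 + klFun M) fun v => by
      rw [Real.norm_of_nonneg (klFun_nonneg (hn.pos' v).le)]; exact hn.klFun_le v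
  have i2 : Integrable (fun v => klFun (g v)) (gauss E β) :=
    Continuous.integrable_of_bound (continuous_klFun.comp hgc) (1 + klFun M) fun v => by
      rw [Real.norm_of_nonneg (klFun_nonneg (hg.pos' v).le)]; exact hg.klFun_le v
  have i3 : Integrable (fun v => Real.log (g v) * (ornsteinUhlenbeck β s g v - g v)) (gauss E β) :=
    Continuous.integrable_of_bound (by fun_prop) ((|Real.log ε| + |Real.log M|) * (M + M))
      fun v => by
        rw [norm_mul]
        refine mul_le_mul (hg.abs_log_le v) ((norm_sub_le _ _).trans
          (add_le_add (hn.abs_le v) (hg.abs_le v))) (norm_nonneg _) (by positivity)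
  have i12 : Integrable (fun v => klFun (ornsteinUhlenbeck β s g v) - klFun (g v)) (gauss E β) :=
    i1.sub i2
  rw [integral_const_mul, integral_sub i12 i3, integral_sub i1 i2]
  ring

end Dissipation

/-! ### De Bruijn's identity and the logarithmic Sobolev inequality for nice functions -/

section Sobolev

variable {E : Type*} [NormedAddCommGroup E] [InnerProductSpace ℝ E] [FiniteDimensional ℝ E]
  [MeasurableSpace E] [BorelSpace E] {β a b s t : ℝ} {h : E → ℝ}

lemma ou_zero (hβ : 0 < β) (h : E → ℝ) : ornsteinUhlenbeck β 0 h = h := by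
  have := isProbabilityMeasure_gauss (E := E) hβ
  funext v
  simp [ornsteinUhlenbeck]

/-- The semigroup property, for bounded functions. -/
lemma ou_ou (hβ : 0 < β) (hs : 0 ≤ s) (ht : 0 ≤ t) (hst : 0 < s + t) (hm : Measurable h)
    {M : ℝ} (hM : ∀ v, |h v| ≤ M) :
    ornsteinUhlenbeck β t (ornsteinUhlenbeck β s h) = ornsteinUhlenbeck β (s + t) h := by
  have := isProbabilityMeasure_gauss (E := E) hβ
  funext v
  obtain ⟨-, hb, hab⟩ := isMehlerPair_exp hst
  have h1 := mehler_sq hs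
  have h2 := mehler_sq ht
  have hexp : Real.exp (-(s + t)) = Real.exp (-s) * Real.exp (-t) := by
    rw [← Real.exp_add]; congr 1; ring
  change ∫ x, ∫ x', h (mehler s (mehler t (v, x), x')) ∂gauss E β ∂gauss E β =
    ∫ z, h (mehler (s + t) (v, z)) ∂gauss E β
  simp only [mehler] at *
  rw [hexp] at hab ⊢
  generalize Real.exp (-s) = a at *
  generalize √(1 - Real.exp (-2 * s)) = b at *
  generalize Real.exp (-t) = a' at *
  generalize √(1 - Real.exp (-2 * t)) = b' at *
  generalize √(1 - Real.exp (-2 * (s + t))) = c at *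
  -- The independent noises `a b' x` and `b x'` add up to a noise of size `c`: `a² b'² + b² = 1 - a²
  -- a'² = c²`. Division by `c` is where `s + t > 0` enters.
  have hrot := measurePreserving_mehler (E := E) hβ (a := a * b' / c) (b := b / c) (by
    field_simp
    nlinarith)
  have hmeas : Measurable fun z : E => h ((a * a') • v + c • z) := hm.comp (by fun_prop)
  have hpt : ∀ p : E × E, (a * a') • v + c • ((a * b' / c) • p.1 + (b / c) • p.2) =
      a • (a' • v + b' • p.1) + b • p.2 := fun p => by
    rw [smul_add, smul_smul, smul_smul, mul_div_cancel₀ _ hb.ne', mul_div_cancel₀ _ hb.ne']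
    module
  have hrhs : ∫ z, h ((a * a') • v + c • z) ∂gauss E β =
      ∫ p, h (a • (a' • v + b' • p.1) + b • p.2) ∂(gauss E β).prod (gauss E β) := by
    simp only [← hpt]
    conv_lhs => rw [← hrot.map_eq]
    exact integral_map hrot.measurable.aemeasurable hmeas.aestronglyMeasurable
  have hmeas2 : Measurable fun p : E × E => a • (a' • v + b' • p.1) + b • p.2 := by fun_prop
  have hi : Integrable (fun p : E × E => h (a • (a' • v + b' • p.1) + b • p.2))
      ((gauss E β).prod (gauss E β)) :=
    Integrable.of_bound (hm.comp hmeas2).aestronglyMeasurable M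
      (Eventually.of_forall fun p => hM _)
  rw [hrhs, integral_prod _ hi]

variable {ε M L : ℝ} {g : E → ℝ} {G : E → E}

lemma IsNice.continuous_ou_time (hg : IsNice ε M L g G) (hβ : 0 < β) (v : E) :
    Continuous fun s => ornsteinUhlenbeck β s g v := by
  have := isProbabilityMeasure_gauss (E := E) hβ
  have hgc := hg.continuous
  change Continuous fun s => ∫ x, g (mehler s (v, x)) ∂gauss E β
  refine continuous_of_dominated (bound := fun _ => M) (fun s => ?_)
    (fun s => Eventually.of_forall fun x => hg.abs_le _) (integrable_const M)
    (Eventually.of_forall fun x => hgc.comp (continuous_mehler_time _))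
  have hm := continuous_mehler (E := E) s
  exact Continuous.aestronglyMeasurable (by fun_prop)

lemma IsNice.continuous_field_time (hg : IsNice ε M L g G) (hβ : 0 < β) (v : E) :
    Continuous fun s => ∫ x, G (mehler s (v, x)) ∂gauss E β := by
  have := isProbabilityMeasure_gauss (E := E) hβ
  have hgc := hg.continuous_grad
  refine continuous_of_dominated (bound := fun _ => L) (fun s => ?_)
    (fun s => Eventually.of_forall fun x => hg.bound _) (integrable_const L)
    (Eventually.of_forall fun x => hgc.comp (continuous_mehler_time _))
  have hm := continuous_mehler (E := E) s
  exact Continuous.aestronglyMeasurable (by fun_prop)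

lemma IsNice.smoothFisher_eq (hg : IsNice ε M L g G) :
    smoothFisher β g = ∫ v, ‖G v‖ ^ 2 / g v ∂gauss E β := by
  simp only [smoothFisher, hg.norm_fderiv]

lemma IsNice.norm_ratio_le (hg : IsNice ε M L g G) (v : E) : ‖‖G v‖ ^ 2 / g v‖ ≤ L ^ 2 / ε := by
  have := hg.pos
  have h1 := hg.pos' v
  rw [Real.norm_of_nonneg (by positivity)]
  have h2 := hg.bound v
  have h3 := hg.lower v
  gcongr

lemma IsNice.continuous_ratio (hg : IsNice ε M L g G) : Continuous fun v => ‖G v‖ ^ 2 / g v :=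
  (hg.continuous_grad.norm.pow 2).div hg.continuous fun v => (hg.pos' v).ne'

lemma IsNice.smoothFisher_nonneg (hg : IsNice ε M L g G) : 0 ≤ smoothFisher β g :=
  integral_nonneg fun v => div_nonneg (sq_nonneg _) (hg.pos' v).le

/-- With `e^{-2s}` in front, what remains is continuous in `s` on the whole line; continuity and
exponential decay of the information both use this form. -/
lemma IsNice.smoothFisher_ou_eq (hg : IsNice ε M L g G) (hβ : 0 < β) (hs : 0 ≤ s) :
    smoothFisher β (ornsteinUhlenbeck β s g) = Real.exp (-2 * s) *
      ∫ v, ‖∫ x, G (mehler s (v, x)) ∂gauss E β‖ ^ 2 / ornsteinUhlenbeck β s g v ∂gauss E β := by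
  rw [(hg.ou hβ hs).smoothFisher_eq, ← integral_const_mul]
  refine integral_congr_ae (Eventually.of_forall fun v => ?_)
  simp only [ouField, norm_smul, mul_pow]
  rw [Real.norm_of_nonneg (Real.exp_pos _).le, ← Real.exp_nat_mul]
  push_cast
  rw [show (2 : ℝ) * -s = -2 * s by ring, mul_div_assoc]

lemma IsNice.continuousOn_smoothFisher_ou (hg : IsNice ε M L g G) (hβ : 0 < β) :
    ContinuousOn (fun s => smoothFisher β (ornsteinUhlenbeck β s g)) (Set.Ici 0) := by
  have := isProbabilityMeasure_gauss (E := E) hβ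
  have hGc := hg.continuous_grad
  have hgc := hg.continuous
  have h1 : Continuous fun s => Real.exp (-2 * s) *
      ∫ v, ‖∫ x, G (mehler s (v, x)) ∂gauss E β‖ ^ 2 / ornsteinUhlenbeck β s g v ∂gauss E β := by
    refine Continuous.mul (by fun_prop) ?_
    refine continuous_of_dominated (bound := fun _ => L ^ 2 / ε) (fun s => ?_)
      (fun s => Eventually.of_forall fun v => ?_) (integrable_const _)
      (Eventually.of_forall fun v => ?_)
    · have hm := continuous_mehler (E := E) s
      have e1 : Continuous fun v => ∫ x, G (mehler s (v, x)) ∂gauss E β :=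
        continuous_of_dominated (bound := fun _ => L)
          (fun v => Continuous.aestronglyMeasurable (by fun_prop))
          (fun v => Eventually.of_forall fun x => hg.bound _) (integrable_const L)
          (Eventually.of_forall fun x => by fun_prop)
      have e2 : Continuous fun v => ∫ x, g (mehler s (v, x)) ∂gauss E β :=
        continuous_of_dominated (bound := fun _ => M)
          (fun v => Continuous.aestronglyMeasurable (by fun_prop))
          (fun v => Eventually.of_forall fun x => hg.abs_le _) (integrable_const M)
          (Eventually.of_forall fun x => by fun_prop)
      exact ((e1.norm.pow 2).div e2 fun v =>
        (hg.pos.trans_le (hg.ou_bounds hβ s v).1).ne').aestronglyMeasurable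
    · have e1 := (hg.ou_bounds hβ s v).1
      have e2 : ‖∫ x, G (mehler s (v, x)) ∂gauss E β‖ ≤ L := by
        refine (norm_integral_le_of_norm_le_const
          (Eventually.of_forall fun x => hg.bound _)).trans ?_
        simp
      have e3 := hg.pos
      rw [Real.norm_of_nonneg (div_nonneg (sq_nonneg _) (e3.le.trans e1))]
      gcongr
    · exact ((hg.continuous_field_time hβ v).norm.pow 2).div (hg.continuous_ou_time hβ v) fun s =>
        (hg.pos.trans_le (hg.ou_bounds hβ s v).1).ne'
  exact h1.continuousOn.congr fun s hs => hg.smoothFisher_ou_eq hβ hs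

/-- Exponential decay of the Fisher information. -/
lemma IsNice.smoothFisher_ou_le (hg : IsNice ε M L g G) (hβ : 0 < β) (hs : 0 ≤ s) :
    smoothFisher β (ornsteinUhlenbeck β s g) ≤ Real.exp (-2 * s) * smoothFisher β g := by
  have := isProbabilityMeasure_gauss (E := E) hβ
  have hM := measurePreserving_mehlerMap (E := E) hβ hs
  have hm := continuous_mehler (E := E) s
  have hr := hg.continuous_ratio
  have hGc := hg.continuous_grad
  have hgc := hg.continuous
  have hri : Integrable (fun v => ‖G v‖ ^ 2 / g v) (gauss E β) :=
    Continuous.integrable_of_bound hr _ hg.norm_ratio_le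
  rw [hg.smoothFisher_ou_eq hβ hs, hg.smoothFisher_eq, ← integral_avg hM hri]
  refine mul_le_mul_of_nonneg_left ?_ (Real.exp_pos _).le
  refine integral_mono_of_nonneg (Eventually.of_forall fun v => div_nonneg (sq_nonneg _)
    (hg.pos.le.trans (hg.ou_bounds hβ s v).1)) (integrable_avg hM hri)
    (Eventually.of_forall fun v => ?_)
  have hpos : 0 < ornsteinUhlenbeck β s g v := hg.pos.trans_le (hg.ou_bounds hβ s v).1
  simp only
  rw [div_le_iff₀' hpos]
  -- Cauchy-Schwarz with weight `g` and field `G/g`: `‖P_s G‖² ≤ P_s g · P_s(‖G‖²/g)`. Integration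
  -- against the invariant `γ` removes `P_s`.
  have key := norm_integral_smul_sq_le (κ := gauss E β) (p := fun x => g (mehler s (v, x)))
    (X := fun x => (g (mehler s (v, x)))⁻¹ • G (mehler s (v, x)))
    (Eventually.of_forall fun x => (hg.pos' _).le)
    (Continuous.integrable_of_bound (by fun_prop) M fun x => hg.abs_le _) ?_
    (Continuous.aestronglyMeasurable ?_)
  · have e1 : ∀ x, g (mehler s (v, x)) • (g (mehler s (v, x)))⁻¹ • G (mehler s (v, x)) =
        G (mehler s (v, x)) := fun x => by
      rw [smul_smul, mul_inv_cancel₀ (hg.pos' _).ne', one_smul]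
    have e2 : ∀ x, g (mehler s (v, x)) * ‖(g (mehler s (v, x)))⁻¹ • G (mehler s (v, x))‖ ^ 2 =
        ‖G (mehler s (v, x))‖ ^ 2 / g (mehler s (v, x)) := fun x => by
      have := hg.pos' (mehler s (v, x))
      rw [norm_smul, norm_inv, Real.norm_of_nonneg this.le]
      field_simp
    simp only [e1, e2] at key
    exact key
  · refine Continuous.integrable_of_bound (f := fun x => g (mehler s (v, x)) *
      ‖(g (mehler s (v, x)))⁻¹ • G (mehler s (v, x))‖ ^ 2) ?_ (L ^ 2 / ε) fun x => ?_
    · have : Continuous fun x => (g (mehler s (v, x)))⁻¹ :=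
        Continuous.inv₀ (by fun_prop) fun x => (hg.pos' _).ne'
      fun_prop
    · have := hg.pos' (mehler s (v, x))
      have h2 := hg.norm_ratio_le (mehler s (v, x))
      rw [norm_smul, norm_inv, Real.norm_of_nonneg this.le]
      refine le_of_eq_of_le (congrArg _ ?_) h2
      field_simp
  · have : Continuous fun x => (g (mehler s (v, x)))⁻¹ :=
      Continuous.inv₀ (by fun_prop) fun x => (hg.pos' _).ne'
    fun_prop

lemma integrableOn_exp_neg_two_mul (c : ℝ) :
    IntegrableOn (fun s : ℝ => Real.exp (-2 * s)) (Set.Ioi c) :=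
  integrableOn_exp_mul_Ioi (by norm_num) c

lemma integral_exp_neg_two_mul : ∫ s in Set.Ioi (0 : ℝ), Real.exp (-2 * s) = 1 / 2 := by
  rw [integral_exp_mul_Ioi (by norm_num) 0]
  norm_num

lemma IsNice.integrableOn_smoothFisher (hg : IsNice ε M L g G) (hβ : 0 < β) :
    IntegrableOn (fun s => smoothFisher β (ornsteinUhlenbeck β s g)) (Set.Ioi 0) := by
  refine ((integrableOn_exp_neg_two_mul 0).mul_const (smoothFisher β g)).mono'
    (((hg.continuousOn_smoothFisher_ou hβ).mono Set.Ioi_subset_Ici_self).aestronglyMeasurable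
      measurableSet_Ioi) ?_
  filter_upwards [ae_restrict_mem measurableSet_Ioi] with s hs
  rw [Real.norm_of_nonneg (hg.ou hβ (le_of_lt hs)).smoothFisher_nonneg]
  exact hg.smoothFisher_ou_le hβ (le_of_lt hs)

lemma IsNice.continuous_entropy_time (hg : IsNice ε M L g G) (hβ : 0 < β) :
    ContinuousOn (fun s => ∫ v, klFun (ornsteinUhlenbeck β s g v) ∂gauss E β) (Set.Ici 0) := by
  have := isProbabilityMeasure_gauss (E := E) hβ
  intro s hs
  refine continuousWithinAt_of_dominated (bound := fun _ => 1 + klFun M) ?_ ?_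
    (integrable_const _) (Eventually.of_forall fun v =>
      (continuous_klFun.comp (hg.continuous_ou_time hβ v)).continuousWithinAt)
  · filter_upwards [self_mem_nhdsWithin] with r hr
    exact (continuous_klFun.comp (hg.ou hβ hr).continuous).aestronglyMeasurable
  · filter_upwards [self_mem_nhdsWithin] with r hr
    refine Eventually.of_forall fun v => ?_
    rw [Real.norm_of_nonneg (klFun_nonneg ((hg.ou hβ hr).pos' v).le)]
    exact (hg.ou hβ hr).klFun_le v

/-- A continuous function is the integral of its right derivative when the latter is integrable. By
the semigroup property the right derivative at `s` is the one at time zero for `P_s g`, which is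
again nice. -/
lemma IsNice.entropy_sub_entropy (hg : IsNice ε M L g G) (hβ : 0 < β) (ht : 0 ≤ t) :
    ∫ s in (0 : ℝ)..t, -(1 / β) * smoothFisher β (ornsteinUhlenbeck β s g) =
      (∫ v, klFun (ornsteinUhlenbeck β t g v) ∂gauss E β) - ∫ v, klFun (g v) ∂gauss E β := by
  have hsub : Set.uIcc 0 t ⊆ Set.Ici 0 := by
    rw [Set.uIcc_of_le ht]; exact Set.Icc_subset_Ici_self
  have key := intervalIntegral.integral_eq_sub_of_hasDeriv_right
    ((hg.continuous_entropy_time hβ).mono hsub)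
    (f' := fun s => -(1 / β) * smoothFisher β (ornsteinUhlenbeck β s g)) ?_ ?_
  · rw [key, ou_zero hβ]
  · intro s hs
    rw [min_eq_left ht] at hs
    rw [hasDerivWithinAt_iff_tendsto_slope' Set.self_notMem_Ioi]
    have h1 := (hg.ou hβ hs.1.le).tendsto_entropy_slope hβ
    have h2 : Tendsto (fun r => r - s) (𝓝[>] s) (𝓝[>] 0) := by
      refine tendsto_nhdsWithin_iff.2 ⟨?_, ?_⟩
      · have : Continuous fun r : ℝ => r - s := by fun_prop
        simpa using (this.tendsto s).mono_left (nhdsWithin_le_nhds (s := Set.Ioi s))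
      · filter_upwards [self_mem_nhdsWithin] with r hr
        exact sub_pos.2 (Set.mem_Ioi.1 hr)
    refine (h1.comp h2).congr' ?_
    filter_upwards [self_mem_nhdsWithin] with r hr
    have hr : s < r := hr
    simp only [Function.comp]
    rw [ou_ou hβ hs.1.le (by linarith) (by linarith [hs.1]) hg.continuous.measurable hg.abs_le,
      add_sub_cancel, slope_def_field]
    ring
  · exact (((hg.continuousOn_smoothFisher_ou hβ).mono hsub).const_smul (-(1 / β))).intervalIntegrable

lemma IsNice.tendsto_ou_atTop (hg : IsNice ε M L g G) (hβ : 0 < β) (v : E) :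
    Tendsto (fun s => ornsteinUhlenbeck β s g v) atTop (𝓝 (∫ x, g x ∂gauss E β)) := by
  have := isProbabilityMeasure_gauss (E := E) hβ
  have hgc := hg.continuous
  change Tendsto (fun s => ∫ x, g (mehler s (v, x)) ∂gauss E β) atTop _
  refine tendsto_integral_filter_of_dominated_convergence (fun _ => M) ?_
    (Eventually.of_forall fun s => Eventually.of_forall fun x => hg.abs_le _)
    (integrable_const M) (Eventually.of_forall fun x => ?_)
  · refine Eventually.of_forall fun s => Continuous.aestronglyMeasurable ?_
    have hm := continuous_mehler (E := E) s
    fun_prop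
  · have e1 : Tendsto (fun s : ℝ => Real.exp (-s)) atTop (𝓝 0) :=
      Real.tendsto_exp_neg_atTop_nhds_zero
    have e2 : Tendsto (fun s : ℝ => Real.exp (-2 * s)) atTop (𝓝 0) := by
      refine Real.tendsto_exp_atBot.comp ?_
      exact tendsto_id.const_mul_atTop_of_neg (by norm_num)
    have e3 : Tendsto (fun s : ℝ => √(1 - Real.exp (-2 * s))) atTop (𝓝 1) := by
      have := (Real.continuous_sqrt.tendsto _).comp (e2.const_sub 1)
      rw [sub_zero, Real.sqrt_one] at this
      exact this
    have e4 := (e1.smul_const v).add (e3.smul_const x)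
    rw [zero_smul, zero_add, one_smul] at e4
    exact (hgc.tendsto x).comp e4

/-- The entropy is the integral of the Fisher information along the Ornstein-Uhlenbeck
semigroup. -/
lemma IsNice.entropy_eq_integral (hg : IsNice ε M L g G) (hβ : 0 < β) :
    ∫ v, klFun (g v) ∂gauss E β = klFun (∫ v, g v ∂gauss E β) +
      (1 / β) * ∫ s in Set.Ioi (0 : ℝ), smoothFisher β (ornsteinUhlenbeck β s g) := by
  have := isProbabilityMeasure_gauss (E := E) hβ
  have h1 := intervalIntegral_tendsto_integral_Ioi 0
    ((hg.integrableOn_smoothFisher hβ).const_mul (-(1 / β))) tendsto_id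
  have h2 : Tendsto (fun t => (∫ v, klFun (ornsteinUhlenbeck β t g v) ∂gauss E β) -
      ∫ v, klFun (g v) ∂gauss E β) atTop
      (𝓝 ((∫ _v : E, klFun (∫ x, g x ∂gauss E β) ∂gauss E β) - ∫ v, klFun (g v) ∂gauss E β)) := by
    refine Tendsto.sub_const ?_ _
    refine tendsto_integral_filter_of_dominated_convergence (fun _ => 1 + klFun M) ?_ ?_
      (integrable_const _) (Eventually.of_forall fun v =>
        (continuous_klFun.tendsto _).comp (hg.tendsto_ou_atTop hβ v))
    · filter_upwards [eventually_ge_atTop 0] with t ht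
      exact (continuous_klFun.comp (hg.ou hβ ht).continuous).aestronglyMeasurable
    · filter_upwards [eventually_ge_atTop 0] with t ht
      refine Eventually.of_forall fun v => ?_
      rw [Real.norm_of_nonneg (klFun_nonneg ((hg.ou hβ ht).pos' v).le)]
      exact (hg.ou hβ ht).klFun_le v
  have h3 := tendsto_nhds_unique (h1.congr' (by
    filter_upwards [eventually_ge_atTop 0] with t ht using hg.entropy_sub_entropy hβ ht)) h2
  rw [integral_const_mul] at h3
  simp only [integral_const, probReal_univ, one_smul] at h3
  linarith

/-- The logarithmic Sobolev inequality. -/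
lemma IsNice.entropy_le (hg : IsNice ε M L g G) (hβ : 0 < β) :
    ∫ v, klFun (g v) ∂gauss E β ≤
      klFun (∫ v, g v ∂gauss E β) + 1 / (2 * β) * smoothFisher β g := by
  rw [hg.entropy_eq_integral hβ]
  have h1 : ∫ s in Set.Ioi (0 : ℝ), smoothFisher β (ornsteinUhlenbeck β s g) ≤
      ∫ s in Set.Ioi (0 : ℝ), Real.exp (-2 * s) * smoothFisher β g := by
    refine setIntegral_mono_on (hg.integrableOn_smoothFisher hβ)
      ((integrableOn_exp_neg_two_mul 0).mul_const _) measurableSet_Ioi fun s hs => ?_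
    exact hg.smoothFisher_ou_le hβ (le_of_lt hs)
  rw [integral_mul_const, integral_exp_neg_two_mul] at h1
  have h2 := mul_le_mul_of_nonneg_left h1 (one_div_nonneg.2 hβ.le)
  have h3 : 1 / β * (1 / 2 * smoothFisher β g) = 1 / (2 * β) * smoothFisher β g := by
    field_simp
  linarith

end Sobolev

/-- Young's inequality for the entropy function. -/
lemma mul_le_klFun_add_exp {x : ℝ} (hx : 0 ≤ x) (y : ℝ) : x * y ≤ klFun x + Real.exp y := by
  rcases hx.eq_or_lt with rfl | hx
  · have := Real.exp_pos y
    rw [klFun_zero]; linarith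
  have h1 := Real.add_one_le_exp (y - Real.log x)
  rw [Real.exp_sub, Real.exp_log hx, le_div_iff₀ hx] at h1
  rw [klFun_apply]
  linarith

lemma klFun_le_one_add {x y : ℝ} (hy : 0 ≤ y) (hx : 0 ≤ x) (hyx : y ≤ max x 1) :
    klFun y ≤ 1 + klFun x := by
  have h1 := convexOn_klFun.le_max_of_mem_Icc (Set.mem_Ici.2 le_rfl)
    (Set.mem_Ici.2 (hy.trans hyx)) ⟨hy, hyx⟩
  rw [klFun_zero] at h1
  have h2 := klFun_nonneg hx
  refine h1.trans (max_le (by linarith) ?_)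
  rcases max_choice x 1 with h | h <;> rw [h]
  · linarith
  · rw [klFun_one]; linarith

/-! ### Moments and information bounds for densities of finite entropy -/

section FiniteEntropy

variable {E : Type*} [NormedAddCommGroup E] [InnerProductSpace ℝ E] [FiniteDimensional ℝ E]
  [MeasurableSpace E] [BorelSpace E] {β s t : ℝ} {h : E → ℝ}

/-- Young's inequality `x y ≤ klFun x + e^y` with `y = β ‖v‖²/4`; the exponential is `γ`-integrable
because `β/4 < β/2`. -/
lemma integrable_norm_sq_mul (hβ : 0 < β) (hh : AEStronglyMeasurable h (gauss E β))
    (h0 : 0 ≤ᵐ[gauss E β] h) (hk : Integrable (fun v => klFun (h v)) (gauss E β)) :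
    Integrable (fun v => ‖v‖ ^ 2 * h v) (gauss E β) := by
  have he : Integrable (fun v : E => Real.exp (β / 4 * ‖v‖ ^ 2)) (gauss E β) := by
    rw [integrable_gauss_iff hβ]
    refine ((integrable_exp_neg_mul_sq_norm (E := E) (b := β / 4) (by positivity)).const_mul
      (maxwellConst E β)).congr (Eventually.of_forall fun v => ?_)
    simp only [maxwell_eq, smul_eq_mul, mul_assoc, ← Real.exp_add]
    ring_nf
  refine ((hk.add he).const_mul (4 / β)).mono'
    ((continuous_norm.pow 2).aestronglyMeasurable.mul hh) ?_
  filter_upwards [h0] with v hv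
  have hv : 0 ≤ h v := hv
  rw [Real.norm_of_nonneg (by positivity), Pi.add_apply]
  have := mul_le_klFun_add_exp hv (β / 4 * ‖v‖ ^ 2)
  rw [div_mul_eq_mul_div, le_div_iff₀ hβ]
  linarith

/-- Rotating `E × E` puts the argument of `h` into the first coordinate, so that the second moment
of the noise weighted by `h` is controlled by moments of `h` itself, uniformly in `s`. -/
lemma mul_norm_sq_rotate (hs : 0 ≤ s) (h : E → ℝ) (p : E × E) :
    h (mehler s p) * ‖p.2‖ ^ 2 =
      (fun q : E × E => h q.1 * ‖√(1 - Real.exp (-2 * s)) • q.1 - Real.exp (-s) • q.2‖ ^ 2)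
        (Real.exp (-s) • p.1 + √(1 - Real.exp (-2 * s)) • p.2,
          √(1 - Real.exp (-2 * s)) • p.1 - Real.exp (-s) • p.2) := by
  have h1 := mehler_sq hs
  simp only [mehler]
  generalize Real.exp (-s) = a at *
  generalize √(1 - Real.exp (-2 * s)) = b at *
  have : b • (a • p.1 + b • p.2) - a • (b • p.1 - a • p.2) = p.2 := by
    calc b • (a • p.1 + b • p.2) - a • (b • p.1 - a • p.2) = (a ^ 2 + b ^ 2) • p.2 := by module
      _ = p.2 := by rw [h1, one_smul]
  rw [this]

lemma norm_rotate_sq_le (hs : 0 ≤ s) (x y : E) :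
    ‖√(1 - Real.exp (-2 * s)) • x - Real.exp (-s) • y‖ ^ 2 ≤ 2 * ‖x‖ ^ 2 + 2 * ‖y‖ ^ 2 := by
  have h1 := mehler_sq hs
  have h2 := Real.exp_pos (-s)
  have h3 := Real.sqrt_nonneg (1 - Real.exp (-2 * s))
  generalize Real.exp (-s) = a at *
  generalize √(1 - Real.exp (-2 * s)) = b at *
  have h4 : ‖b • x - a • y‖ ≤ b * ‖x‖ + a * ‖y‖ := by
    refine (norm_sub_le _ _).trans (le_of_eq ?_)
    rw [norm_smul, norm_smul, Real.norm_of_nonneg h2.le, Real.norm_of_nonneg h3]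
  have h5 : b * ‖x‖ ≤ ‖x‖ := mul_le_of_le_one_left (norm_nonneg _) (by nlinarith)
  have h6 : a * ‖y‖ ≤ ‖y‖ := mul_le_of_le_one_left (norm_nonneg _) (by nlinarith)
  have h7 := pow_le_pow_left₀ (norm_nonneg _) (h4.trans (add_le_add h5 h6)) 2
  nlinarith [sq_nonneg (‖x‖ - ‖y‖)]

lemma integrable_rotate_aux (hβ : 0 < β) (hh : Integrable h (gauss E β))
    (h2 : Integrable (fun v => ‖v‖ ^ 2 * h v) (gauss E β)) :
    Integrable (fun q : E × E => 2 * (‖q.1‖ ^ 2 * h q.1) + 2 * (h q.1 * ‖q.2‖ ^ 2))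
      ((gauss E β).prod (gauss E β)) := by
  have := isProbabilityMeasure_gauss (E := E) hβ
  have h3 := (hh.mul_prod (integrable_norm_sq_gauss (E := E) hβ)).const_mul 2
  have h4 := ((measurePreserving_fst (μ := gauss E β)
    (ν := gauss E β)).integrable_comp_of_integrable h2).const_mul 2
  exact h4.add h3

lemma integrable_rotate (hβ : 0 < β) (hs : 0 ≤ s) (hh : Integrable h (gauss E β))
    (h2 : Integrable (fun v => ‖v‖ ^ 2 * h v) (gauss E β)) :
    Integrable (fun q : E × E => h q.1 *
      ‖√(1 - Real.exp (-2 * s)) • q.1 - Real.exp (-s) • q.2‖ ^ 2)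
      ((gauss E β).prod (gauss E β)) := by
  have := isProbabilityMeasure_gauss (E := E) hβ
  have h1 := integrable_rotate_aux hβ hh.norm
    (h2.norm.congr (Eventually.of_forall fun v => by
      simp only [norm_mul, norm_pow, norm_norm]))
  refine h1.mono' ((hh.aestronglyMeasurable.comp_fst).mul
    (Continuous.aestronglyMeasurable (by fun_prop))) (Eventually.of_forall fun q => ?_)
  rw [norm_mul, norm_pow, norm_norm]
  have := mul_le_mul_of_nonneg_left (norm_rotate_sq_le hs q.1 q.2) (norm_nonneg (h q.1))
  linarith

lemma integrable_mehler_norm_sq (hβ : 0 < β) (hs : 0 ≤ s) (hh : Integrable h (gauss E β))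
    (h2 : Integrable (fun v => ‖v‖ ^ 2 * h v) (gauss E β)) :
    Integrable (fun p : E × E => h (mehler s p) * ‖p.2‖ ^ 2)
      ((gauss E β).prod (gauss E β)) := by
  simp only [mul_norm_sq_rotate hs h]
  exact (measurePreserving_rotate hβ (mehler_sq hs)).integrable_comp_of_integrable
    (integrable_rotate hβ hs hh h2)

lemma integral_mehler_norm_sq_le (hβ : 0 < β) (hs : 0 ≤ s) (hh : Integrable h (gauss E β))
    (h0 : ∀ v, 0 ≤ h v) (h2 : Integrable (fun v => ‖v‖ ^ 2 * h v) (gauss E β)) :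
    ∫ p : E × E, h (mehler s p) * ‖p.2‖ ^ 2 ∂(gauss E β).prod (gauss E β) ≤
      ∫ q : E × E, (2 * (‖q.1‖ ^ 2 * h q.1) + 2 * (h q.1 * ‖q.2‖ ^ 2))
        ∂(gauss E β).prod (gauss E β) := by
  have := isProbabilityMeasure_gauss (E := E) hβ
  have hR := measurePreserving_rotate (E := E) hβ (mehler_sq hs)
  have hi := integrable_rotate hβ hs hh h2
  have heq : ∫ p : E × E, h (mehler s p) * ‖p.2‖ ^ 2 ∂(gauss E β).prod (gauss E β) =
      ∫ q : E × E, h q.1 * ‖√(1 - Real.exp (-2 * s)) • q.1 - Real.exp (-s) • q.2‖ ^ 2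
        ∂(gauss E β).prod (gauss E β) := by
    conv_rhs => rw [← hR.map_eq]
    rw [integral_map hR.measurable.aemeasurable
      (by rw [hR.map_eq]; exact hi.aestronglyMeasurable)]
    exact integral_congr_ae (Eventually.of_forall (mul_norm_sq_rotate hs h))
  rw [heq]
  refine integral_mono hi (integrable_rotate_aux hβ hh h2) fun q => ?_
  have := mul_le_mul_of_nonneg_left (norm_rotate_sq_le hs q.1 q.2) (h0 q.1)
  simp only
  linarith

/-- Nonnegative densities of finite entropy, with an everywhere defined measurable version. -/
structure FiniteEntropy (β : ℝ) (h : E → ℝ) : Prop where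
  measurable : Measurable h
  nonneg : ∀ v, 0 ≤ h v
  integrable : Integrable h (gauss E β)
  klFun_integrable : Integrable (fun v => klFun (h v)) (gauss E β)
  pos : 0 < ∫ v, h v ∂gauss E β

lemma FiniteEntropy.moment (hh : FiniteEntropy β h) (hβ : 0 < β) :
    Integrable (fun v => ‖v‖ ^ 2 * h v) (gauss E β) :=
  integrable_norm_sq_mul hβ hh.integrable.aestronglyMeasurable
    (Eventually.of_forall hh.nonneg) hh.klFun_integrable

/-- The kernel is positive: if `P_s h` vanished at one point, then `h` would vanish almost
everywhere. -/
lemma ou_pos (hβ : 0 < β) (hs : 0 < s) (h0 : ∀ v, 0 ≤ h v) (hh : Integrable h (gauss E β))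
    (hpos : 0 < ∫ v, h v ∂gauss E β) (v : E) : 0 < ornsteinUhlenbeck β s h v := by
  obtain ⟨-, hb, -⟩ := isMehlerPair_exp hs
  have hi := integrable_mehler hβ (isMehlerPair_exp hs) hh v
  refine lt_of_le_of_ne (integral_nonneg fun x => h0 _) fun heq => ?_
  have h1 := (integral_eq_zero_iff_of_nonneg (fun x => h0 _) hi).1 heq.symm
  have h2 := ae_mehler hβ (inv_ne_zero hb.ne') h1
    (-((√(1 - Real.exp (-2 * s)))⁻¹ • Real.exp (-s) • v))
  have h3 : h =ᵐ[gauss E β] 0 := by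
    filter_upwards [h2] with y hy
    rw [smul_add, smul_neg, smul_inv_smul₀ hb.ne', smul_inv_smul₀ hb.ne',
      add_neg_cancel_left] at hy
    exact hy
  rw [integral_congr_ae h3] at hpos
  simp at hpos

lemma smoothFisher_ou (hβ : 0 < β) (hs : 0 < s) (hh : Integrable h (gauss E β)) :
    smoothFisher β (ornsteinUhlenbeck β s h) =
      ∫ v, ‖ouGrad β s h v‖ ^ 2 / ornsteinUhlenbeck β s h v ∂gauss E β := by
  refine integral_congr_ae (Eventually.of_forall fun v => ?_)
  simp only [(hasFDerivAt_ou hβ hs hh v).fderiv, innerSL_apply_norm]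

/-- The prefactor of the gradient of `P_s h`. -/
def ouFactor (β s : ℝ) : ℝ := β * Real.exp (-s) / √(1 - Real.exp (-2 * s))

/-- The gradient of `P_s h` is a multiple of the mean of the noise `x` weighted by `h`, so
Cauchy-Schwarz with weight `h` bounds its square by `P_s h` times a second moment. No derivative of
`h` enters. -/
lemma norm_ouGrad_sq_div_le (hβ : 0 < β) (hs : 0 < s) (h0 : ∀ v, 0 ≤ h v)
    (hh : Integrable h (gauss E β)) {v : E}
    (hv : Integrable (fun x => h (mehler s (v, x)) * ‖x‖ ^ 2) (gauss E β)) :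
    ‖ouGrad β s h v‖ ^ 2 / ornsteinUhlenbeck β s h v ≤
      ouFactor β s ^ 2 * ∫ x, h (mehler s (v, x)) * ‖x‖ ^ 2 ∂gauss E β := by
  have hi := integrable_mehler hβ (isMehlerPair_exp hs) hh v
  have h1 := norm_integral_smul_sq_le (κ := gauss E β) (p := fun x => h (mehler s (v, x)))
    (X := fun x => x) (Eventually.of_forall fun x => h0 _) hi hv
    continuous_id.aestronglyMeasurable
  have hA : 0 ≤ ornsteinUhlenbeck β s h v := integral_nonneg fun x => h0 _
  have hB : 0 ≤ ∫ x, h (mehler s (v, x)) * ‖x‖ ^ 2 ∂gauss E β :=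
    integral_nonneg fun x => mul_nonneg (h0 _) (sq_nonneg _)
  refine div_le_of_le_mul₀ hA (mul_nonneg (sq_nonneg _) hB) ?_
  rw [ouGrad, norm_smul, mul_pow, Real.norm_eq_abs, sq_abs]
  change ouFactor β s ^ 2 * _ ≤ _
  rw [mul_assoc]
  refine mul_le_mul_of_nonneg_left (h1.trans (le_of_eq ?_)) (sq_nonneg _)
  rw [mul_comm]
  rfl

/-- A positive time of the flow makes a merely measurable function, bounded and bounded away from
zero, nice. This is how truncated densities enter de Bruijn's identity. -/
lemma isNice_ou (hβ : 0 < β) (hs : 0 < s) {ε M : ℝ} (hε : 0 < ε) (hm : Measurable h)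
    (hl : ∀ v, ε ≤ h v) (hu : ∀ v, h v ≤ M) :
    IsNice ε M (‖ouFactor β s‖ * ∫ x, M * ‖x‖ ∂gauss E β) (ornsteinUhlenbeck β s h)
      (ouGrad β s h) := by
  have := isProbabilityMeasure_gauss (E := E) hβ
  have hn : ∀ v, ‖h v‖ ≤ M := fun v => by
    rw [Real.norm_of_nonneg (hε.le.trans (hl v))]; exact hu v
  have hi : Integrable h (gauss E β) :=
    Integrable.of_bound hm.aestronglyMeasurable M (Eventually.of_forall hn)
  have hvi := fun v => integrable_mehler hβ (isMehlerPair_exp hs) hi v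
  refine ⟨hε, fun v => ?_, fun v => ?_, hasFDerivAt_ou hβ hs hi, continuous_ouGrad hβ hs hi,
    fun v => ?_⟩
  · have := integral_mono (integrable_const ε) (hvi v) fun x => hl _
    rwa [integral_const, probReal_univ, one_smul] at this
  · have := integral_mono (hvi v) (integrable_const M) fun x => hu _
    rwa [integral_const, probReal_univ, one_smul] at this
  · rw [ouGrad, norm_smul]
    refine mul_le_mul_of_nonneg_left ?_ (norm_nonneg _)
    refine norm_integral_le_of_norm_le ((integrable_norm_gauss hβ).const_mul M)
      (Eventually.of_forall fun x => ?_)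
    rw [norm_smul]
    exact mul_le_mul_of_nonneg_right (hn _) (norm_nonneg _)

/-- For fixed `s > 0` the denominator stays away from zero, and the bound is integrable over the
remaining time `t`. It degenerates as `s → 0`, which is why the identity is started at a positive
time. -/
lemma ouFactor_sq_le (hβ : 0 < β) (hs : 0 < s) (ht : 0 < t) :
    ouFactor β (s + t) ^ 2 ≤ β ^ 2 / (1 - Real.exp (-2 * s)) * Real.exp (-2 * t) := by
  have h1 : Real.exp (-2 * s) < 1 := by
    rw [← Real.exp_zero]; exact Real.exp_lt_exp.2 (by linarith)
  have h2 : Real.exp (-2 * (s + t)) ≤ Real.exp (-2 * s) := Real.exp_le_exp.2 (by linarith)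
  have h3 : Real.exp (-2 * (s + t)) ≤ Real.exp (-2 * t) := Real.exp_le_exp.2 (by linarith)
  have h4 : Real.exp (-(s + t)) ^ 2 = Real.exp (-2 * (s + t)) := by
    rw [← Real.exp_nat_mul]; congr 1; push_cast; ring
  rw [ouFactor, div_pow, Real.sq_sqrt (by linarith), mul_pow, h4, div_mul_eq_mul_div]
  gcongr

end FiniteEntropy

/-! ### De Bruijn's identity for densities of finite entropy, by truncation -/

section Truncation

variable {E : Type*} [NormedAddCommGroup E] [InnerProductSpace ℝ E] [FiniteDimensional ℝ E]
  [MeasurableSpace E] [BorelSpace E] {β s t : ℝ} {h : E → ℝ}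

/-- Truncation of a nonnegative function, bounded and bounded away from zero. -/
def truncate (h : E → ℝ) (n : ℕ) (v : E) : ℝ :=
  (1 - 1 / ((n : ℝ) + 1)) * min (h v) n + 1 / ((n : ℝ) + 1)

lemma one_div_succ_le_one (n : ℕ) : 1 / ((n : ℝ) + 1) ≤ 1 := by
  rw [div_le_one (by positivity)]
  linarith [n.cast_nonneg (α := ℝ)]

lemma measurable_truncate (hh : Measurable h) (n : ℕ) : Measurable (truncate h n) :=
  ((hh.min measurable_const).const_mul _).add_const _

lemma le_truncate (h0 : ∀ v, 0 ≤ h v) (n : ℕ) (v : E) : 1 / ((n : ℝ) + 1) ≤ truncate h n v := by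
  have h1 := mul_nonneg (sub_nonneg.2 (one_div_succ_le_one n))
    (le_min (h0 v) (n.cast_nonneg (α := ℝ)))
  rw [truncate]; linarith

lemma truncate_nonneg (h0 : ∀ v, 0 ≤ h v) (n : ℕ) (v : E) : 0 ≤ truncate h n v :=
  le_trans (by positivity) (le_truncate h0 n v)

lemma truncate_le (h : E → ℝ) (n : ℕ) (v : E) : truncate h n v ≤ n + 1 := by
  have h1 := mul_le_mul_of_nonneg_left (min_le_right (h v) n)
    (sub_nonneg.2 (one_div_succ_le_one n))
  have h2 := one_div_succ_le_one n
  have h3 : 0 < 1 / ((n : ℝ) + 1) := by positivity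
  rw [truncate]
  nlinarith [n.cast_nonneg (α := ℝ)]

/-- The bound is a convex combination of `h` and the constant `1`. Hence `P_s` of the truncation is
at most `max (P_s h) 1`, which dominates the entropies through `klFun_le_one_add`. -/
lemma truncate_le_convex (h : E → ℝ) (n : ℕ) (v : E) :
    truncate h n v ≤ (1 - 1 / ((n : ℝ) + 1)) * h v + 1 / ((n : ℝ) + 1) := by
  have h1 := mul_le_mul_of_nonneg_left (min_le_left (h v) n)
    (sub_nonneg.2 (one_div_succ_le_one n))
  rw [truncate]
  linarith

lemma truncate_le_add_one (h0 : ∀ v, 0 ≤ h v) (n : ℕ) (v : E) : truncate h n v ≤ h v + 1 := by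
  have h1 := truncate_le_convex h n v
  have h2 := one_div_succ_le_one n
  have h3 : 0 < 1 / ((n : ℝ) + 1) := by positivity
  nlinarith [h0 v]

lemma tendsto_truncate (h : E → ℝ) (v : E) :
    Tendsto (fun n => truncate h n v) atTop (𝓝 (h v)) := by
  have h1 := tendsto_one_div_add_atTop_nhds_zero_nat (𝕜 := ℝ)
  have h2 : Tendsto (fun n : ℕ => min (h v) n) atTop (𝓝 (h v)) := by
    refine tendsto_const_nhds.congr' ?_
    filter_upwards [tendsto_natCast_atTop_atTop.eventually_ge_atTop (h v)] with n hn
    exact (min_eq_left hn).symm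
  have h3 := ((h1.const_sub 1).mul h2).add h1
  simpa [truncate] using h3

lemma norm_truncate_le (h0 : ∀ v, 0 ≤ h v) (n : ℕ) (v : E) : ‖truncate h n v‖ ≤ h v + 1 := by
  rw [Real.norm_of_nonneg (truncate_nonneg h0 n v)]
  exact truncate_le_add_one h0 n v

lemma integrable_truncate (hβ : 0 < β) (hh : FiniteEntropy β h) (n : ℕ) :
    Integrable (truncate h n) (gauss E β) := by
  have := isProbabilityMeasure_gauss (E := E) hβ
  exact (hh.integrable.add (integrable_const 1)).mono'
    (measurable_truncate hh.measurable n).aestronglyMeasurable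
    (Eventually.of_forall (norm_truncate_le hh.nonneg n))

lemma FiniteEntropy.integrable_add_one (hh : FiniteEntropy β h) (hβ : 0 < β) :
    Integrable (fun v => h v + 1) (gauss E β) := by
  have := isProbabilityMeasure_gauss (E := E) hβ
  exact hh.integrable.add (integrable_const 1)

lemma FiniteEntropy.moment_add_one (hh : FiniteEntropy β h) (hβ : 0 < β) :
    Integrable (fun v => ‖v‖ ^ 2 * (h v + 1)) (gauss E β) := by
  simp only [mul_add, mul_one]
  exact (hh.moment hβ).add (integrable_norm_sq_gauss hβ)

lemma aestronglyMeasurable_comp_mehler (hm : Measurable h) (v : E) :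
    AEStronglyMeasurable (fun x => h (mehler s (v, x))) (gauss E β) := by
  have : Measurable fun x : E => mehler s (v, x) :=
    ((continuous_mehler s).comp (by fun_prop : Continuous fun x : E => (v, x))).measurable
  exact (hm.comp this).aestronglyMeasurable

lemma tendsto_ou_truncate (hβ : 0 < β) (hs : 0 < s) (hh : FiniteEntropy β h) (v : E) :
    Tendsto (fun n => ornsteinUhlenbeck β s (truncate h n) v) atTop
      (𝓝 (ornsteinUhlenbeck β s h v)) :=
  tendsto_integral_of_dominated_convergence _
    (fun n => aestronglyMeasurable_comp_mehler (measurable_truncate hh.measurable n) v)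
    (integrable_mehler hβ (isMehlerPair_exp hs) (hh.integrable_add_one hβ) v)
    (fun n => Eventually.of_forall fun _ => norm_truncate_le hh.nonneg n _)
    (Eventually.of_forall fun _ => tendsto_truncate h _)

lemma tendsto_ouGrad_truncate (hβ : 0 < β) (hs : 0 < s) (hh : FiniteEntropy β h) (v : E) :
    Tendsto (fun n => ouGrad β s (truncate h n) v) atTop (𝓝 (ouGrad β s h v)) := by
  refine Tendsto.const_smul (tendsto_integral_of_dominated_convergence _
    (fun n => (aestronglyMeasurable_comp_mehler (measurable_truncate hh.measurable n) v).smul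
      continuous_id.aestronglyMeasurable)
    (integrable_mehler_smul hβ (isMehlerPair_exp hs) (hh.integrable_add_one hβ) v).norm
    (fun n => Eventually.of_forall fun x => ?_)
    (Eventually.of_forall fun x => (tendsto_truncate h _).smul_const x)) _
  change ‖truncate h n (mehler s (v, x)) • x‖ ≤ _
  rw [norm_smul, norm_smul]
  refine mul_le_mul_of_nonneg_right ((norm_truncate_le hh.nonneg n _).trans ?_) (norm_nonneg _)
  exact le_abs_self _

lemma integral_mehler_norm_sq_mono (hβ : 0 < β) (hs : 0 ≤ s) (hh : FiniteEntropy β h) :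
    ∀ᵐ v ∂gauss E β, ∀ n,
      Integrable (fun x => truncate h n (mehler s (v, x)) * ‖x‖ ^ 2) (gauss E β) ∧
      ∫ x, truncate h n (mehler s (v, x)) * ‖x‖ ^ 2 ∂gauss E β ≤
        ∫ x, (h (mehler s (v, x)) + 1) * ‖x‖ ^ 2 ∂gauss E β := by
  have := isProbabilityMeasure_gauss (E := E) hβ
  filter_upwards [(integrable_mehler_norm_sq hβ hs (hh.integrable_add_one hβ)
    (hh.moment_add_one hβ)).prod_right_ae] with v hv n
  have hi : Integrable (fun x => truncate h n (mehler s (v, x)) * ‖x‖ ^ 2) (gauss E β) := by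
    refine hv.mono' ((aestronglyMeasurable_comp_mehler (measurable_truncate hh.measurable n) v).mul
      (continuous_norm.pow 2).aestronglyMeasurable) (Eventually.of_forall fun x => ?_)
    rw [norm_mul, norm_pow, norm_norm]
    exact mul_le_mul_of_nonneg_right (norm_truncate_le hh.nonneg n _) (sq_nonneg _)
  exact ⟨hi, integral_mono hi hv fun x =>
    mul_le_mul_of_nonneg_right (truncate_le_add_one hh.nonneg n _) (sq_nonneg _)⟩

lemma ratio_truncate_le (hβ : 0 < β) (hs : 0 < s) (hh : FiniteEntropy β h) :
    ∀ᵐ v ∂gauss E β, ∀ n,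
      ‖‖ouGrad β s (truncate h n) v‖ ^ 2 / ornsteinUhlenbeck β s (truncate h n) v‖ ≤
        ouFactor β s ^ 2 * ∫ x, (h (mehler s (v, x)) + 1) * ‖x‖ ^ 2 ∂gauss E β := by
  filter_upwards [integral_mehler_norm_sq_mono hβ hs.le hh] with v hv n
  have h1 := norm_ouGrad_sq_div_le hβ hs (truncate_nonneg hh.nonneg n)
    (integrable_truncate hβ hh n) (hv n).1
  have h2 : 0 ≤ ornsteinUhlenbeck β s (truncate h n) v :=
    integral_nonneg fun x => truncate_nonneg hh.nonneg n _
  rw [Real.norm_of_nonneg (div_nonneg (sq_nonneg _) h2)]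
  exact h1.trans (mul_le_mul_of_nonneg_left (hv n).2 (sq_nonneg _))

lemma tendsto_ratio_truncate (hβ : 0 < β) (hs : 0 < s) (hh : FiniteEntropy β h) (v : E) :
    Tendsto (fun n => ‖ouGrad β s (truncate h n) v‖ ^ 2 / ornsteinUhlenbeck β s (truncate h n) v)
      atTop (𝓝 (‖ouGrad β s h v‖ ^ 2 / ornsteinUhlenbeck β s h v)) :=
  ((tendsto_ouGrad_truncate hβ hs hh v).norm.pow 2).div (tendsto_ou_truncate hβ hs hh v)
    (ou_pos hβ hs hh.nonneg hh.integrable hh.pos v).ne'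

lemma isNice_ou_truncate (hβ : 0 < β) (hs : 0 < s) (hh : FiniteEntropy β h) (n : ℕ) :
    IsNice (1 / ((n : ℝ) + 1)) (n + 1) (‖ouFactor β s‖ * ∫ x, ((n : ℝ) + 1) * ‖x‖ ∂gauss E β)
      (ornsteinUhlenbeck β s (truncate h n)) (ouGrad β s (truncate h n)) :=
  isNice_ou hβ hs (by positivity) (measurable_truncate hh.measurable n)
    (le_truncate hh.nonneg n) (truncate_le h n)

/-- The integrands converge pointwise since `P_s h > 0`, and they are dominated, uniformly in `n`,
by the second moment of the noise weighted by `h + 1`. -/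
lemma tendsto_smoothFisher_truncate (hβ : 0 < β) (hs : 0 < s) (hh : FiniteEntropy β h) :
    Tendsto (fun n => smoothFisher β (ornsteinUhlenbeck β s (truncate h n))) atTop
      (𝓝 (smoothFisher β (ornsteinUhlenbeck β s h))) := by
  have := isProbabilityMeasure_gauss (E := E) hβ
  simp only [smoothFisher_ou hβ hs (integrable_truncate hβ hh _), smoothFisher_ou hβ hs hh.integrable]
  refine tendsto_integral_of_dominated_convergence _
    (fun n => (isNice_ou_truncate hβ hs hh n).continuous_ratio.aestronglyMeasurable)
    (((integrable_mehler_norm_sq hβ hs.le (hh.integrable_add_one hβ)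
      (hh.moment_add_one hβ)).integral_prod_left).const_mul (ouFactor β s ^ 2)) (fun n => ?_)
    (Eventually.of_forall (tendsto_ratio_truncate hβ hs hh))
  filter_upwards [ratio_truncate_le hβ hs hh] with v hv using hv n

lemma smoothFisher_truncate_le (hβ : 0 < β) (hs : 0 < s) (hh : FiniteEntropy β h) (n : ℕ) :
    smoothFisher β (ornsteinUhlenbeck β s (truncate h n)) ≤ ouFactor β s ^ 2 *
      ∫ q : E × E, (2 * (‖q.1‖ ^ 2 * (h q.1 + 1)) + 2 * ((h q.1 + 1) * ‖q.2‖ ^ 2))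
        ∂(gauss E β).prod (gauss E β) := by
  have := isProbabilityMeasure_gauss (E := E) hβ
  have h1 := integrable_mehler_norm_sq hβ hs.le (hh.integrable_add_one hβ) (hh.moment_add_one hβ)
  have h2 := integral_mehler_norm_sq_le hβ hs.le (hh.integrable_add_one hβ)
    (fun v => by linarith [hh.nonneg v]) (hh.moment_add_one hβ)
  refine le_trans ?_ (mul_le_mul_of_nonneg_left h2 (sq_nonneg _))
  rw [smoothFisher_ou hβ hs (integrable_truncate hβ hh _), integral_prod _ h1, ← integral_const_mul]
  have hn := isNice_ou_truncate hβ hs hh n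
  refine integral_mono_ae (Continuous.integrable_of_bound hn.continuous_ratio _ hn.norm_ratio_le)
    (h1.integral_prod_left.const_mul _) ?_
  filter_upwards [ratio_truncate_le hβ hs hh] with v hv
  exact (le_abs_self _).trans (hv n)

lemma FiniteEntropy.integrable_klFun_ou (hh : FiniteEntropy β h) (hβ : 0 < β) (hs : 0 ≤ s) :
    Integrable (fun v => klFun (ornsteinUhlenbeck β s h v)) (gauss E β) := by
  have := isProbabilityMeasure_gauss (E := E) hβ
  exact integrable_klFun_avg (measurePreserving_mehlerMap hβ hs) hh.integrable
    (Eventually.of_forall hh.nonneg) hh.klFun_integrable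

lemma tendsto_entropy_truncate (hβ : 0 < β) (hs : 0 < s) (hh : FiniteEntropy β h) :
    Tendsto (fun n => ∫ v, klFun (ornsteinUhlenbeck β s (truncate h n) v) ∂gauss E β) atTop
      (𝓝 (∫ v, klFun (ornsteinUhlenbeck β s h v) ∂gauss E β)) := by
  have := isProbabilityMeasure_gauss (E := E) hβ
  refine tendsto_integral_of_dominated_convergence _
    (fun n => (continuous_klFun.comp (isNice_ou_truncate hβ hs hh n).continuous).aestronglyMeasurable)
    ((integrable_const 1).add (hh.integrable_klFun_ou hβ hs.le))
    (fun n => Eventually.of_forall fun v => ?_)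
    (Eventually.of_forall fun v => (continuous_klFun.tendsto _).comp (tendsto_ou_truncate hβ hs hh v))
  have h1 : 0 ≤ ornsteinUhlenbeck β s (truncate h n) v :=
    integral_nonneg fun x => truncate_nonneg hh.nonneg n _
  have h2 : 0 ≤ ornsteinUhlenbeck β s h v := integral_nonneg fun x => hh.nonneg _
  rw [Real.norm_of_nonneg (klFun_nonneg h1)]
  refine klFun_le_one_add h1 h2 ?_
  have hi := integrable_mehler hβ (isMehlerPair_exp hs) hh.integrable v
  have h3 := integral_mono
    (integrable_mehler hβ (isMehlerPair_exp hs) (integrable_truncate hβ hh n) v)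
    ((hi.const_mul _).add (integrable_const _)) fun x => truncate_le_convex h n _
  rw [integral_add' (hi.const_mul _) (integrable_const _), integral_const_mul, integral_const,
    probReal_univ, one_smul] at h3
  have h4 := one_div_succ_le_one n
  have h5 : 0 < 1 / ((n : ℝ) + 1) := by positivity
  change ornsteinUhlenbeck β s (truncate h n) v ≤
    (1 - 1 / ((n : ℝ) + 1)) * ornsteinUhlenbeck β s h v + 1 / ((n : ℝ) + 1) at h3
  nlinarith [le_max_left (ornsteinUhlenbeck β s h v) 1, le_max_right (ornsteinUhlenbeck β s h v) 1]

/-- de Bruijn's identity along the Ornstein-Uhlenbeck flow, started at a positive time. -/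
theorem FiniteEntropy.entropy_ou (hh : FiniteEntropy β h) (hβ : 0 < β) (hs : 0 < s) :
    IntegrableOn (fun τ => smoothFisher β (ornsteinUhlenbeck β (s + τ) h)) (Set.Ioi 0) ∧
    ∫ v, klFun (ornsteinUhlenbeck β s h v) ∂gauss E β = klFun (∫ v, h v ∂gauss E β) +
      (1 / β) * ∫ τ in Set.Ioi (0 : ℝ), smoothFisher β (ornsteinUhlenbeck β (s + τ) h) := by
  have := isProbabilityMeasure_gauss (E := E) hβ
  -- `D` bounds the second moment of the noise weighted by `h + 1`, for all truncations and all
  -- times; the dependence on time sits in `ouFactor` alone.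
  set D := ∫ q : E × E, (2 * (‖q.1‖ ^ 2 * (h q.1 + 1)) + 2 * ((h q.1 + 1) * ‖q.2‖ ^ 2))
    ∂(gauss E β).prod (gauss E β) with hD
  have hD0 : 0 ≤ D := integral_nonneg fun q => by
    have := hh.nonneg q.1
    positivity
  have hou : ∀ n : ℕ, ∀ τ, 0 ≤ τ → ornsteinUhlenbeck β τ (ornsteinUhlenbeck β s (truncate h n)) =
      ornsteinUhlenbeck β (s + τ) (truncate h n) := fun n τ hτ =>
    ou_ou hβ hs.le hτ (by linarith) (measurable_truncate hh.measurable n) (M := n + 1) fun v => by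
      rw [abs_of_nonneg (truncate_nonneg hh.nonneg n v)]; exact truncate_le h n v
  have hI : ∀ n, IntegrableOn (fun τ => smoothFisher β (ornsteinUhlenbeck β (s + τ) (truncate h n)))
      (Set.Ioi 0) := fun n =>
    ((isNice_ou_truncate hβ hs hh n).integrableOn_smoothFisher hβ).congr_fun
      (fun τ hτ => by simp only [hou n τ (le_of_lt hτ)]) measurableSet_Ioi
  set bound : ℝ → ℝ := fun τ => β ^ 2 / (1 - Real.exp (-2 * s)) * Real.exp (-2 * τ) * D with hbound
  have hbI : IntegrableOn bound (Set.Ioi 0) :=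
    ((integrableOn_exp_neg_two_mul 0).const_mul _).mul_const _
  have hb : ∀ n, ∀ τ ∈ Set.Ioi (0 : ℝ),
      ‖smoothFisher β (ornsteinUhlenbeck β (s + τ) (truncate h n))‖ ≤ bound τ := fun n τ hτ => by
    have hsτ : 0 < s + τ := add_pos hs hτ
    rw [Real.norm_of_nonneg (isNice_ou_truncate hβ hsτ hh n).smoothFisher_nonneg]
    exact (smoothFisher_truncate_le hβ hsτ hh n).trans
      (mul_le_mul_of_nonneg_right (ouFactor_sq_le hβ hs hτ) hD0)
  have hlim : ∀ τ ∈ Set.Ioi (0 : ℝ),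
      Tendsto (fun n => smoothFisher β (ornsteinUhlenbeck β (s + τ) (truncate h n))) atTop
        (𝓝 (smoothFisher β (ornsteinUhlenbeck β (s + τ) h))) := fun τ hτ =>
    tendsto_smoothFisher_truncate hβ (add_pos hs hτ) hh
  have hae : ∀ {p : ℝ → Prop}, (∀ τ ∈ Set.Ioi (0 : ℝ), p τ) →
      ∀ᵐ τ ∂volume.restrict (Set.Ioi (0 : ℝ)), p τ := fun hp =>
    (ae_restrict_mem measurableSet_Ioi).mono hp
  refine ⟨hbI.mono' (aestronglyMeasurable_of_tendsto_ae atTop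
    (fun n => (hI n).aestronglyMeasurable) (hae hlim)) (hae fun τ hτ =>
      le_of_tendsto (hlim τ hτ).norm (Eventually.of_forall fun n => hb n τ hτ)), ?_⟩
  have h1 := tendsto_integral_of_dominated_convergence bound
    (fun n => (hI n).aestronglyMeasurable) hbI (fun n => hae (hb n)) (hae hlim)
  have h2 : Tendsto (fun n => ∫ v, truncate h n v ∂gauss E β) atTop (𝓝 (∫ v, h v ∂gauss E β)) :=
    tendsto_integral_of_dominated_convergence _
      (fun n => (integrable_truncate hβ hh n).aestronglyMeasurable) (hh.integrable_add_one hβ)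
      (fun n => Eventually.of_forall (norm_truncate_le hh.nonneg n))
      (Eventually.of_forall (tendsto_truncate h))
  have h3 := ((continuous_klFun.tendsto _).comp h2).add (h1.const_mul (1 / β))
  refine tendsto_nhds_unique (tendsto_entropy_truncate hβ hs hh) (h3.congr fun n => ?_)
  rw [(isNice_ou_truncate hβ hs hh n).entropy_eq_integral hβ, Function.comp,
    ornsteinUhlenbeck_eq_avg, integral_avg (measurePreserving_mehlerMap hβ hs.le)
      (integrable_truncate hβ hh n)]
  congr 2
  refine setIntegral_congr_fun measurableSet_Ioi fun τ hτ => ?_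
  rw [← ornsteinUhlenbeck_eq_avg]
  simp only [hou n τ (le_of_lt hτ)]

end Truncation

lemma tendsto_eLpNorm_one_of_integral {X : Type*} [MeasurableSpace X] {μ : Measure X}
    {u : ℕ → X → ℝ} {f : X → ℝ} (hu : ∀ n, Integrable (u n) μ) (hf : Integrable f μ)
    (h : Tendsto (fun n => ∫ v, |u n v - f v| ∂μ) atTop (𝓝 0)) :
    Tendsto (fun n => eLpNorm (u n - f) 1 μ) atTop (𝓝 0) := by
  have h1 := ENNReal.tendsto_ofReal h
  rw [ENNReal.ofReal_zero] at h1
  refine h1.congr fun n => ?_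
  rw [eLpNorm_one_eq_lintegral_enorm, ← ofReal_integral_norm_eq_lintegral_enorm ((hu n).sub hf)]
  rfl

/-- Lower semicontinuity of the entropy, combined with an upper bound. -/
lemma tendsto_integral_klFun {X : Type*} [MeasurableSpace X] {μ : Measure X}
    [IsProbabilityMeasure μ] {u : ℕ → X → ℝ}
    {f : X → ℝ} (hu : ∀ n, Integrable (u n) μ) (hu0 : ∀ n, 0 ≤ᵐ[μ] u n) (hf : Integrable f μ)
    (hf0 : 0 ≤ᵐ[μ] f) (hku : ∀ n, Integrable (fun v => klFun (u n v)) μ)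
    (hkf : Integrable (fun v => klFun (f v)) μ)
    (hle : ∀ n, ∫ v, klFun (u n v) ∂μ ≤ ∫ v, klFun (f v) ∂μ)
    (h : Tendsto (fun n => eLpNorm (u n - f) 1 μ) atTop (𝓝 0)) :
    Tendsto (fun n => ∫ v, klFun (u n v) ∂μ) atTop (𝓝 (∫ v, klFun (f v) ∂μ)) := by
  have hnn : ∀ n, 0 ≤ᵐ[μ] fun v => klFun (u n v) := fun n => by
    filter_upwards [hu0 n] with v hv using klFun_nonneg hv
  have hnf : 0 ≤ᵐ[μ] fun v => klFun (f v) := by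
    filter_upwards [hf0] with v hv using klFun_nonneg hv
  refine tendsto_order.2 ⟨fun a ha => ?_, fun a ha => Eventually.of_forall fun n =>
    (hle n).trans_lt ha⟩
  -- Otherwise a subsequence has entropy at most `a`, below that of `f`, against lower
  -- semicontinuity.
  by_contra hcon
  obtain ⟨φ, hφ, hφa⟩ := extraction_of_frequently_atTop (not_eventually.1 hcon)
  have h1 := lintegral_klFun_le_of_tendsto (S := ENNReal.ofReal a)
    (fun n => (hu (φ n)).aestronglyMeasurable) hf.aestronglyMeasurable
    (h.comp hφ.tendsto_atTop) fun n => by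
      rw [← ofReal_integral_eq_lintegral_ofReal (hku _) (hnn _)]
      exact ENNReal.ofReal_le_ofReal (not_lt.1 (hφa n))
  rw [← ofReal_integral_eq_lintegral_ofReal hkf hnf] at h1
  have ha0 : 0 ≤ a := (integral_nonneg_of_ae (hnn _)).trans (not_lt.1 (hφa 0))
  exact absurd ((ENNReal.ofReal_le_ofReal_iff ha0).1 h1) (not_le.2 ha)

/-! ### Continuity of the semigroup and of the entropy at time zero -/

section Continuity

variable {E : Type*} [NormedAddCommGroup E] [InnerProductSpace ℝ E] [FiniteDimensional ℝ E]
  [MeasurableSpace E] [BorelSpace E] {β : ℝ} {h : E → ℝ} {s : ℕ → ℝ}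

lemma integrable_ou (hβ : 0 < β) {s : ℝ} (hs : 0 ≤ s) (hh : Integrable h (gauss E β)) :
    Integrable (ornsteinUhlenbeck β s h) (gauss E β) := by
  have := isProbabilityMeasure_gauss (E := E) hβ
  exact integrable_avg (measurePreserving_mehlerMap hβ hs) hh

lemma integral_abs_ou_le (hβ : 0 < β) {s : ℝ} (hs : 0 ≤ s) (hh : Integrable h (gauss E β)) :
    ∫ v, |ornsteinUhlenbeck β s h v| ∂gauss E β ≤ ∫ v, |h v| ∂gauss E β := by
  have := isProbabilityMeasure_gauss (E := E) hβ
  exact integral_abs_avg_le (measurePreserving_mehlerMap hβ hs) hh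

lemma integral_abs_ou_sub_le (hβ : 0 < β) {s : ℝ} (hs : 0 ≤ s) {g : E → ℝ}
    (hh : Integrable h (gauss E β)) (hg : Integrable g (gauss E β)) :
    ∫ v, |ornsteinUhlenbeck β s h v - ornsteinUhlenbeck β s g v| ∂gauss E β ≤
      ∫ v, |h v - g v| ∂gauss E β := by
  have := isProbabilityMeasure_gauss (E := E) hβ
  refine le_trans (le_of_eq (integral_congr_ae ?_)) (integral_abs_ou_le hβ hs (hh.sub hg))
  filter_upwards [avg_ae_integrable (measurePreserving_mehlerMap hβ hs) hh,
    avg_ae_integrable (measurePreserving_mehlerMap hβ hs) hg] with v h1 h2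
  congr 1
  exact (integral_sub h1 h2).symm

lemma tendsto_integral_ou_sub_of_bounded (hβ : 0 < β) (hs : Tendsto s atTop (𝓝 0))
    (hc : Continuous h) {M : ℝ} (hM : ∀ v, |h v| ≤ M) :
    Tendsto (fun n => ∫ v, |ornsteinUhlenbeck β (s n) h v - h v| ∂gauss E β) atTop (𝓝 0) := by
  have := isProbabilityMeasure_gauss (E := E) hβ
  have hc2 : ∀ v, Continuous fun s => ornsteinUhlenbeck β s h v := fun v => by
    change Continuous fun s => ∫ x, h (mehler s (v, x)) ∂gauss E β
    refine continuous_of_dominated (bound := fun _ => M) (fun s => ?_)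
      (fun s => Eventually.of_forall fun x => hM _) (integrable_const M)
      (Eventually.of_forall fun x => hc.comp (continuous_mehler_time _))
    have hm := continuous_mehler (E := E) s
    exact Continuous.aestronglyMeasurable (by fun_prop)
  have hcv : ∀ s, Continuous (ornsteinUhlenbeck β s h) := fun s => by
    change Continuous fun v => ∫ x, h (mehler s (v, x)) ∂gauss E β
    have hm := continuous_mehler (E := E) s
    refine continuous_of_dominated (bound := fun _ => M)
      (fun v => Continuous.aestronglyMeasurable (by fun_prop))
      (fun s => Eventually.of_forall fun x => hM _) (integrable_const M)
      (Eventually.of_forall fun x => by fun_prop)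
  have hb : ∀ s v, |ornsteinUhlenbeck β s h v| ≤ M := fun s v => by
    refine (norm_integral_le_of_norm_le (μ := gauss E β) (integrable_const M)
      (f := fun x => h (mehler s (v, x)))
      (Eventually.of_forall fun x => hM _)).trans (le_of_eq ?_)
    rw [integral_const, probReal_univ, one_smul]
  have key := tendsto_integral_of_dominated_convergence (μ := gauss E β)
    (F := fun n v => |ornsteinUhlenbeck β (s n) h v - h v|) (f := fun _ => 0) (fun _ => M + M)
    (fun n => ((hcv _).sub hc).abs.aestronglyMeasurable) (integrable_const _)
    (fun n => Eventually.of_forall fun v => ?_) (Eventually.of_forall fun v => ?_)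
  · simpa using key
  · rw [Real.norm_eq_abs, abs_abs]
    exact (abs_sub _ _).trans (add_le_add (hb _ _) (hM _))
  · have h1 := ((hc2 v).tendsto 0).comp hs
    rw [ou_zero hβ] at h1
    have h2 := (h1.sub_const (h v)).abs
    rw [sub_self, abs_zero] at h2
    exact h2

/-- Strong continuity of the Ornstein-Uhlenbeck semigroup at time zero. -/
lemma tendsto_integral_ou_sub (hβ : 0 < β) (hs : Tendsto s atTop (𝓝 0)) (hs0 : ∀ n, 0 ≤ s n)
    (hh : Integrable h (gauss E β)) :
    Tendsto (fun n => ∫ v, |ornsteinUhlenbeck β (s n) h v - h v| ∂gauss E β) atTop (𝓝 0) := by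
  have := isProbabilityMeasure_gauss (E := E) hβ
  refine tendsto_order.2 ⟨fun a ha => Eventually.of_forall fun n =>
    ha.trans_le (integral_nonneg fun v => abs_nonneg _), fun a ha => ?_⟩
  -- `P_s` contracts `L¹`, so an approximation of `h` by a bounded continuous function costs its
  -- error only twice.
  obtain ⟨g, hg, hgi⟩ := hh.exists_boundedContinuous_integral_sub_le (ε := a / 3) (by positivity)
  have h1 := tendsto_integral_ou_sub_of_bounded hβ hs g.continuous
    (fun v => g.norm_coe_le_norm v)
  filter_upwards [(tendsto_order.1 h1).2 (a / 3) (by positivity)] with n hn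
  have e1 := integral_abs_ou_sub_le hβ (hs0 n) hh hgi
  have i1 : Integrable (fun v => |ornsteinUhlenbeck β (s n) h v - ornsteinUhlenbeck β (s n) g v|)
      (gauss E β) := ((integrable_ou hβ (hs0 n) hh).sub (integrable_ou hβ (hs0 n) hgi)).abs
  have i2 : Integrable (fun v => |ornsteinUhlenbeck β (s n) g v - g v|) (gauss E β) :=
    ((integrable_ou hβ (hs0 n) hgi).sub hgi).abs
  have i3 : Integrable (fun v => |h v - g v|) (gauss E β) := (hh.sub hgi).abs
  have i0 : Integrable (fun v => |ornsteinUhlenbeck β (s n) h v - h v|) (gauss E β) :=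
    ((integrable_ou hβ (hs0 n) hh).sub hh).abs
  have i12 : Integrable (fun v => |ornsteinUhlenbeck β (s n) h v - ornsteinUhlenbeck β (s n) g v| +
    |ornsteinUhlenbeck β (s n) g v - g v|) (gauss E β) := i1.add i2
  have e2 := integral_mono i0 (i12.add i3) fun v => by
    have h1 := abs_sub_le (ornsteinUhlenbeck β (s n) h v) (ornsteinUhlenbeck β (s n) g v) (h v)
    have h2 := abs_sub_le (ornsteinUhlenbeck β (s n) g v) (g v) (h v)
    rw [abs_sub_comm (g v) (h v)] at h2
    simp only [Pi.add_apply]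
    linarith
  rw [integral_add' i12 i3, integral_add i1 i2] at e2
  have hg : ∫ v, |h v - g v| ∂gauss E β ≤ a / 3 := hg
  linarith

lemma tendsto_eLpNorm_ou_sub (hβ : 0 < β) (hs : Tendsto s atTop (𝓝 0)) (hs0 : ∀ n, 0 ≤ s n)
    (hh : Integrable h (gauss E β)) :
    Tendsto (fun n => eLpNorm (ornsteinUhlenbeck β (s n) h - h) 1 (gauss E β)) atTop (𝓝 0) :=
  tendsto_eLpNorm_one_of_integral (fun n => integrable_ou hβ (hs0 n) hh) hh
    (tendsto_integral_ou_sub hβ hs hs0 hh)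

/-- The entropy of `P_s h` converges to the entropy of `h` as `s → 0`. -/
lemma tendsto_entropy_ou (hβ : 0 < β) (hs : Tendsto s atTop (𝓝 0)) (hs0 : ∀ n, 0 ≤ s n)
    (hh : Integrable h (gauss E β)) (h0 : 0 ≤ᵐ[gauss E β] h)
    (hk : Integrable (fun v => klFun (h v)) (gauss E β)) :
    Tendsto (fun n => ∫ v, klFun (ornsteinUhlenbeck β (s n) h v) ∂gauss E β) atTop
      (𝓝 (∫ v, klFun (h v) ∂gauss E β)) := by
  have := isProbabilityMeasure_gauss (E := E) hβ
  have hM := fun n => measurePreserving_mehlerMap (E := E) hβ (hs0 n)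
  exact tendsto_integral_klFun (fun n => integrable_ou hβ (hs0 n) hh)
    (fun n => avg_nonneg (hM n) h0) hh h0 (fun n => integrable_klFun_avg (hM n) hh h0 hk) hk
    (fun n => integral_klFun_avg_le (hM n) hh h0 hk) (tendsto_eLpNorm_ou_sub hβ hs hs0 hh)

end Continuity

/-! ### The semigroup and weak gradients -/

section Cutoff

variable {E : Type*} [NormedAddCommGroup E] [InnerProductSpace ℝ E] [FiniteDimensional ℝ E]
  [MeasurableSpace E] [BorelSpace E] {β a b s : ℝ} {h u χ : E → ℝ} {G : E → E}

lemma contDiff_maxwell (β : ℝ) : ContDiff ℝ ∞ (maxwell β : E → ℝ) :=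
  contDiff_const.mul ((contDiff_const.mul (contDiff_norm_sq ℝ)).exp)

/-- Change of variables from the noise to the displaced point. -/
lemma integral_mehler_eq_kernel {F : Type*} [NormedAddCommGroup F] [NormedSpace ℝ F] (hβ : 0 < β)
    (hb : 0 < b) (X : E → F) (w : E) :
    ∫ x, X (w + b • x) ∂gauss E β = |(b ^ Module.finrank ℝ E)⁻¹| •
      ∫ y, maxwell β (b⁻¹ • (y - w)) • X y := by
  have h1 := Measure.integral_comp_smul (volume : Measure E)
    (fun y => maxwell β (b⁻¹ • y) • X (w + y)) b
  simp only [inv_smul_smul₀ hb.ne'] at h1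
  rw [integral_gauss hβ, h1]
  congr 1
  rw [← integral_sub_right_eq_self _ w]
  simp only [add_sub_cancel]

/-- The product rule gradient of `χ u`. -/
def cutGrad (χ u : E → ℝ) (G : E → E) (y : E) : E :=
  χ y • G y + u y • (InnerProductSpace.toDual ℝ E).symm (fderiv ℝ χ y)

lemma inner_cutGrad (χ u : E → ℝ) (G : E → E) (y e : E) :
    ⟪cutGrad χ u G y, e⟫_ℝ = χ y * ⟪G y, e⟫_ℝ + u y * fderiv ℝ χ y e := by
  rw [cutGrad, inner_add_left, real_inner_smul_left, real_inner_smul_left,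
    InnerProductSpace.toDual_symm_apply]

lemma continuous_toDual_fderiv (hχ : ContDiff ℝ ∞ χ) :
    Continuous fun y => (InnerProductSpace.toDual ℝ E).symm (fderiv ℝ χ y) :=
  (InnerProductSpace.toDual ℝ E).symm.continuous.comp
    (hχ.continuous_fderiv (by simp))

lemma hasCompactSupport_toDual_fderiv (hc : HasCompactSupport χ) :
    HasCompactSupport fun y => (InnerProductSpace.toDual ℝ E).symm (fderiv ℝ χ y) :=
  (hc.fderiv ℝ).comp_left (map_zero _)

lemma integrable_cutGrad (hu : IsWeakGradient u G) (hχ : ContDiff ℝ ∞ χ)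
    (hc : HasCompactSupport χ) : Integrable (cutGrad χ u G) :=
  (hu.2.1.integrable_smul_left_of_hasCompactSupport hχ.continuous hc).add
    (hu.1.integrable_smul_right_of_hasCompactSupport (continuous_toDual_fderiv hχ)
      (hasCompactSupport_toDual_fderiv hc))

lemma integrable_cut (hu : LocallyIntegrable u) (hχ : Continuous χ)
    (hc : HasCompactSupport χ) : Integrable (fun y => χ y * u y) :=
  hu.integrable_smul_left_of_hasCompactSupport hχ hc

lemma maxwell_le (hβ : 0 < β) (v : E) : maxwell β v ≤ maxwellConst E β := by
  rw [maxwell_eq]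
  refine mul_le_of_le_one_right (maxwellConst_pos hβ).le (Real.exp_le_one_iff.2 ?_)
  have : 0 ≤ β / 2 * ‖v‖ ^ 2 := by positivity
  linarith

lemma integrable_gauss_of_integrable {F : Type*} [NormedAddCommGroup F] [NormedSpace ℝ F]
    (hβ : 0 < β) {X : E → F} (hX : Integrable X) : Integrable X (gauss E β) := by
  rw [integrable_gauss_iff hβ]
  refine (hX.norm.const_mul (maxwellConst E β)).mono'
    ((continuous_maxwell β).aestronglyMeasurable.smul hX.aestronglyMeasurable)
    (Eventually.of_forall fun v => ?_)
  rw [norm_smul, Real.norm_of_nonneg (maxwell_pos hβ v).le]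
  exact mul_le_mul_of_nonneg_right (maxwell_le hβ v) (norm_nonneg _)

/-- The semigroup maps integrable functions to bounded functions with bounded gradient. -/
lemma exists_ou_bound (hβ : 0 < β) (hs : 0 < s) (hh : Integrable h) :
    ∃ B, ∀ v, |ornsteinUhlenbeck β s h v| ≤ B ∧ ‖ouGrad β s h v‖ ≤ B := by
  have hab := isMehlerPair_exp hs
  have hb := hab.pos_right
  obtain ⟨C, hC, hCb⟩ := maxwell_shift_le (E := E) hβ hab 0
  have hm : ∀ z : E, (1 + ‖z‖) * maxwell β z ≤ C * maxwellConst E β := fun z => by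
    have := hCb 0 z (by simp)
    rw [smul_zero, sub_zero] at this
    exact this.trans (mul_le_mul_of_nonneg_left (maxwell_le hβ _) hC.le)
  have hi := ((hh.comp_smul hb.ne').norm).mul_const (C * maxwellConst E β)
  refine ⟨max (∫ z, ‖h (√(1 - Real.exp (-2 * s)) • z)‖ * (C * maxwellConst E β))
    (|ouFactor β s| * ∫ z, ‖h (√(1 - Real.exp (-2 * s)) • z)‖ * (C * maxwellConst E β)),
    fun v => ⟨?_, ?_⟩⟩
  · refine le_trans ?_ (le_max_left _ _)
    have h1 := integral_mehler_eq (a := Real.exp (-s)) (h := h) hβ hb (fun _ : E => (1 : ℝ)) v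
    simp only [smul_eq_mul, mul_one] at h1
    rw [ornsteinUhlenbeck, h1, ← Real.norm_eq_abs]
    refine norm_integral_le_of_norm_le hi (Eventually.of_forall fun z => ?_)
    rw [norm_mul]
    refine mul_le_mul_of_nonneg_left ?_ (norm_nonneg _)
    have h2 := hm (z - (Real.exp (-s) / √(1 - Real.exp (-2 * s))) • v)
    have h3 := maxwell_pos hβ (z - (Real.exp (-s) / √(1 - Real.exp (-2 * s))) • v)
    rw [Real.norm_of_nonneg h3.le]
    nlinarith [norm_nonneg (z - (Real.exp (-s) / √(1 - Real.exp (-2 * s))) • v)]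
  · refine le_trans ?_ (le_max_right _ _)
    rw [ouGrad, norm_smul, integral_mehler_eq hβ hb (fun x : E => x)]
    refine mul_le_mul_of_nonneg_left ?_ (abs_nonneg _)
    refine norm_integral_le_of_norm_le hi (Eventually.of_forall fun z => ?_)
    rw [norm_smul, norm_smul]
    refine mul_le_mul_of_nonneg_left ?_ (norm_nonneg _)
    have h2 := hm (z - (Real.exp (-s) / √(1 - Real.exp (-2 * s))) • v)
    have h3 := maxwell_pos hβ (z - (Real.exp (-s) / √(1 - Real.exp (-2 * s))) • v)
    rw [Real.norm_of_nonneg h3.le]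
    linarith

lemma fderiv_maxwell_kernel (w y e : E) :
    fderiv ℝ (fun y => maxwell β (b⁻¹ • (y - w))) y e =
      -(β / b) * (maxwell β (b⁻¹ • (y - w)) * ⟪b⁻¹ • (y - w), e⟫_ℝ) := by
  have h1 : HasFDerivAt (fun y : E => b⁻¹ • (y - w)) (b⁻¹ • ContinuousLinearMap.id ℝ E) y :=
    ((hasFDerivAt_id y).sub_const w).const_smul b⁻¹
  have h2 := (hasFDerivAt_maxwell β (b⁻¹ • (y - w))).comp y h1
  rw [Function.comp_def] at h2
  rw [h2.fderiv]
  generalize b⁻¹ • (y - w) = z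
  simp
  ring

/-- Integration by parts against the Gaussian kernel. -/
lemma integral_cut_mul_fderiv_kernel (hu : IsWeakGradient u G) (hχ : ContDiff ℝ ∞ χ)
    (hc : HasCompactSupport χ) {ψ : E → ℝ} (hψ : ContDiff ℝ ∞ ψ) (e : E) :
    ∫ y, χ y * u y * fderiv ℝ ψ y e = -∫ y, ψ y * ⟪cutGrad χ u G y, e⟫_ℝ := by
  have hd := hχ.differentiable (by simp)
  have hdψ := hψ.differentiable (by simp)
  have hcont : Continuous fun y => fderiv ℝ χ y e :=
    (hχ.continuous_fderiv (by simp)).clm_apply continuous_const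
  have hcontψ : Continuous fun y => fderiv ℝ ψ y e :=
    (hψ.continuous_fderiv (by simp)).clm_apply continuous_const
  have hcs : HasCompactSupport fun y => fderiv ℝ χ y e := hc.fderiv_apply ℝ e
  -- `ψ` need not have compact support, but `χ ψ` is an admissible test function. The term in which
  -- the derivative falls on `χ` is the one that `cutGrad` adds to `χ G`.
  have key := hu.2.2 (fun y => χ y * ψ y) (hχ.mul hψ) hc.mul_right e
  have hprod : ∀ y, fderiv ℝ (fun y => χ y * ψ y) y e =
      χ y * fderiv ℝ ψ y e + ψ y * fderiv ℝ χ y e := fun y => by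
    rw [fderiv_fun_mul (hd y) (hdψ y)]
    simp
  simp only [hprod] at key
  have i1 : Integrable fun y => χ y * u y * fderiv ℝ ψ y e :=
    (hu.1.integrable_smul_left_of_hasCompactSupport (g := fun y => χ y * fderiv ℝ ψ y e)
      (hχ.continuous.mul hcontψ) hc.mul_right).congr (Eventually.of_forall fun y => by
        simp only [smul_eq_mul]; ring)
  have i2 : Integrable fun y => u y * fderiv ℝ χ y e * ψ y :=
    (hu.1.integrable_smul_left_of_hasCompactSupport (g := fun y => fderiv ℝ χ y e * ψ y)
      (hcont.mul hψ.continuous) hcs.mul_right).congr (Eventually.of_forall fun y => by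
        simp only [smul_eq_mul]; ring)
  have i3 : Integrable fun y => ⟪G y, e⟫_ℝ * (χ y * ψ y) := by
    have h1 := hu.2.1.integrable_smul_left_of_hasCompactSupport (g := fun y => χ y * ψ y)
      (hχ.continuous.mul hψ.continuous) hc.mul_right
    refine (h1.inner_const (𝕜 := ℝ) e).congr (Eventually.of_forall fun y => ?_)
    simp only [real_inner_smul_left]; ring
  have e1 : ∫ y, u y * (χ y * fderiv ℝ ψ y e + ψ y * fderiv ℝ χ y e) =
      (∫ y, χ y * u y * fderiv ℝ ψ y e) + ∫ y, u y * fderiv ℝ χ y e * ψ y := by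
    rw [← integral_add i1 i2]
    refine integral_congr_ae (Eventually.of_forall fun y => ?_)
    simp only; ring
  have e2 : ∫ y, ψ y * ⟪cutGrad χ u G y, e⟫_ℝ =
      (∫ y, ⟪G y, e⟫_ℝ * (χ y * ψ y)) + ∫ y, u y * fderiv ℝ χ y e * ψ y := by
    rw [← integral_add i3 i2]
    refine integral_congr_ae (Eventually.of_forall fun y => ?_)
    simp only [inner_cutGrad]; ring
  rw [e1] at key
  rw [e2]
  linarith

/-- The Ornstein-Uhlenbeck semigroup commutes with the weak gradient, up to the factor `e⁻ˢ`. -/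
lemma ouGrad_cut (hβ : 0 < β) (hs : 0 < s) (hu : IsWeakGradient u G) (hχ : ContDiff ℝ ∞ χ)
    (hc : HasCompactSupport χ) (v : E) :
    ouGrad β s (fun y => χ y * u y) v =
      Real.exp (-s) • ∫ x, cutGrad χ u G (mehler s (v, x)) ∂gauss E β := by
  have hab := isMehlerPair_exp hs
  have hb := hab.pos_right
  have hK := integrable_cutGrad hu hχ hc
  have hk := integrable_gauss_of_integrable hβ (integrable_cut hu.1 hχ.continuous hc)
  have hi1 := integrable_mehler_smul hβ hab hk v
  simp only [mehler]
  rw [ouGrad]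
  generalize Real.exp (-s) = a at *
  generalize √(1 - Real.exp (-2 * s)) = b at *
  refine ext_inner_right ℝ fun e => ?_
  have hψ : ContDiff ℝ ∞ fun y : E => maxwell β (b⁻¹ • (y - a • v)) :=
    (contDiff_maxwell β).comp (contDiff_const.smul (contDiff_id.sub contDiff_const))
  have hKi : Integrable fun y => maxwell β (b⁻¹ • (y - a • v)) • cutGrad χ u G y := by
    refine (hK.norm.const_mul (maxwellConst E β)).mono'
      (hψ.continuous.aestronglyMeasurable.smul hK.aestronglyMeasurable)
      (Eventually.of_forall fun y => ?_)
    rw [norm_smul, Real.norm_of_nonneg (maxwell_pos hβ _).le]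
    exact mul_le_mul_of_nonneg_right (maxwell_le hβ _) (norm_nonneg _)
  have e1 : ⟪∫ x, (χ (a • v + b • x) * u (a • v + b • x)) • x ∂gauss E β, e⟫_ℝ =
      |(b ^ Module.finrank ℝ E)⁻¹| * ∫ y, maxwell β (b⁻¹ • (y - a • v)) *
        (χ y * u y * ⟪b⁻¹ • (y - a • v), e⟫_ℝ) := by
    rw [real_inner_comm, ← integral_inner hi1]
    have := integral_mehler_eq_kernel hβ hb
      (fun y => χ y * u y * ⟪b⁻¹ • (y - a • v), e⟫_ℝ) (a • v)
    simp only [add_sub_cancel_left, inv_smul_smul₀ hb.ne', smul_eq_mul] at this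
    rw [← this]
    refine integral_congr_ae (Eventually.of_forall fun x => ?_)
    simp only [real_inner_smul_right, real_inner_comm e]
  have e2 : ⟪∫ x, cutGrad χ u G (a • v + b • x) ∂gauss E β, e⟫_ℝ =
      |(b ^ Module.finrank ℝ E)⁻¹| * ∫ y, maxwell β (b⁻¹ • (y - a • v)) *
        ⟪cutGrad χ u G y, e⟫_ℝ := by
    rw [integral_mehler_eq_kernel hβ hb, real_inner_smul_left, real_inner_comm,
      ← integral_inner hKi]
    congr 1
    refine integral_congr_ae (Eventually.of_forall fun y => ?_)
    simp only [real_inner_smul_right, real_inner_comm e]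
  have e3 := integral_cut_mul_fderiv_kernel hu hχ hc hψ e
  simp only [fderiv_maxwell_kernel] at e3
  have e4 : ∫ y, χ y * u y * (-(β / b) * (maxwell β (b⁻¹ • (y - a • v)) *
      ⟪b⁻¹ • (y - a • v), e⟫_ℝ)) = -(β / b) * ∫ y, maxwell β (b⁻¹ • (y - a • v)) *
        (χ y * u y * ⟪b⁻¹ • (y - a • v), e⟫_ℝ) := by
    rw [← integral_const_mul]
    refine integral_congr_ae (Eventually.of_forall fun y => ?_)
    simp only; ring
  rw [e4] at e3
  rw [real_inner_smul_left, real_inner_smul_left, e1, e2]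
  linear_combination (-a * |(b ^ Module.finrank ℝ E)⁻¹|) * e3

end Cutoff

/-! ### Finite entropy from `√h ∈ H¹(γ)` -/

section SobolevEntropy

variable {E : Type*} [NormedAddCommGroup E] [InnerProductSpace ℝ E] [FiniteDimensional ℝ E]
  [MeasurableSpace E] [BorelSpace E] {β s : ℝ} {h u χ : E → ℝ} {G : E → E}

/-- Dilations of one bump function by factors `n + 1 ≥ 1`; dilating does not increase the gradient,
so `C` is independent of `n`. -/
lemma exists_cutoff (E : Type*) [NormedAddCommGroup E] [InnerProductSpace ℝ E]
    [FiniteDimensional ℝ E] : ∃ C : ℝ, 0 ≤ C ∧ ∃ χ : ℕ → E → ℝ, ∀ n,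
      ContDiff ℝ ∞ (χ n) ∧ HasCompactSupport (χ n) ∧ (∀ v, |χ n v| ≤ 1) ∧
      (∀ v, ‖fderiv ℝ (χ n) v‖ ≤ C) ∧ ∀ v : E, ‖v‖ ≤ n + 1 → χ n v = 1 := by
  let f : ContDiffBump (0 : E) := ⟨1, 2, one_pos, by norm_num⟩
  have hf : ContDiff ℝ ∞ f := f.contDiff
  obtain ⟨C, hC⟩ := (hf.continuous_fderiv (by simp)).bounded_above_of_compact_support
    (f.hasCompactSupport.fderiv ℝ)
  have hC0 : 0 ≤ C := (norm_nonneg _).trans (hC 0)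
  refine ⟨C, hC0, fun n v => f (((n : ℝ) + 1)⁻¹ • v), fun n => ⟨?_, ?_, ?_, ?_, ?_⟩⟩
  · exact hf.comp (contDiff_const_smul _)
  · exact f.hasCompactSupport.comp_smul (by positivity)
  · intro v
    rw [abs_of_nonneg f.nonneg]
    exact f.le_one
  · intro v
    have h1 : HasFDerivAt (fun v : E => ((n : ℝ) + 1)⁻¹ • v)
        (((n : ℝ) + 1)⁻¹ • ContinuousLinearMap.id ℝ E) v := (hasFDerivAt_id v).const_smul _
    have h2 := ((hf.differentiable (by simp)) (((n : ℝ) + 1)⁻¹ • v)).hasFDerivAt.comp v h1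
    rw [Function.comp_def] at h2
    rw [h2.fderiv, ContinuousLinearMap.comp_smul, ContinuousLinearMap.comp_id, norm_smul,
      Real.norm_of_nonneg (by positivity)]
    refine (mul_le_of_le_one_left (norm_nonneg _) (inv_le_one_of_one_le₀ ?_)).trans (hC _)
    linarith [n.cast_nonneg (α := ℝ)]
  · intro v hv
    refine f.one_of_mem_closedBall ?_
    rw [mem_closedBall_zero_iff, norm_smul, Real.norm_of_nonneg (by positivity),
      inv_mul_le_iff₀ (by positivity)]
    exact hv.trans_eq (mul_one _).symm

/-- Jensen's inequality for the square of the norm. -/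
lemma norm_mehler_sq_le {F : Type*} [NormedAddCommGroup F] [NormedSpace ℝ F] (hβ : 0 < β)
    (hs : 0 ≤ s) {X : E → F} (hX : Integrable X (gauss E β))
    (hX2 : Integrable (fun v => ‖X v‖ ^ 2) (gauss E β)) :
    ∀ᵐ v ∂gauss E β, ‖∫ x, X (mehler s (v, x)) ∂gauss E β‖ ^ 2 ≤
      ornsteinUhlenbeck β s (fun v => ‖X v‖ ^ 2) v := by
  have := isProbabilityMeasure_gauss (E := E) hβ
  have hM := measurePreserving_mehlerMap (E := E) hβ hs
  filter_upwards [(hM.integrable_comp_of_integrable hX).prod_right_ae, avg_ae_integrable hM hX2]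
    with v h1 h2
  have := norm_integral_smul_sq_le (κ := gauss E β) (p := fun _ => (1 : ℝ))
    (X := fun x => X (mehler s (v, x))) (Eventually.of_forall fun _ => zero_le_one)
    (integrable_const 1) (by simpa using h2) h1.aestronglyMeasurable
  simp only [one_smul, one_mul, integral_const, probReal_univ] at this
  exact this

lemma integral_norm_mehler_sq_le {F : Type*} [NormedAddCommGroup F] [NormedSpace ℝ F] (hβ : 0 < β)
    (hs : 0 ≤ s) {X : E → F} (hX : Integrable X (gauss E β))
    (hX2 : Integrable (fun v => ‖X v‖ ^ 2) (gauss E β)) :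
    ∫ v, ‖∫ x, X (mehler s (v, x)) ∂gauss E β‖ ^ 2 ∂gauss E β ≤ ∫ v, ‖X v‖ ^ 2 ∂gauss E β := by
  have := isProbabilityMeasure_gauss (E := E) hβ
  have hM := measurePreserving_mehlerMap (E := E) hβ hs
  rw [← integral_avg hM hX2]
  exact integral_mono_of_nonneg (Eventually.of_forall fun v => sq_nonneg _)
    (integrable_avg hM hX2) (norm_mehler_sq_le hβ hs hX hX2)

lemma norm_cutGrad_sq_le {C : ℝ} (h1 : ∀ v, |χ v| ≤ 1) (hC : ∀ v, ‖fderiv ℝ χ v‖ ≤ C) (v : E) :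
    ‖cutGrad χ u G v‖ ^ 2 ≤ 2 * ‖G v‖ ^ 2 + 2 * C ^ 2 * ‖u v‖ ^ 2 := by
  have h2 : ‖cutGrad χ u G v‖ ≤ ‖G v‖ + C * ‖u v‖ := by
    refine (norm_add_le _ _).trans ?_
    rw [norm_smul, norm_smul, LinearIsometryEquiv.norm_map, mul_comm ‖u v‖]
    exact add_le_add (mul_le_of_le_one_left (norm_nonneg _) (h1 v))
      (mul_le_mul_of_nonneg_right (hC v) (norm_nonneg _))
  have h3 := pow_le_pow_left₀ (norm_nonneg _) h2 2
  nlinarith [sq_nonneg (‖G v‖ - C * ‖u v‖)]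

/-- The smoothed cut-off square roots have bounded entropy, by the logarithmic Sobolev
inequality. -/
lemma entropy_cut_le (hβ : 0 < β) (hs : 0 < s) (hu : IsWeakGradient u G)
    (hu2 : Integrable (fun v => ‖u v‖ ^ 2) (gauss E β))
    (hG2 : Integrable (fun v => ‖G v‖ ^ 2) (gauss E β)) (hχ : ContDiff ℝ ∞ χ)
    (hc : HasCompactSupport χ) {C : ℝ} (h1 : ∀ v, |χ v| ≤ 1) (hC : ∀ v, ‖fderiv ℝ χ v‖ ≤ C)
    {ε : ℝ} (hε : 0 < ε) (hε1 : ε ≤ 1) :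
    ∫⁻ v, ENNReal.ofReal
        (klFun (ε + ornsteinUhlenbeck β s (fun y => χ y * u y) v ^ 2)) ∂gauss E β ≤
      ENNReal.ofReal (1 + klFun (1 + ∫ v, ‖u v‖ ^ 2 ∂gauss E β) + 1 / (2 * β) *
        (4 * ∫ v, (2 * ‖G v‖ ^ 2 + 2 * C ^ 2 * ‖u v‖ ^ 2) ∂gauss E β)) := by
  have := isProbabilityMeasure_gauss (E := E) hβ
  have hkv := integrable_cut hu.1 hχ.continuous hc
  have hk := integrable_gauss_of_integrable hβ hkv
  have hK := integrable_gauss_of_integrable hβ (integrable_cutGrad hu hχ hc)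
  obtain ⟨B, hB⟩ := exists_ou_bound hβ hs hkv
  have hB0 : 0 ≤ B := (abs_nonneg _).trans (hB 0).1
  set w := ornsteinUhlenbeck β s fun y => χ y * u y with hw
  set W := ouGrad β s fun y => χ y * u y with hW
  have hk2 : ∀ v, ‖χ v * u v‖ ^ 2 ≤ ‖u v‖ ^ 2 := fun v => by
    rw [norm_mul]
    exact pow_le_pow_left₀ (by positivity) (mul_le_of_le_one_left (norm_nonneg _) (h1 v)) 2
  have hk2i : Integrable (fun v => ‖χ v * u v‖ ^ 2) (gauss E β) := by
    refine hu2.mono' (hk.aestronglyMeasurable.norm.pow 2) (Eventually.of_forall fun v => ?_)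
    rw [Real.norm_of_nonneg (sq_nonneg _)]
    exact hk2 v
  have hbdI : Integrable (fun v => 2 * ‖G v‖ ^ 2 + 2 * C ^ 2 * ‖u v‖ ^ 2) (gauss E β) :=
    (hG2.const_mul 2).add (hu2.const_mul (2 * C ^ 2))
  have hK2i : Integrable (fun v => ‖cutGrad χ u G v‖ ^ 2) (gauss E β) := by
    refine hbdI.mono' (hK.aestronglyMeasurable.norm.pow 2) (Eventually.of_forall fun v => ?_)
    rw [Real.norm_of_nonneg (sq_nonneg _)]
    exact norm_cutGrad_sq_le h1 hC v
  have hwd : ∀ v, HasFDerivAt w (innerSL ℝ (W v)) v := hasFDerivAt_ou hβ hs hk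
  have hWc : Continuous W := continuous_ouGrad hβ hs hk
  have hwc : Continuous w := continuous_iff_continuousAt.2 fun v => (hwd v).continuousAt
  -- Squaring leads from `√h` back to a density, and `ε` keeps it away from zero. Cutting off makes
  -- `χ u` Lebesgue integrable, which provides the bound `B` on `w` and on its gradient.
  have hnice : IsNice ε (ε + B ^ 2) (2 * B * B) (fun v => ε + w v ^ 2)
      (fun v => (2 * w v) • W v) := by
    refine ⟨hε, fun v => by nlinarith [sq_nonneg (w v)], fun v => ?_, fun v => ?_, by fun_prop,
      fun v => ?_⟩
    · have := pow_le_pow_left₀ (abs_nonneg _) (hB v).1 2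
      rw [sq_abs] at this
      linarith
    · refine (((hwd v).pow 2).const_add ε).congr_fderiv ?_
      ext e
      simp
    · rw [norm_smul, norm_mul, Real.norm_of_nonneg zero_le_two]
      gcongr
      exacts [(hB v).1, (hB v).2]
  have hW2i : Integrable (fun v => ‖W v‖ ^ 2) (gauss E β) :=
    Continuous.integrable_of_bound (by fun_prop) (B ^ 2) fun v => by
      rw [norm_pow, norm_norm]; exact pow_le_pow_left₀ (norm_nonneg _) (hB v).2 2
  have hw2i : Integrable (fun v => w v ^ 2) (gauss E β) :=
    Continuous.integrable_of_bound (by fun_prop) (B ^ 2) fun v => by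
      rw [norm_pow]; exact pow_le_pow_left₀ (norm_nonneg _) (hB v).1 2
  -- `∇w` is `e^{-s}` times the average of `cutGrad χ u G`; Jensen and `e^{-s} ≤ 1` bound it
  -- independently of `s`.
  have hW2 : ∫ v, ‖W v‖ ^ 2 ∂gauss E β ≤
      ∫ v, (2 * ‖G v‖ ^ 2 + 2 * C ^ 2 * ‖u v‖ ^ 2) ∂gauss E β := by
    refine le_trans ?_ ((integral_norm_mehler_sq_le hβ hs.le hK hK2i).trans
      (integral_mono hK2i hbdI (norm_cutGrad_sq_le h1 hC)))
    refine integral_mono hW2i ?_ fun v => ?_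
    · have := (hW2i.const_mul ((Real.exp (-s))⁻¹ ^ 2))
      refine this.congr (Eventually.of_forall fun v => ?_)
      simp only [hW, ouGrad_cut hβ hs hu hχ hc, norm_smul, mul_pow, 
        Real.norm_of_nonneg (Real.exp_pos (-s)).le]
      field_simp
    · simp only [hW, ouGrad_cut hβ hs hu hχ hc, norm_smul, mul_pow]
      refine mul_le_of_le_one_left (sq_nonneg _) (pow_le_one₀ (norm_nonneg _) ?_)
      rw [Real.norm_of_nonneg (Real.exp_pos _).le]
      exact Real.exp_le_one_iff.2 (by linarith)
  have hw2 : ∫ v, w v ^ 2 ∂gauss E β ≤ ∫ v, ‖u v‖ ^ 2 ∂gauss E β := by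
    have h2 := integral_norm_mehler_sq_le hβ hs.le hk hk2i
    simp only [Real.norm_eq_abs, sq_abs] at h2
    refine h2.trans (integral_mono ?_ hu2 fun v => ?_)
    · simpa only [Real.norm_eq_abs, sq_abs] using hk2i
    · simpa only [Real.norm_eq_abs, sq_abs] using hk2 v
  -- `‖2 w W‖²/(ε + w²) ≤ 4 ‖W‖²`: the information of a square is controlled by a Dirichlet
  -- integral, uniformly in `ε`.
  have hsf : smoothFisher β (fun v => ε + w v ^ 2) ≤ 4 * ∫ v, ‖W v‖ ^ 2 ∂gauss E β := by
    rw [hnice.smoothFisher_eq, ← integral_const_mul]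
    refine integral_mono (Continuous.integrable_of_bound hnice.continuous_ratio _
      hnice.norm_ratio_le) (hW2i.const_mul 4) fun v => ?_
    simp only
    have hp : 0 < ε + w v ^ 2 := by positivity
    rw [div_le_iff₀ hp, norm_smul, norm_mul, Real.norm_of_nonneg zero_le_two, mul_pow, mul_pow,
      Real.norm_eq_abs, sq_abs]
    nlinarith [mul_nonneg hε.le (sq_nonneg ‖W v‖)]
  have hkl : klFun (∫ v, (ε + w v ^ 2) ∂gauss E β) ≤
      1 + klFun (1 + ∫ v, ‖u v‖ ^ 2 ∂gauss E β) := by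
    have h3 : 0 ≤ ∫ v, w v ^ 2 ∂gauss E β := integral_nonneg fun v => sq_nonneg _
    have h4 : 0 ≤ ∫ v, ‖u v‖ ^ 2 ∂gauss E β := integral_nonneg fun v => sq_nonneg _
    rw [integral_add (integrable_const _) hw2i, integral_const, probReal_univ, one_smul]
    exact klFun_le_one_add (by positivity) (by positivity) (le_max_of_le_left (by linarith))
  have hkI : Integrable (fun v => klFun (ε + w v ^ 2)) (gauss E β) :=
    Continuous.integrable_of_bound (continuous_klFun.comp hnice.continuous)
      (1 + klFun (ε + B ^ 2)) fun v => by
        rw [Real.norm_of_nonneg (klFun_nonneg (hnice.pos' v).le)]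
        exact hnice.klFun_le v
  rw [← ofReal_integral_eq_lintegral_ofReal hkI
    (Eventually.of_forall fun v => klFun_nonneg (hnice.pos' v).le)]
  refine ENNReal.ofReal_le_ofReal ((hnice.entropy_le hβ).trans (add_le_add hkl ?_))
  refine mul_le_mul_of_nonneg_left (hsf.trans ?_) (by positivity)
  linarith

/-- A nonnegative function whose square root is in `H¹(γ)` has finite entropy. -/
theorem integrable_klFun_of_memH1 (hβ : 0 < β) (h0 : 0 ≤ᵐ[gauss E β] h)
    (hm : AEStronglyMeasurable h (gauss E β)) (hh : MemH1Gauss β fun v => √(h v)) :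
    Integrable (fun v => klFun (h v)) (gauss E β) := by
  have := isProbabilityMeasure_gauss (E := E) hβ
  obtain ⟨hu, G, hG, hGL⟩ := hh
  set u := fun v => √(h v) with hudef
  have hu1 : Integrable u (gauss E β) := hu.integrable (by norm_num)
  have hu2 : Integrable (fun v => ‖u v‖ ^ 2) (gauss E β) := hu.integrable_norm_pow two_ne_zero
  have hG2 : Integrable (fun v => ‖G v‖ ^ 2) (gauss E β) := hGL.integrable_norm_pow two_ne_zero
  obtain ⟨C, hC0, χ, hχ⟩ := exists_cutoff E
  -- The index `n` governs the cut-off radius, the smoothing time and the constant `ε` together; the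
  -- bound of `entropy_cut_le` depends on none of them.
  have hs : ∀ n : ℕ, 0 < 1 / ((n : ℝ) + 1) := fun n => by positivity
  have hslim := tendsto_one_div_add_atTop_nhds_zero_nat (𝕜 := ℝ)
  set k : ℕ → E → ℝ := fun n y => χ n y * u y with hkdef
  have hki : ∀ n, Integrable (k n) (gauss E β) := fun n =>
    integrable_gauss_of_integrable hβ (integrable_cut hG.1 (hχ n).1.continuous (hχ n).2.1)
  set w : ℕ → E → ℝ := fun n => ornsteinUhlenbeck β (1 / ((n : ℝ) + 1)) (k n) with hwdef
  have hwi : ∀ n, Integrable (w n) (gauss E β) := fun n => integrable_ou hβ (hs n).le (hki n)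
  have hk : Tendsto (fun n => ∫ v, |k n v - u v| ∂gauss E β) atTop (𝓝 0) := by
    have key := tendsto_integral_of_dominated_convergence (μ := gauss E β)
      (F := fun n v => |k n v - u v|) (f := fun _ => 0) (fun v => 2 * ‖u v‖)
      (fun n => ((hki n).sub hu1).abs.aestronglyMeasurable) (hu1.norm.const_mul 2)
      (fun n => Eventually.of_forall fun v => ?_) (Eventually.of_forall fun v => ?_)
    · simpa using key
    · rw [Real.norm_eq_abs, abs_abs]
      have h1 := abs_sub (χ n v * u v) (u v)
      have h2 := mul_le_of_le_one_left (abs_nonneg (u v)) ((hχ n).2.2.1 v)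
      rw [abs_mul] at h1
      rw [Real.norm_eq_abs]
      linarith
    · refine tendsto_const_nhds.congr' ?_
      filter_upwards [tendsto_natCast_atTop_atTop.eventually_ge_atTop ‖v‖] with n hn
      simp only [hkdef, (hχ n).2.2.2.2 v (by linarith), one_mul, sub_self, abs_zero]
  have hw : Tendsto (fun n => ∫ v, |w n v - u v| ∂gauss E β) atTop (𝓝 0) := by
    have hlim := hk.add (tendsto_integral_ou_sub hβ hslim (fun n => (hs n).le) hu1)
    rw [add_zero] at hlim
    refine squeeze_zero (fun n => integral_nonneg fun v => abs_nonneg _) (fun n => ?_) hlim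
    refine le_trans ?_ (add_le_add_left (integral_abs_ou_sub_le hβ (hs n).le (hki n) hu1) _)
    have hPu := integrable_ou hβ (hs n).le hu1
    have i1 : Integrable (fun v => |w n v - ornsteinUhlenbeck β (1 / ((n : ℝ) + 1)) u v|)
        (gauss E β) := ((hwi n).sub hPu).abs
    have i2 : Integrable (fun v => |ornsteinUhlenbeck β (1 / ((n : ℝ) + 1)) u v - u v|)
        (gauss E β) := (hPu.sub hu1).abs
    change _ ≤ (∫ v, |w n v - ornsteinUhlenbeck β (1 / ((n : ℝ) + 1)) u v| ∂gauss E β) + _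
    rw [← integral_add i1 i2]
    exact integral_mono ((hwi n).sub hu1).abs (i1.add i2) fun v => abs_sub_le _ _ _
  obtain ⟨ns, hns, hlim⟩ := (tendstoInMeasure_of_tendsto_eLpNorm one_ne_zero
    (fun n => (hwi n).aestronglyMeasurable) hu1.aestronglyMeasurable
    (tendsto_eLpNorm_one_of_integral hwi hu1 hw)).exists_seq_tendsto_ae
  have hF : Continuous fun x => ENNReal.ofReal (klFun x) :=
    ENNReal.continuous_ofReal.comp continuous_klFun
  refine integrable_klFun_of_lintegral ENNReal.ofReal_ne_top hm h0 (S := ENNReal.ofReal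
    (1 + klFun (1 + ∫ v, ‖u v‖ ^ 2 ∂gauss E β) + 1 / (2 * β) *
      (4 * ∫ v, (2 * ‖G v‖ ^ 2 + 2 * C ^ 2 * ‖u v‖ ^ 2) ∂gauss E β))) ?_
  calc ∫⁻ v, ENNReal.ofReal (klFun (h v)) ∂gauss E β
      = ∫⁻ v, liminf (fun i => ENNReal.ofReal
          (klFun (1 / ((ns i : ℝ) + 1) + w (ns i) v ^ 2))) atTop ∂gauss E β := by
        refine lintegral_congr_ae ?_
        filter_upwards [hlim, h0] with v hv hv0
        have h1 := (hslim.comp hns.tendsto_atTop).add (hv.pow 2)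
        rw [zero_add, Real.sq_sqrt hv0] at h1
        exact (((hF.tendsto _).comp h1).liminf_eq).symm
    _ ≤ liminf (fun i => ∫⁻ v, ENNReal.ofReal
          (klFun (1 / ((ns i : ℝ) + 1) + w (ns i) v ^ 2)) ∂gauss E β) atTop :=
        lintegral_liminf_le' fun i => hF.measurable.comp_aemeasurable
          (((hwi _).aestronglyMeasurable.aemeasurable.pow_const 2).const_add _)
    _ ≤ _ := by
        refine liminf_le_of_le (by isBoundedDefault) fun b hb => ?_
        obtain ⟨i, hi⟩ := hb.exists
        refine hi.trans ?_
        obtain ⟨c1, c2, c3, c4, -⟩ := hχ (ns i)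
        exact entropy_cut_le hβ (hs _) hG hu2 hG2 c1 c2 c3 c4 (hs _) (one_div_succ_le_one _)

end SobolevEntropy

/-! ### Weak gradients, and the comparison of entropies -/

section WeakGradient

variable {E : Type*} [NormedAddCommGroup E] [InnerProductSpace ℝ E] [FiniteDimensional ℝ E]
  [MeasurableSpace E] [BorelSpace E] {β s : ℝ} {f h h₁ u : E → ℝ} {G G' : E → E}

lemma isWeakGradient_of_hasFDerivAt (hu : ∀ v, HasFDerivAt u (innerSL ℝ (G v)) v)
    (hG : Continuous G) : IsWeakGradient u G := by
  have huc : Continuous u := continuous_iff_continuousAt.2 fun v => (hu v).continuousAt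
  refine ⟨huc.locallyIntegrable, hG.locallyIntegrable, fun φ hφ hc e => ?_⟩
  have hφd : Continuous fun v => fderiv ℝ φ v e :=
    (hφ.continuous_fderiv (by simp)).clm_apply continuous_const
  have hφc := hφ.continuous
  have hfd : ∀ v, fderiv ℝ u v e = ⟪G v, e⟫_ℝ := fun v => by
    rw [(hu v).fderiv, innerSL_apply_apply]
  rw [integral_mul_fderiv_eq_neg_fderiv_mul_of_integrable]
  · simp only [hfd]
  · simp only [hfd]
    exact Continuous.integrable_of_hasCompactSupport (by fun_prop) hc.mul_left
  · exact Continuous.integrable_of_hasCompactSupport (by fun_prop)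
      (hc.fderiv_apply ℝ e).mul_left
  · exact Continuous.integrable_of_hasCompactSupport (by fun_prop) hc.mul_left
  · exact fun v _ => (hu v).differentiableAt
  · exact fun v _ => hφ.differentiable (by simp) v

lemma IsWeakGradient.ae_eq (h : IsWeakGradient u G) (h' : IsWeakGradient u G') : G =ᵐ[volume] G' := by
  refine ae_eq_of_integral_contDiff_smul_eq h.2.1 h'.2.1 fun φ hφ hc => ?_
  have i1 := h.2.1.integrable_smul_left_of_hasCompactSupport hφ.continuous hc
  have i2 := h'.2.1.integrable_smul_left_of_hasCompactSupport hφ.continuous hc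
  refine ext_inner_left ℝ fun e => ?_
  rw [← integral_inner i1, ← integral_inner i2]
  have h1 := h.2.2 φ hφ hc e
  rw [h'.2.2 φ hφ hc e] at h1
  simp only [real_inner_smul_right, mul_comm (φ _)]
  simp only [real_inner_comm] at h1 ⊢
  linarith

lemma weakGradient_ae_eq (h : IsWeakGradient u G) : weakGradient u =ᵐ[volume] G := by
  have hex : ∃ G, IsWeakGradient u G := ⟨G, h⟩
  rw [weakGradient, dif_pos hex]
  exact hex.choose_spec.ae_eq h

/-- `P_s h` is `C¹`, and weak gradients are unique up to null sets, so the chosen one agrees with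
the classical gradient almost everywhere. -/
lemma fisherInfo_ou (hβ : 0 < β) (hs : 0 < s) (hh : Integrable h (gauss E β)) :
    fisherInfo β (ornsteinUhlenbeck β s h) = smoothFisher β (ornsteinUhlenbeck β s h) := by
  have h1 := weakGradient_ae_eq (isWeakGradient_of_hasFDerivAt (hasFDerivAt_ou hβ hs hh)
    (continuous_ouGrad hβ hs hh))
  rw [smoothFisher_ou hβ hs hh]
  refine integral_congr_ae ?_
  filter_upwards [(ae_gauss_iff hβ).2 h1] with v hv
  rw [hv]

/-- `P_s h` is positive and `C¹`, so the gradient of its root is `∇P_s h / (2 √(P_s h))`. Its square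
is a quarter of the Fisher integrand, which the second moment of the noise dominates. -/
lemma FiniteEntropy.memH1_sqrt_ou (hh : FiniteEntropy β h) (hβ : 0 < β) (hs : 0 < s) :
    MemH1Gauss β fun v => √(ornsteinUhlenbeck β s h v) := by
  have := isProbabilityMeasure_gauss (E := E) hβ
  have hpos := ou_pos hβ hs hh.nonneg hh.integrable hh.pos
  have hd := hasFDerivAt_ou hβ hs hh.integrable
  have hGc := continuous_ouGrad hβ hs hh.integrable
  have hc : Continuous (ornsteinUhlenbeck β s h) :=
    continuous_iff_continuousAt.2 fun v => (hd v).continuousAt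
  have hsqrt : ∀ v, 0 < √(ornsteinUhlenbeck β s h v) := fun v => Real.sqrt_pos.2 (hpos v)
  have hGG : Continuous fun v => (1 / (2 * √(ornsteinUhlenbeck β s h v))) • ouGrad β s h v :=
    (continuous_const.div (by fun_prop) fun v => by have := hsqrt v; positivity).smul hGc
  have hmI := integrable_mehler_norm_sq hβ hs.le hh.integrable (hh.moment hβ)
  refine ⟨?_, fun v => (1 / (2 * √(ornsteinUhlenbeck β s h v))) • ouGrad β s h v,
    isWeakGradient_of_hasFDerivAt (fun v => ?_) hGG, ?_⟩
  · rw [memLp_two_iff_integrable_sq (by fun_prop)]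
    exact (integrable_ou hβ hs.le hh.integrable).congr
      (Eventually.of_forall fun v => (Real.sq_sqrt (hpos v).le).symm)
  · refine ((hd v).sqrt (hpos v).ne').congr_fderiv ?_
    rw [map_smul]
  · rw [memLp_two_iff_integrable_sq_norm hGG.aestronglyMeasurable]
    refine (hmI.integral_prod_left.const_mul (ouFactor β s ^ 2)).mono'
      (hGG.norm.pow 2).aestronglyMeasurable ?_
    filter_upwards [hmI.prod_right_ae] with v hv
    have h1 := norm_ouGrad_sq_div_le hβ hs hh.nonneg hh.integrable hv
    refine le_trans ?_ h1
    rw [Real.norm_of_nonneg (sq_nonneg _), norm_smul, mul_pow, Real.norm_eq_abs, sq_abs, div_pow,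
      mul_pow, Real.sq_sqrt (hpos v).le, one_pow, one_div_mul_eq_div]
    have h2 := hpos v
    gcongr
    linarith

lemma FiniteEntropy.isProbDensity_ou (hh : FiniteEntropy β h) (hβ : 0 < β) (hs : 0 < s)
    (h1 : ∫ v, h v ∂gauss E β = 1) : IsProbDensity (gauss E β) (ornsteinUhlenbeck β s h) := by
  have := isProbabilityMeasure_gauss (E := E) hβ
  refine ⟨Eventually.of_forall fun v =>
    (ou_pos hβ hs hh.nonneg hh.integrable hh.pos v).le, integrable_ou hβ hs.le hh.integrable, ?_⟩
  rw [← h1]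
  exact integral_avg (measurePreserving_mehlerMap hβ hs.le) hh.integrable

lemma FiniteEntropy.moment_ou (hh : FiniteEntropy β h) (hβ : 0 < β) (hs : 0 < s) :
    Integrable (fun v => ‖v‖ ^ 2 * ornsteinUhlenbeck β s h v) (gauss E β) :=
  integrable_norm_sq_mul hβ (integrable_ou hβ hs.le hh.integrable).aestronglyMeasurable
    (Eventually.of_forall fun v => (ou_pos hβ hs hh.nonneg hh.integrable hh.pos v).le)
    (hh.integrable_klFun_ou hβ hs.le)

/-- Passing to a measurable, everywhere nonnegative version is harmless: by `ou_congr_ae`, `P_s`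
with `s > 0` takes the same value at every point. -/
lemma exists_finiteEntropy (h0 : IsProbDensity (gauss E β) h)
    (hk : Integrable (fun v => klFun (h v)) (gauss E β)) :
    ∃ h', FiniteEntropy β h' ∧ h =ᵐ[gauss E β] h' := by
  obtain ⟨hnn, hi, h1⟩ := h0
  have hm := hi.aestronglyMeasurable
  have hae : h =ᵐ[gauss E β] fun v => |hm.mk h v| := by
    filter_upwards [hm.ae_eq_mk, hnn] with v hv hv0
    rw [← hv, abs_of_nonneg hv0]
  refine ⟨_, ⟨hm.measurable_mk.abs, fun v => abs_nonneg _, hi.congr hae, hk.congr ?_, ?_⟩, hae⟩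
  · filter_upwards [hae] with v hv
    rw [← hv]
  · rw [← integral_congr_ae hae, h1]
    exact one_pos

/-- A bound on the Fisher information along the Ornstein-Uhlenbeck flow gives the same bound on
the entropy. -/
theorem entropy_le_of_fisherInfo_ou_le (hβ : 0 < β) {c : ℝ} (hh : IsProbDensity (gauss E β) h)
    (hk : Integrable (fun v => klFun (h v)) (gauss E β)) (hh₁ : IsProbDensity (gauss E β) h₁)
    (hk₁ : Integrable (fun v => klFun (h₁ v)) (gauss E β))
    (hc : ∀ s, 0 < s → fisherInfo β (ornsteinUhlenbeck β s h₁) ≤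
      c * fisherInfo β (ornsteinUhlenbeck β s h)) :
    ∫ v, klFun (h₁ v) ∂gauss E β ≤ c * ∫ v, klFun (h v) ∂gauss E β := by
  obtain ⟨g, hg, hgh⟩ := exists_finiteEntropy hh hk
  obtain ⟨g₁, hg₁, hgh₁⟩ := exists_finiteEntropy hh₁ hk₁
  have e : ∫ v, g v ∂gauss E β = 1 := by rw [← integral_congr_ae hgh, hh.2.2]
  have e₁ : ∫ v, g₁ v ∂gauss E β = 1 := by rw [← integral_congr_ae hgh₁, hh₁.2.2]
  have key : ∀ s, 0 < s → ∫ v, klFun (ornsteinUhlenbeck β s h₁ v) ∂gauss E β ≤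
      c * ∫ v, klFun (ornsteinUhlenbeck β s h v) ∂gauss E β := fun s hs => by
    obtain ⟨i, hi⟩ := hg.entropy_ou hβ hs
    obtain ⟨i₁, hi₁⟩ := hg₁.entropy_ou hβ hs
    -- Both masses are one and `klFun 1 = 0`, so only the time integrals of the information remain,
    -- and these are compared pointwise in `τ`.
    rw [ou_congr_ae hβ hs hgh, ou_congr_ae hβ hs hgh₁, hi, hi₁, e, e₁, klFun_one, zero_add,
      zero_add, mul_left_comm, ← integral_const_mul c]
    refine mul_le_mul_of_nonneg_left (setIntegral_mono_on i₁ (i.const_mul c) measurableSet_Ioi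
      fun τ hτ => ?_) (by positivity)
    have hsτ : 0 < s + τ := add_pos hs hτ
    have := hc _ hsτ
    rwa [ou_congr_ae hβ hsτ hgh, ou_congr_ae hβ hsτ hgh₁, fisherInfo_ou hβ hsτ hg.integrable,
      fisherInfo_ou hβ hsτ hg₁.integrable] at this
  have hs : ∀ n : ℕ, 0 < 1 / ((n : ℝ) + 1) := fun n => by positivity
  have hslim := tendsto_one_div_add_atTop_nhds_zero_nat (𝕜 := ℝ)
  -- The limit `s → 0` is taken in the entropies only; the information at `s = 0` is never compared.
  exact le_of_tendsto_of_tendsto' (tendsto_entropy_ou hβ hslim (fun n => (hs n).le) hh₁.2.1 hh₁.1 hk₁)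
    ((tendsto_entropy_ou hβ hslim (fun n => (hs n).le) hh.2.1 hh.1 hk).const_mul c)
    fun n => key _ (hs n)

lemma entropyIntegrand_eq (hβ : 0 < β) (f : E → ℝ) (v : E) : entropyIntegrand β f v =
    maxwell β v • (klFun (f v / maxwell β v) + f v / maxwell β v - 1) := by
  have := maxwell_pos hβ v
  rw [entropyIntegrand, klFun_apply, smul_eq_mul]
  field_simp
  ring

lemma integrable_entropyIntegrand (hβ : 0 < β)
    (hh : IsProbDensity (gauss E β) fun v => f v / maxwell β v)
    (hk : Integrable (fun v => klFun (f v / maxwell β v)) (gauss E β)) :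
    Integrable (entropyIntegrand β f) := by
  have := isProbabilityMeasure_gauss (E := E) hβ
  rw [funext (entropyIntegrand_eq hβ f)]
  exact (integrable_gauss_iff hβ).1 ((hk.add hh.2.1).sub (integrable_const 1))

/-- `x log x = klFun x + x - 1`, and the linear part integrates to zero because `f` and `γ` both
have mass one. -/
lemma relEntropy_eq (hβ : 0 < β) (hh : IsProbDensity (gauss E β) fun v => f v / maxwell β v)
    (hk : Integrable (fun v => klFun (f v / maxwell β v)) (gauss E β)) :
    relEntropy β f = ∫ v, klFun (f v / maxwell β v) ∂gauss E β := by
  have := isProbabilityMeasure_gauss (E := E) hβ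
  have i1 : Integrable (fun v => klFun (f v / maxwell β v) + f v / maxwell β v) (gauss E β) :=
    hk.add hh.2.1
  rw [relEntropy, funext (entropyIntegrand_eq hβ f), ← integral_gauss hβ,
    integral_sub i1 (integrable_const 1), integral_add hk hh.2.1, hh.2.2]
  simp

lemma isProbDensity_div_maxwell (hβ : 0 < β) (hf : IsProbDensity volume f) :
    IsProbDensity (gauss E β) fun v => f v / maxwell β v := by
  obtain ⟨h0, hi, h1⟩ := hf
  refine ⟨(ae_gauss_iff hβ).2 ?_, (integrable_gauss_div_maxwell hβ).2 hi, ?_⟩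
  · filter_upwards [h0] with v hv using div_nonneg hv (maxwell_pos hβ v).le
  · rw [integral_gauss hβ, ← h1]
    refine integral_congr_ae (Eventually.of_forall fun v => ?_)
    have := (maxwell_pos hβ v).ne'
    simp only [smul_eq_mul]
    field_simp

end WeakGradient

end KacThermostat

end

/-! ### Conclusion: from a bound on the information to a bound on the entropy -/

theorem mainTheorem6 (d N : ℕ) (hN : 1 ≤ N) (β lam mu : ℝ) (hβ : 0 < β) (hlam : 0 < lam)
    (hmu : 0 < mu) (ρ : Measure (Direction d)) [IsProbabilityMeasure ρ]
    (hρ : SymmetryCondition ρ) (c : ℝ → ℝ)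
    (f : ℝ → State d N → ℝ) (hf : IsKacSolution β lam mu ρ f)
    (hf_density : IsProbDensity volume (f 0))
    (hf_sobolev : MemH1Gauss β (fun v => √(groundState β f 0 v)))
    (hf_energy : Integrable (fun v => ‖v‖ ^ 2 * f 0 v) volume) (t : ℝ) (ht : 0 ≤ t) :
    -- the relative entropies at the times `0` and `t` are finite
    (Integrable (entropyIntegrand β (f 0)) volume ∧
      Integrable (entropyIntegrand β (f t)) volume) ∧
    -- the bound on the information need only hold along the solutions that start from `P_s h_0`
    ((∀ s : ℝ, 0 ≤ s → ∀ g : ℝ → State d N → ℝ, IsTransformedSolution β lam mu ρ g →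
        g 0 = ornsteinUhlenbeck β s (groundState β f 0) →
        fisherInfo β (g t) ≤ c t * fisherInfo β (g 0)) →
      relEntropy β (f t) ≤ c t * relEntropy β (f 0)) ∧
    -- in particular, a bound that holds for all admissible initial data suffices
    ((∀ g : ℝ → State d N → ℝ, IsTransformedSolution β lam mu ρ g → IsAdmissible β (g 0) →
        fisherInfo β (g t) ≤ c t * fisherInfo β (g 0)) →
      relEntropy β (f t) ≤ c t * relEntropy β (f 0)) := by
  have h0 : IsProbDensity (gauss (State d N) β) (groundState β f 0) :=
    isProbDensity_div_maxwell hβ hf_density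
  have hk0 : Integrable (fun v => klFun (groundState β f 0 v)) (gauss (State d N) β) := integrable_klFun_of_memH1 hβ h0.1 h0.2.1.aestronglyMeasurable hf_sobolev
  have hsol := hf.groundState hβ
  obtain ⟨h1, hk1⟩ := hsol.isProbDensity hN hβ hlam hmu h0 hk0 ht
  have key : (∀ s, 0 < s → fisherInfo β (ornsteinUhlenbeck β s (groundState β f t)) ≤
      c t * fisherInfo β (ornsteinUhlenbeck β s (groundState β f 0))) →
      relEntropy β (f t) ≤ c t * relEntropy β (f 0) := fun hc => by
    rw [relEntropy_eq hβ h0 hk0, relEntropy_eq hβ h1 hk1]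
    exact entropy_le_of_fisherInfo_ou_le hβ h0 hk0 h1 hk1 hc
  refine ⟨⟨integrable_entropyIntegrand hβ h0 hk0, integrable_entropyIntegrand hβ h1 hk1⟩,
    fun hc => key fun s hs => ?_, fun hc => key fun s hs => ?_⟩
  · exact hc s hs.le (fun τ => ornsteinUhlenbeck β s (groundState β f τ)) (hsol.ornsteinUhlenbeck hβ hs.le) rfl
  · refine hc (fun τ => ornsteinUhlenbeck β s (groundState β f τ)) (hsol.ornsteinUhlenbeck hβ hs.le) ?_
    -- Admissibility of `P_s h_0` comes from finite entropy alone, which yields the Sobolev bound on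
    -- the root as well as the energy.
    obtain ⟨g, hg, hgae⟩ := exists_finiteEntropy h0 hk0
    have e : ∫ v, g v ∂gauss (State d N) β = 1 := by rw [← integral_congr_ae hgae, h0.2.2]
    simp only [ou_congr_ae hβ hs hgae]
    exact ⟨hg.isProbDensity_ou hβ hs e, hg.memH1_sqrt_ou hβ hs, hg.moment_ou hβ hs⟩
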